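/- Let $\hat K=[0,1]^2$, $k\in\mathbb N_0$, and let $\mathcal Q_{a,b}$ be the real polynomials of degree at most $a$ in $x$ and at most $b$ in $y$ (with $\mathcal Q_{-1,b}=\mathcal Q_{a,-1}=\{0\}$). Let $u\in L^1(\hat K)^2$ have a weak divergence $\operatorname{div}u\in L^1(\hat K)$ and an integrable normal trace $u\cdot n$ on the faces of $\hat K$: either $u$ is continuous on $\hat K$ and $u\cdot n$ is its pointwise normal component, or $u\cdot n\in L^1(\partial\hat K)$ satisfies $\int_{\partial\hat K}(u\cdot n)\,\varphi=\int_{\hat K}(u\cdot\nabla\varphi+\varphi\operatorname{div}u)$ for all $\varphi\in C^\infty(\mathbb R^2)$. Then there is exactly one $\hat I_{ABF}u\in ABF_k:=\mathcal Q_{k+2,k}\times\mathcal Q_{k,k+2}$, the Arnold–Boffi–Falk interpolant of $u$, such that $$\int_{F}(\hat I_{ABF}u-u)\cdot n\,q=0\quad\text{for every face }F\subset\partial\hat K\text{ and every polynomial }q\text{ on }F\text{ of degree}\le k,$$ $$\int_{\hat K}(\hat I_{ABF}u-u)\cdot q=0\quad\text{for all }q\in\mathcal Q_{k-1,k}\times\mathcal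 Q_{k,k-1},$$ $$\int_{\hat K}\operatorname{div}(\hat I_{ABF}u-u)\,x^iy^{k+1}=0\quad\text{and}\quad\int_{\hat K}\operatorname{div}(\hat I_{ABF}u-u)\,x^{k+1}y^i=0\quad\text{for all }0\le i\le k.$$ Let $1\le p<\infty$. (i) For every $1\le\ell\le k+2$ there is a constant $C=C(k,\ell,p)$ such that, for all such $u$ with $\operatorname{div}u\in W^{\ell,p}(\hat K)$, $$\|\operatorname{div}(u-\hat I_{ABF}u)\|_{L^p(\hat K)}\le C\sum_{\alpha_1+\alpha_2=\ell}\|\partial_x^{\alpha_1}\partial_y^{\alpha_2}\operatorname{div}u\|_{L^p(\hat K)}.$$ (ii) For every $1\le s\le k+1$ there is a constant $C=C(k,s,p)$ such that, for all such $u$ with $\operatorname{div}u\in W^{s,p}(\hat K)$, $$\|\operatorname{div}(u-\hat I_{ABF}u)\|_{L^p(\hat K)}\le C\left(\|\partial_x^{s}\operatorname{div}u\|_{L^p(\hat K)}+\|\partial_y^{s}\operatorname{div}u\|_{L^p(\hat K)}\right).$$ -/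

import Mathlib

open MeasureTheory
open scoped ENNReal NNReal ContDiff

namespace ABF

noncomputable section

/-- The closed reference square `[0,1]²`. -/
def refSquare : Set (ℝ × ℝ) := Set.Icc 0 1 ×ˢ Set.Icc 0 1

/-- The open reference square `(0,1)²`. -/
def openSquare : Set (ℝ × ℝ) := Set.Ioo 0 1 ×ˢ Set.Ioo 0 1

/-! ### Weak derivatives and Sobolev spaces on the square -/

/-- Classical partial derivative in `x`. -/
def dx (φ : ℝ × ℝ → ℝ) (z : ℝ × ℝ) : ℝ := fderiv ℝ φ z (1, 0)

/-- Classical partial derivative in `y`. -/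
def dy (φ : ℝ × ℝ → ℝ) (z : ℝ × ℝ) : ℝ := fderiv ℝ φ z (0, 1)

/-- Test functions: smooth, with compact support in the open square. -/
structure IsTestFunction (φ : ℝ × ℝ → ℝ) : Prop where
  smooth : ContDiff ℝ ∞ φ
  compactSupport : HasCompactSupport φ
  support_subset : tsupport φ ⊆ openSquare

/-- `g` is the weak derivative `∂_x^a ∂_y^b w` on the open square. -/
structure IsWeakPartial (a b : ℕ) (w g : ℝ × ℝ → ℝ) : Prop where
  locallyIntegrable : LocallyIntegrableOn w openSquare
  locallyIntegrable_deriv : LocallyIntegrableOn g openSquare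
  integral_eq : ∀ φ, IsTestFunction φ →
    ∫ z in openSquare, w z * (dx^[a] (dy^[b] φ)) z
      = (-1) ^ (a + b) * ∫ z in openSquare, g z * φ z

open Classical in
/-- The weak derivative `∂_x^a ∂_y^b w`, unique almost everywhere on the square if it exists
(and `0` by convention if it does not). -/
def weakPartial (a b : ℕ) (w : ℝ × ℝ → ℝ) : ℝ × ℝ → ℝ :=
  if h : ∃ g, IsWeakPartial a b w g then h.choose else 0

/-- The `L^p` norm over the reference square. -/
def normLp (p : ℝ≥0∞) (w : ℝ × ℝ → ℝ) : ℝ≥0∞ := eLpNorm w p (volume.restrict refSquare)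

/-- Membership in the Sobolev space `W^{ℓ,p}` of the reference square. -/
structure MemSobolev (ℓ : ℕ) (p : ℝ≥0∞) (w : ℝ × ℝ → ℝ) : Prop where
  memLp : MemLp w p (volume.restrict refSquare)
  exists_weakPartial : ∀ a b : ℕ, a + b ≤ ℓ →
    ∃ g, IsWeakPartial a b w g ∧ MemLp g p (volume.restrict refSquare)

/-- `w` is the weak divergence of the vector field `u` on the open square. -/
structure IsWeakDiv (u : ℝ × ℝ → ℝ × ℝ) (w : ℝ × ℝ → ℝ) : Prop where
  locallyIntegrable : LocallyIntegrableOn u openSquare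
  locallyIntegrable_div : LocallyIntegrableOn w openSquare
  integral_eq : ∀ φ, IsTestFunction φ →
    ∫ z in openSquare, ((u z).1 * dx φ z + (u z).2 * dy φ z)
      = - ∫ z in openSquare, w z * φ z

/-! ### Faces and normal traces -/

/-- The four faces of the reference square. -/
inductive Face
  | left
  | right
  | bottom
  | top

/-- The parametrisation of a face by `t ∈ [0,1]` (arc length). -/
def Face.param : Face → ℝ → ℝ × ℝ
  | .left, t => (0, t)
  | .right, t => (1, t)
  | .bottom, t => (t, 0)
  | .top, t => (t, 1)

/-- The outer unit normal on a face. -/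
def Face.normal : Face → ℝ × ℝ
  | .left => (-1, 0)
  | .right => (1, 0)
  | .bottom => (0, -1)
  | .top => (0, 1)

/-- The component of `v` in the direction `n`. -/
def dot (v n : ℝ × ℝ) : ℝ := v.1 * n.1 + v.2 * n.2

/-- The field `u` is continuous on the closed square and `g` is its pointwise normal component
`u · n` on the faces. -/
def IsClassicalNormalTrace (u : ℝ × ℝ → ℝ × ℝ) (g : Face → ℝ → ℝ) : Prop :=
  ContinuousOn u refSquare ∧
    ∀ F : Face, ∀ t ∈ Set.Icc (0 : ℝ) 1, g F t = dot (u (F.param t)) F.normal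

/-- For a field `u` with divergence `w`, `g` is the weak normal trace `u · n ∈ L¹(∂K)`:
`∫_{∂K} (u · n) φ = ∫_K (u · ∇φ + φ div u)` for all smooth `φ`. -/
def IsWeakNormalTrace (u : ℝ × ℝ → ℝ × ℝ) (w : ℝ × ℝ → ℝ) (g : Face → ℝ → ℝ) : Prop :=
  (∀ F : Face, IntegrableOn (g F) (Set.Icc 0 1)) ∧
  ∀ φ : ℝ × ℝ → ℝ, ContDiff ℝ ∞ φ →
    (∫ t in Set.Icc (0 : ℝ) 1, g .left t * φ (Face.left.param t))
      + (∫ t in Set.Icc (0 : ℝ) 1, g .right t * φ (Face.right.param t))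
      + (∫ t in Set.Icc (0 : ℝ) 1, g .bottom t * φ (Face.bottom.param t))
      + (∫ t in Set.Icc (0 : ℝ) 1, g .top t * φ (Face.top.param t))
    = ∫ z in refSquare, ((u z).1 * dx φ z + (u z).2 * dy φ z + w z * φ z)

/-! ### Polynomial spaces -/

/-- `Q_{a,b}`: polynomials of degree at most `a` in `x` and at most `b` in `y`. The degrees are
integers, so that `Q_{-1,b} = Q_{a,-1} = {0}`. -/
def Q (a b : ℤ) : Submodule ℝ (MvPolynomial (Fin 2) ℝ) :=
  MvPolynomial.restrictSupport ℝ {m | (m 0 : ℤ) ≤ a ∧ (m 1 : ℤ) ≤ b}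

/-- Vector valued polynomials in two variables. -/
abbrev VecPoly : Type := MvPolynomial (Fin 2) ℝ × MvPolynomial (Fin 2) ℝ

/-- The space `ABF_k = Q_{k+2,k} × Q_{k,k+2}`. -/
def abfSpace (k : ℕ) : Submodule ℝ VecPoly := (Q (k + 2) k).prod (Q k (k + 2))

/-- The value of a polynomial at a point. -/
def evalPt (q : MvPolynomial (Fin 2) ℝ) (z : ℝ × ℝ) : ℝ := MvPolynomial.eval ![z.1, z.2] q

/-- The value of a vector valued polynomial at a point. -/
def evalVec (v : VecPoly) (z : ℝ × ℝ) : ℝ × ℝ := (evalPt v.1 z, evalPt v.2 z)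

/-- The divergence of a vector valued polynomial, as a function. -/
def divPoly (v : VecPoly) (z : ℝ × ℝ) : ℝ :=
  evalPt (MvPolynomial.pderiv 0 v.1 + MvPolynomial.pderiv 1 v.2) z

/-! ### The interpolant -/

/-- `v` is the Arnold-Boffi-Falk interpolant, of order `k`, of the field `u` with divergence `w`
and normal trace `g`. -/
structure IsInterpolant (k : ℕ) (u : ℝ × ℝ → ℝ × ℝ) (w : ℝ × ℝ → ℝ) (g : Face → ℝ → ℝ)
    (v : VecPoly) : Prop where
  mem : v ∈ abfSpace k
  face : ∀ F : Face, ∀ q : Polynomial ℝ, q.natDegree ≤ k →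
    ∫ t in Set.Icc (0 : ℝ) 1, (dot (evalVec v (F.param t)) F.normal - g F t) * q.eval t = 0
  interior : ∀ q : VecPoly, q ∈ (Q (k - 1) k).prod (Q k (k - 1)) →
    ∫ z in refSquare, dot (evalVec v z - u z) (evalVec q z) = 0
  div_x : ∀ i : ℕ, i ≤ k →
    ∫ z in refSquare, (divPoly v z - w z) * (z.1 ^ i * z.2 ^ (k + 1)) = 0
  div_y : ∀ j : ℕ, j ≤ k →
    ∫ z in refSquare, (divPoly v z - w z) * (z.1 ^ (k + 1) * z.2 ^ j) = 0

end

end ABF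

namespace ABF

noncomputable section

open Filter Topology


/-! ### The reference square -/

/-! The argument has three independent ingredients.

Unisolvence. The degrees of freedom and the coefficients of `abfSpace k` are equally many, so
existence and uniqueness reduce to showing that a field `v` with vanishing degrees of freedom is
zero (`IsInterpolant.eq_zero`). Green's formula shows that `div v` is orthogonal to the span of
`divExpo k`, which contains it, so `div v = 0`. This kills the top coefficients in `x^(k+2)` and
`y^(k+2)`, and what remains is a Raviart–Thomas field with vanishing degrees of freedom. Its first
component is divisible by `x (x - 1)` with a quotient in `Q_{k-1,k}`, and the interior moments force
that quotient to vanish; the second component is symmetric.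

Projection. For a general `u`, the same use of Green's formula shows that the divergence of the
interpolant is the `L²` projection of `w` onto the span of `divExpo k`, that is `Q_{k+1,k+1}`
without `x^(k+1) y^(k+1)` (`IsInterpolant.integral_div_sub_eq_zero`). For a weak normal trace
Green's formula is the definition; for a continuous field it follows from the weak divergence by
cutoff functions (`IsClassicalNormalTrace.green`). On a finite-dimensional space the projection is
controlled in `L^p` by `L¹` moments, so the interpolation error of the divergence is at most a
constant times the best approximation error (`exists_normLp_sub_divPoly_le`).

Approximation. The polynomial comes from a tensorised averaged Taylor expansion, built by duality.
Each one-dimensional test function is a combination of derivatives of a fixed weight plus the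
derivative of order `n` of another test function, obtained by an integral operator with bounded
kernel (`IsUnitTest.expansion`). Expanding a product test function in `x`, and then the resulting
coefficients in `y`, writes `w` as a polynomial in `Q_{n,n}` plus remainders containing only
`∂_x^(n+1) w` and `∂_y^(n+1) w` (`ae_eq_expansion`). With `s = n + 1 ≤ k + 1` this is (ii). For (i),
the terms of total order at least `ℓ` have coefficients bounded by derivatives of order `ℓ` of `w`;
dropping them leaves total degree at most `k + 1`, which `divExpo k` allows. -/

lemma refSquare_eq_Icc : refSquare = Set.Icc ((0, 0) : ℝ × ℝ) (1, 1) := by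
  rw [refSquare, Set.Icc_prod_Icc]

lemma isCompact_refSquare : IsCompact refSquare := isCompact_Icc.prod isCompact_Icc

lemma measurableSet_refSquare : MeasurableSet refSquare := measurableSet_Icc.prod measurableSet_Icc

lemma measurableSet_openSquare : MeasurableSet openSquare :=
  measurableSet_Ioo.prod measurableSet_Ioo

/-- Lebesgue measure on the unit interval. -/
def unitMeasure : Measure ℝ := volume.restrict (Set.Icc 0 1)

instance : IsProbabilityMeasure unitMeasure := ⟨by simp [unitMeasure]⟩

lemma unitMeasure_eq_Ioo : unitMeasure = volume.restrict (Set.Ioo 0 1) :=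
  Measure.restrict_congr_set Ioo_ae_eq_Icc.symm

lemma restrict_refSquare : volume.restrict refSquare = unitMeasure.prod unitMeasure := by
  rw [refSquare, unitMeasure, Measure.prod_restrict, Measure.volume_eq_prod]

/-- The boundary is a null set. Weak derivatives are tested on the open square and norms are taken
on the closed one; this identity passes between the two. -/
lemma restrict_openSquare : volume.restrict openSquare = volume.restrict refSquare := by
  rw [restrict_refSquare, unitMeasure_eq_Ioo, Measure.prod_restrict, openSquare,
    Measure.volume_eq_prod]

instance : IsProbabilityMeasure (volume.restrict refSquare) := by
  rw [restrict_refSquare]; infer_instance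

lemma integral_refSquare_swap (f : ℝ × ℝ → ℝ) :
    ∫ z in refSquare, f z.swap = ∫ z in refSquare, f z := by
  rw [restrict_refSquare, integral_prod_swap]

/-- A nonnegative continuous function on the square with zero integral vanishes inside. -/
lemma eq_zero_of_integral_refSquare_eq_zero {f : ℝ × ℝ → ℝ} (hf : Continuous f)
    (h0 : ∀ z ∈ refSquare, 0 ≤ f z) (h : ∫ z in refSquare, f z = 0) :
    ∀ z ∈ openSquare, f z = 0 := by
  have hint : IntegrableOn f refSquare := hf.continuousOn.integrableOn_compact isCompact_refSquare
  rw [setIntegral_eq_zero_iff_of_nonneg_ae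
    (ae_restrict_of_forall_mem measurableSet_refSquare h0) hint, ← restrict_openSquare] at h
  have hop : IsOpen openSquare := isOpen_Ioo.prod isOpen_Ioo
  exact Measure.eqOn_open_of_ae_eq h hop hf.continuousOn continuousOn_const

/-! ### Evaluation of polynomials -/

@[simp] lemma evalPt_add (q r : MvPolynomial (Fin 2) ℝ) (z : ℝ × ℝ) :
    evalPt (q + r) z = evalPt q z + evalPt r z := by simp [evalPt]

@[simp] lemma evalPt_sub (q r : MvPolynomial (Fin 2) ℝ) (z : ℝ × ℝ) :
    evalPt (q - r) z = evalPt q z - evalPt r z := by simp [evalPt]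

@[simp] lemma evalPt_mul (q r : MvPolynomial (Fin 2) ℝ) (z : ℝ × ℝ) :
    evalPt (q * r) z = evalPt q z * evalPt r z := by simp [evalPt]

@[simp] lemma evalPt_smul (c : ℝ) (q : MvPolynomial (Fin 2) ℝ) (z : ℝ × ℝ) :
    evalPt (c • q) z = c * evalPt q z := by simp [evalPt]

@[simp] lemma evalPt_zero (z : ℝ × ℝ) : evalPt 0 z = 0 := by simp [evalPt]

@[simp] lemma evalPt_one (z : ℝ × ℝ) : evalPt 1 z = 1 := by simp [evalPt]

@[simp] lemma evalPt_C (c : ℝ) (z : ℝ × ℝ) : evalPt (MvPolynomial.C c) z = c := by simp [evalPt]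

@[simp] lemma evalPt_X0 (z : ℝ × ℝ) : evalPt (MvPolynomial.X 0) z = z.1 := by simp [evalPt]

@[simp] lemma evalPt_X1 (z : ℝ × ℝ) : evalPt (MvPolynomial.X 1) z = z.2 := by simp [evalPt]

@[simp] lemma evalPt_sum {ι : Type*} (s : Finset ι) (q : ι → MvPolynomial (Fin 2) ℝ)
    (z : ℝ × ℝ) : evalPt (∑ i ∈ s, q i) z = ∑ i ∈ s, evalPt (q i) z := by simp [evalPt]

lemma evalPt_monomial (m : Fin 2 →₀ ℕ) (c : ℝ) (z : ℝ × ℝ) :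
    evalPt (MvPolynomial.monomial m c) z = c * (z.1 ^ m 0 * z.2 ^ m 1) := by
  simp [evalPt, MvPolynomial.eval_monomial, Finsupp.prod_fintype]

lemma contDiff_evalPt (q : MvPolynomial (Fin 2) ℝ) : ContDiff ℝ ∞ (evalPt q) := by
  induction q using MvPolynomial.induction_on with
  | C a => simpa [funext fun z => evalPt_C a z] using contDiff_const
  | add p q hp hq => simpa [funext fun z => evalPt_add p q z] using hp.add hq
  | mul_X p i hp =>
    have : ContDiff ℝ ∞ (evalPt (MvPolynomial.X i)) := by
      fin_cases i
      · simpa [funext fun z => evalPt_X0 z] using contDiff_fst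
      · simpa [funext fun z => evalPt_X1 z] using contDiff_snd
    rw [funext fun z => evalPt_mul p (MvPolynomial.X i) z]
    exact hp.mul this

@[fun_prop]
lemma continuous_evalPt (q : MvPolynomial (Fin 2) ℝ) : Continuous (evalPt q) :=
  (contDiff_evalPt q).continuous

lemma differentiable_evalPt (q : MvPolynomial (Fin 2) ℝ) : Differentiable ℝ (evalPt q) :=
  (contDiff_evalPt q).differentiable (by simp)

lemma fderiv_evalPt (q : MvPolynomial (Fin 2) ℝ) (z : ℝ × ℝ) (v : ℝ × ℝ) :
    fderiv ℝ (evalPt q) z v =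
      evalPt (MvPolynomial.pderiv 0 q) z * v.1 + evalPt (MvPolynomial.pderiv 1 q) z * v.2 := by
  induction q using MvPolynomial.induction_on with
  | C a => simp [show evalPt (MvPolynomial.C a) = fun _ => a from funext fun z => evalPt_C a z]
  | add p q hp hq =>
    rw [show evalPt (p + q) = evalPt p + evalPt q from funext fun z => evalPt_add p q z,
      fderiv_add (differentiable_evalPt p z) (differentiable_evalPt q z)]
    simp [hp, hq]; ring
  | mul_X p i hp =>
    have hX : fderiv ℝ (evalPt (MvPolynomial.X i)) z v = ![v.1, v.2] i := by
      fin_cases i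
      · simp [show evalPt (MvPolynomial.X 0) = Prod.fst from funext fun z => evalPt_X0 z,
          fderiv_fst]
      · simp [show evalPt (MvPolynomial.X 1) = Prod.snd from funext fun z => evalPt_X1 z,
          fderiv_snd]
    rw [show evalPt (p * MvPolynomial.X i) = evalPt p * evalPt (MvPolynomial.X i) from
      funext fun z => evalPt_mul p _ z,
      fderiv_mul (differentiable_evalPt p z) (differentiable_evalPt _ z)]
    simp only [_root_.add_apply, _root_.smul_apply, hX, hp, smul_eq_mul,
      Derivation.leibniz, MvPolynomial.pderiv_X, evalPt_add, evalPt_mul]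
    fin_cases i <;> simp [evalPt_one] <;> ring

lemma dx_evalPt (q : MvPolynomial (Fin 2) ℝ) : dx (evalPt q) = evalPt (MvPolynomial.pderiv 0 q) := by
  ext z; simp [dx, fderiv_evalPt]

lemma dy_evalPt (q : MvPolynomial (Fin 2) ℝ) : dy (evalPt q) = evalPt (MvPolynomial.pderiv 1 q) := by
  ext z; simp [dy, fderiv_evalPt]

lemma eq_zero_of_evalPt_eq_zero {q : MvPolynomial (Fin 2) ℝ}
    (h : ∀ z ∈ openSquare, evalPt q z = 0) : q = 0 := by
  refine MvPolynomial.funext_set (fun _ => Set.Ioo (0 : ℝ) 1)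
    (fun _ => Set.Ioo_infinite one_pos) fun x hx => ?_
  have := h (x 0, x 1) ⟨hx 0 trivial, hx 1 trivial⟩
  rw [map_zero, ← this, evalPt, show x = ![x 0, x 1] by ext i; fin_cases i <;> rfl]
  rfl

lemma eq_zero_of_integral_sq_eq_zero {q : MvPolynomial (Fin 2) ℝ}
    (h : ∫ z in refSquare, evalPt q z * evalPt q z = 0) : q = 0 := by
  refine eq_zero_of_evalPt_eq_zero fun z hz => ?_
  have := eq_zero_of_integral_refSquare_eq_zero (by fun_prop) (fun z _ => mul_self_nonneg _) h z hz
  exact mul_self_eq_zero.1 this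

/-! ### Monomials -/

/-- The exponent of `x ^ a * y ^ b`. -/
def expo (a b : ℕ) : Fin 2 →₀ ℕ := Finsupp.single 0 a + Finsupp.single 1 b

@[simp] lemma expo_zero (a b : ℕ) : expo a b 0 = a := by simp [expo]

@[simp] lemma expo_one (a b : ℕ) : expo a b 1 = b := by simp [expo]

lemma expo_eta (m : Fin 2 →₀ ℕ) : expo (m 0) (m 1) = m := by
  ext i; fin_cases i <;> simp

/-- The monomial `x ^ a * y ^ b`. -/
def mono (a b : ℕ) : MvPolynomial (Fin 2) ℝ := MvPolynomial.monomial (expo a b) 1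

@[simp] lemma evalPt_mono (a b : ℕ) (z : ℝ × ℝ) : evalPt (mono a b) z = z.1 ^ a * z.2 ^ b := by
  simp [mono, evalPt_monomial]

/-- Polynomials with exponents in a set `s` of pairs. -/
def polySpan (s : Set (ℕ × ℕ)) : Submodule ℝ (MvPolynomial (Fin 2) ℝ) :=
  MvPolynomial.restrictSupport ℝ {m | (m 0, m 1) ∈ s}

lemma polySpan_mono {s t : Set (ℕ × ℕ)} (h : s ⊆ t) : polySpan s ≤ polySpan t :=
  MvPolynomial.restrictSupport_mono _ fun _ hm => h hm

lemma monomial_mem_polySpan {s : Set (ℕ × ℕ)} {m : Fin 2 →₀ ℕ} (c : ℝ) (h : (m 0, m 1) ∈ s) :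
    MvPolynomial.monomial m c ∈ polySpan s :=
  (MvPolynomial.monomial_mem_restrictSupport _).2 (Or.inl h)

lemma mono_mem_polySpan {s : Set (ℕ × ℕ)} {a b : ℕ} (h : (a, b) ∈ s) : mono a b ∈ polySpan s :=
  monomial_mem_polySpan _ (by simpa)

lemma polySpan_eq_span (s : Set (ℕ × ℕ)) :
    polySpan s = Submodule.span ℝ ((fun i : ℕ × ℕ => mono i.1 i.2) '' s) := by
  rw [polySpan, MvPolynomial.restrictSupport_eq_span]
  congr 1
  ext q
  constructor
  · rintro ⟨m, hm, rfl⟩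
    exact ⟨(m 0, m 1), hm, by simp [mono, expo_eta]⟩
  · rintro ⟨i, hi, rfl⟩
    exact ⟨expo i.1 i.2, by simpa using hi, rfl⟩

lemma coeff_eq_zero_of_mem_polySpan {s : Set (ℕ × ℕ)} {q : MvPolynomial (Fin 2) ℝ}
    (hq : q ∈ polySpan s) {a b : ℕ} (h : (a, b) ∉ s) : q.coeff (expo a b) = 0 := by
  by_contra hne
  have := (MvPolynomial.mem_restrictSupport_iff _).1 hq
    (Finset.mem_coe.2 (MvPolynomial.mem_support_iff.2 hne))
  exact h (by simpa using this)

lemma mem_polySpan_of_coeff {s : Set (ℕ × ℕ)} {q : MvPolynomial (Fin 2) ℝ}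
    (h : ∀ a b, (a, b) ∉ s → q.coeff (expo a b) = 0) : q ∈ polySpan s := by
  refine (MvPolynomial.mem_restrictSupport_iff _).2 fun m hm => ?_
  by_contra hne
  exact MvPolynomial.mem_support_iff.1 (Finset.mem_coe.1 hm)
    (by simpa [expo_eta] using h (m 0) (m 1) hne)

lemma eq_sum_of_mem_polySpan {s : Finset (ℕ × ℕ)} {q : MvPolynomial (Fin 2) ℝ}
    (hq : q ∈ polySpan s) : q = ∑ i ∈ s, q.coeff (expo i.1 i.2) • mono i.1 i.2 := by
  ext m
  simp only [MvPolynomial.coeff_sum, MvPolynomial.coeff_smul, mono, MvPolynomial.coeff_monomial,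
    smul_eq_mul, mul_ite, mul_one, mul_zero]
  have key : ∀ i : ℕ × ℕ, expo i.1 i.2 = m ↔ i = (m 0, m 1) := fun i => by
    constructor
    · rintro rfl; simp
    · rintro rfl; exact expo_eta m
  simp only [key, Finset.sum_ite_eq']
  split_ifs with h
  · simp [expo_eta]
  · rw [← expo_eta m]
    exact coeff_eq_zero_of_mem_polySpan hq (by simpa using h)

lemma pderiv_zero_mono (a b : ℕ) :
    MvPolynomial.pderiv 0 (mono a b) = (a : ℝ) • mono (a - 1) b := by
  rw [mono, MvPolynomial.pderiv_monomial, mono, MvPolynomial.smul_monomial,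
    show expo a b - Finsupp.single 0 1 = expo (a - 1) b by ext i; fin_cases i <;> simp]
  simp

lemma pderiv_one_mono (a b : ℕ) :
    MvPolynomial.pderiv 1 (mono a b) = (b : ℝ) • mono a (b - 1) := by
  rw [mono, MvPolynomial.pderiv_monomial, mono, MvPolynomial.smul_monomial,
    show expo a b - Finsupp.single 1 1 = expo a (b - 1) by ext i; fin_cases i <;> simp]
  simp

lemma map_mem_of_mono {M : Type*} [AddCommGroup M] [Module ℝ M] {s : Set (ℕ × ℕ)}
    (f : MvPolynomial (Fin 2) ℝ →ₗ[ℝ] M) (N : Submodule ℝ M)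
    (h : ∀ a b, (a, b) ∈ s → f (mono a b) ∈ N) {q : MvPolynomial (Fin 2) ℝ}
    (hq : q ∈ polySpan s) : f q ∈ N := by
  rw [polySpan_eq_span] at hq
  suffices Submodule.span ℝ ((fun i : ℕ × ℕ => mono i.1 i.2) '' s) ≤ N.comap f from this hq
  rw [Submodule.span_le]
  rintro _ ⟨i, hi, rfl⟩
  exact h _ _ hi

/-- The exponents of `Q_{a,b}`. -/
def box (a b : ℤ) : Set (ℕ × ℕ) := {i | (i.1 : ℤ) ≤ a ∧ (i.2 : ℤ) ≤ b}

lemma Q_eq (a b : ℤ) : Q a b = polySpan (box a b) := rfl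

/-- The exponents of the divergences of `ABF_k`. -/
def divExpo (k : ℕ) : Finset (ℕ × ℕ) :=
  (Finset.range (k + 2) ×ˢ Finset.range (k + 2)).erase (k + 1, k + 1)

lemma mem_divExpo {k a b : ℕ} :
    (a, b) ∈ divExpo k ↔ (a ≤ k ∧ b ≤ k + 1) ∨ (a ≤ k + 1 ∧ b ≤ k) := by
  simp only [divExpo, Finset.mem_erase, ne_eq, Prod.mk.injEq, Finset.mem_product, Finset.mem_range]
  omega

/-- The divergence of a vector valued polynomial. -/
def divP : VecPoly →ₗ[ℝ] MvPolynomial (Fin 2) ℝ where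
  toFun v := MvPolynomial.pderiv 0 v.1 + MvPolynomial.pderiv 1 v.2
  map_add' v w := by simp; abel
  map_smul' c v := by simp

lemma divPoly_eq (v : VecPoly) : divPoly v = evalPt (divP v) := rfl

/-- `∂_x` maps `Q_{k+2,k}` into `Q_{k+1,k}`, and `∂_y` maps `Q_{k,k+2}` into `Q_{k,k+1}`. The corner
exponent `(k+1, k+1)` belongs to neither. -/
lemma divP_mem {k : ℕ} {v : VecPoly} (hv : v ∈ abfSpace k) : divP v ∈ polySpan (divExpo k) := by
  obtain ⟨h1, h2⟩ := hv
  rw [SetLike.mem_coe, Q_eq] at h1 h2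
  refine Submodule.add_mem _ ?_ ?_
  · refine map_mem_of_mono (MvPolynomial.pderiv 0).toLinearMap _ (fun a b hab => ?_) h1
    simp only [Derivation.coeFn_coe, pderiv_zero_mono]
    refine Submodule.smul_mem _ _ (mono_mem_polySpan ?_)
    simp only [box, Set.mem_ofPred_eq] at hab
    simp only [Finset.mem_coe, mem_divExpo]; omega
  · refine map_mem_of_mono (MvPolynomial.pderiv 1).toLinearMap _ (fun a b hab => ?_) h2
    simp only [Derivation.coeFn_coe, pderiv_one_mono]
    refine Submodule.smul_mem _ _ (mono_mem_polySpan ?_)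
    simp only [box, Set.mem_ofPred_eq] at hab
    simp only [Finset.mem_coe, mem_divExpo]; omega

/-! ### Integration against polynomials -/

lemma _root_.MeasureTheory.IntegrableOn.mul_continuous_refSquare {f h : ℝ × ℝ → ℝ}
    (hf : IntegrableOn f refSquare) (hh : Continuous h) :
    IntegrableOn (fun z => f z * h z) refSquare :=
  hf.mul_continuousOn hh.continuousOn isCompact_refSquare

lemma _root_.Continuous.integrableOn_refSquare {f : ℝ × ℝ → ℝ} (hf : Continuous f) :
    IntegrableOn f refSquare :=
  hf.continuousOn.integrableOn_compact isCompact_refSquare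

lemma _root_.MeasureTheory.IntegrableOn.mul_continuous_Icc {f h : ℝ → ℝ}
    (hf : IntegrableOn f (Set.Icc 0 1)) (hh : Continuous h) :
    IntegrableOn (fun z => f z * h z) (Set.Icc 0 1) :=
  hf.mul_continuousOn hh.continuousOn isCompact_Icc

lemma integral_mul_evalPt_eq_zero {f : ℝ × ℝ → ℝ} (hf : IntegrableOn f refSquare)
    {s : Set (ℕ × ℕ)} (h : ∀ a b, (a, b) ∈ s → ∫ z in refSquare, f z * (z.1 ^ a * z.2 ^ b) = 0)
    {q : MvPolynomial (Fin 2) ℝ} (hq : q ∈ polySpan s) :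
    ∫ z in refSquare, f z * evalPt q z = 0 := by
  let L : MvPolynomial (Fin 2) ℝ →ₗ[ℝ] ℝ :=
    { toFun := fun q => ∫ z in refSquare, f z * evalPt q z
      map_add' := fun q r => by
        simp only [evalPt_add, mul_add]
        exact integral_add (hf.mul_continuous_refSquare (continuous_evalPt q))
          (hf.mul_continuous_refSquare (continuous_evalPt r))
      map_smul' := fun c q => by
        simp only [evalPt_smul, mul_left_comm _ c, integral_const_mul, RingHom.id_apply,
          smul_eq_mul] }
  have := map_mem_of_mono L ⊥ (fun a b hab => by simpa [L] using h a b hab) hq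
  exact (Submodule.mem_bot ℝ).1 this

lemma integral_mul_eval_eq_zero {f : ℝ → ℝ} (hf : IntegrableOn f (Set.Icc 0 1)) {k : ℕ}
    (h : ∀ i ≤ k, ∫ t in Set.Icc (0 : ℝ) 1, f t * t ^ i = 0) {q : Polynomial ℝ}
    (hq : q.natDegree ≤ k) : ∫ t in Set.Icc (0 : ℝ) 1, f t * q.eval t = 0 := by
  simp only [Polynomial.eval_eq_sum_range' (Nat.lt_succ_of_le hq), Finset.mul_sum]
  rw [integral_finsetSum]
  · refine Finset.sum_eq_zero fun i hi => ?_
    simp only [mul_left_comm _ (q.coeff i), integral_const_mul]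
    rw [h i (by simpa [Nat.lt_succ_iff] using hi), mul_zero]
  · intro i _
    exact hf.mul_continuous_Icc (by fun_prop)

/-! ### Green's formula for polynomials -/

instance : Fintype Face :=
  ⟨⟨[Face.left, Face.right, Face.bottom, Face.top], by simp⟩, by rintro ⟨⟩ <;> simp⟩

lemma sum_face {M : Type*} [AddCommMonoid M] (f : Face → M) :
    ∑ F, f F = f .left + f .right + f .bottom + f .top := by
  change Multiset.sum (Multiset.map f ↑[Face.left, .right, .bottom, .top]) = _
  simp [add_assoc]

/-- The normal component of a polynomial field on the faces. -/
def normalTrace (v : VecPoly) (F : Face) (t : ℝ) : ℝ := dot (evalVec v (F.param t)) F.normal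

/-- Green's formula for a field `u`, with divergence `w` and normal trace `g`, tested against the
polynomial `q`. -/
def Green (u : ℝ × ℝ → ℝ × ℝ) (w : ℝ × ℝ → ℝ) (g : Face → ℝ → ℝ) (q : MvPolynomial (Fin 2) ℝ) :
    Prop :=
  ∑ F, ∫ t in Set.Icc (0 : ℝ) 1, g F t * evalPt q (F.param t)
    = ∫ z in refSquare, (dot (u z) (evalVec (MvPolynomial.pderiv 0 q, MvPolynomial.pderiv 1 q) z)
        + w z * evalPt q z)

lemma continuous_param (F : Face) : Continuous F.param := by
  cases F
  · exact continuous_const.prodMk continuous_id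
  · exact continuous_const.prodMk continuous_id
  · exact continuous_id.prodMk continuous_const
  · exact continuous_id.prodMk continuous_const

lemma continuous_normalTrace (v : VecPoly) (F : Face) : Continuous (normalTrace v F) := by
  have := continuous_param F
  unfold normalTrace dot evalVec
  fun_prop

/-- This is the divergence theorem on the square for the product field `q v`. -/
lemma green_polynomial (v : VecPoly) (q : MvPolynomial (Fin 2) ℝ) :
    Green (evalVec v) (divPoly v) (normalTrace v) q := by
  have key := integral_divergence_prod_Icc_of_hasFDerivAt_of_le
    (evalPt (v.1 * q)) (evalPt (v.2 * q)) (fderiv ℝ (evalPt (v.1 * q)))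
    (fderiv ℝ (evalPt (v.2 * q))) (0, 0) (1, 1) (by simp [Prod.le_def])
    (continuous_evalPt _).continuousOn (continuous_evalPt _).continuousOn
    (fun x _ => (differentiable_evalPt _ x).hasFDerivAt)
    (fun x _ => (differentiable_evalPt _ x).hasFDerivAt)
    (by
      simp only [fderiv_evalPt]
      rw [← refSquare_eq_Icc]
      exact Continuous.integrableOn_refSquare (by fun_prop))
  rw [← refSquare_eq_Icc] at key
  simp only [intervalIntegral.integral_of_le zero_le_one, ← integral_Icc_eq_integral_Ioc] at key
  unfold Green
  rw [sum_face]
  trans ∫ z in refSquare, fderiv ℝ (evalPt (v.1 * q)) z (1, 0) + fderiv ℝ (evalPt (v.2 * q)) z (0, 1)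
  · rw [key]
    simp only [normalTrace, dot, evalVec, Face.param, Face.normal, evalPt_mul, mul_neg, mul_zero,
      mul_one, add_zero, zero_add, neg_mul, integral_neg]
    ring
  · congr 1; ext z
    simp only [fderiv_evalPt, dot, evalVec, divPoly, Derivation.leibniz, evalPt_add, evalPt_mul,
      smul_eq_mul]
    ring

/-! ### The divergence of the interpolant -/

lemma fst_integrableOn {u : ℝ × ℝ → ℝ × ℝ} (hu : IntegrableOn u refSquare) :
    IntegrableOn (fun z => (u z).1) refSquare := Integrable.fst hu

lemma snd_integrableOn {u : ℝ × ℝ → ℝ × ℝ} (hu : IntegrableOn u refSquare) :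
    IntegrableOn (fun z => (u z).2) refSquare := Integrable.snd hu

/-- Traces of `Q_{k,k}` on a face are admissible test polynomials for the face moments. -/
lemma evalPt_mono_param (F : Face) (a b k : ℕ) (ha : a ≤ k) (hb : b ≤ k) :
    ∃ r : Polynomial ℝ, r.natDegree ≤ k ∧ ∀ t, evalPt (mono a b) (F.param t) = r.eval t := by
  cases F
  · exact ⟨Polynomial.C (0 ^ a) * Polynomial.X ^ b,
      (Polynomial.natDegree_C_mul_X_pow_le _ _).trans hb, by simp [Face.param]⟩
  · exact ⟨Polynomial.C 1 * Polynomial.X ^ b,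
      (Polynomial.natDegree_C_mul_X_pow_le _ _).trans hb, by simp [Face.param]⟩
  · exact ⟨Polynomial.C (0 ^ b) * Polynomial.X ^ a,
      (Polynomial.natDegree_C_mul_X_pow_le _ _).trans ha, by simp [Face.param, mul_comm]⟩
  · exact ⟨Polynomial.C 1 * Polynomial.X ^ a,
      (Polynomial.natDegree_C_mul_X_pow_le _ _).trans ha, by simp [Face.param]⟩

lemma integrableOn_dot {u : ℝ × ℝ → ℝ × ℝ} (hu : IntegrableOn u refSquare) (v : VecPoly) :
    IntegrableOn (fun z => dot (u z) (evalVec v z)) refSquare := by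
  unfold dot evalVec
  exact ((fst_integrableOn hu).mul_continuous_refSquare (continuous_evalPt v.1)).add
    ((snd_integrableOn hu).mul_continuous_refSquare (continuous_evalPt v.2))

lemma continuous_evalVec (v : VecPoly) : Continuous (evalVec v) := by
  unfold evalVec; fun_prop

lemma continuous_divPoly (v : VecPoly) : Continuous (divPoly v) := by
  rw [divPoly_eq]; fun_prop

lemma integrableOn_evalVec (v : VecPoly) : IntegrableOn (evalVec v) refSquare :=
  (continuous_evalVec v).continuousOn.integrableOn_compact isCompact_refSquare

/-- The divergence of the interpolant is the `L²` projection of the divergence. -/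
lemma IsInterpolant.integral_div_sub_eq_zero {k : ℕ} {u : ℝ × ℝ → ℝ × ℝ} {w : ℝ × ℝ → ℝ}
    {g : Face → ℝ → ℝ} {v : VecPoly} (hv : IsInterpolant k u w g v)
    (hu : IntegrableOn u refSquare) (hw : IntegrableOn w refSquare)
    (hg : ∀ F, IntegrableOn (g F) (Set.Icc 0 1))
    (hG : ∀ a b, a ≤ k → b ≤ k → Green u w g (mono a b)) {a b : ℕ} (hab : (a, b) ∈ divExpo k) :
    ∫ z in refSquare, (divPoly v z - w z) * (z.1 ^ a * z.2 ^ b) = 0 := by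
  rw [mem_divExpo] at hab
  -- A monomial with an exponent `k + 1` is itself one of the divergence moments. Only `Q_{k,k}` is
  -- left, where Green's formula turns the divergence moment into face and interior moments.
  by_cases hb : b = k + 1
  · subst hb; exact hv.div_x a (by omega)
  by_cases ha : a = k + 1
  · subst ha; exact hv.div_y b (by omega)
  replace ha : a ≤ k := by omega
  replace hb : b ≤ k := by omega
  have h1 := hG a b ha hb
  have h2 := green_polynomial v (mono a b)
  unfold Green at h1 h2
  set G : VecPoly := (MvPolynomial.pderiv 0 (mono a b), MvPolynomial.pderiv 1 (mono a b)) with hGdef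
  have hGmem : G ∈ (Q (k - 1) k).prod (Q k (k - 1)) := by
    constructor
    · rw [SetLike.mem_coe, Q_eq, hGdef, pderiv_zero_mono]
      -- The case `a = 0` is separate because the truncated exponent `a - 1 = 0` need not be at most
      -- `k - 1` when `k = 0`; the derivative is then zero anyway.
      rcases Nat.eq_zero_or_pos a with rfl | h
      · simp
      · refine Submodule.smul_mem _ _ (mono_mem_polySpan ?_)
        simp only [box, Set.mem_ofPred_eq]; omega
    · rw [SetLike.mem_coe, Q_eq, hGdef, pderiv_one_mono]
      rcases Nat.eq_zero_or_pos b with rfl | h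
      · simp
      · refine Submodule.smul_mem _ _ (mono_mem_polySpan ?_)
        simp only [box, Set.mem_ofPred_eq]; omega
  have hint := hv.interior G hGmem
  have hface : ∑ F, ∫ t in Set.Icc (0 : ℝ) 1,
      (normalTrace v F t - g F t) * evalPt (mono a b) (F.param t) = 0 := by
    refine Finset.sum_eq_zero fun F _ => ?_
    obtain ⟨r, hr, hr'⟩ := evalPt_mono_param F a b k ha hb
    simp only [hr']
    exact hv.face F r hr
  have hface' : ∑ F, ∫ t in Set.Icc (0 : ℝ) 1, normalTrace v F t * evalPt (mono a b) (F.param t)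
      = ∑ F, ∫ t in Set.Icc (0 : ℝ) 1, g F t * evalPt (mono a b) (F.param t) := by
    rw [← sub_eq_zero, ← Finset.sum_sub_distrib]
    refine Eq.trans ?_ hface
    refine Finset.sum_congr rfl fun F _ => ?_
    have hc : Continuous fun t => evalPt (mono a b) (F.param t) :=
      (continuous_evalPt _).comp (continuous_param F)
    rw [← integral_sub]
    · simp only [sub_mul]
    · exact ((continuous_normalTrace v F).mul hc).continuousOn.integrableOn_compact isCompact_Icc
    · exact (hg F).mul_continuous_Icc hc
  have huG := integrableOn_dot hu G
  have hvG := integrableOn_dot (integrableOn_evalVec v) G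
  have hwG := hw.mul_continuous_refSquare (continuous_evalPt (mono a b))
  have hdG := (continuous_divPoly v).integrableOn_refSquare.mul_continuous_refSquare
    (continuous_evalPt (mono a b))
  rw [integral_add huG hwG] at h1
  rw [integral_add hvG hdG] at h2
  have h3 : ∫ z in refSquare, dot (evalVec v z - u z) (evalVec G z) =
      (∫ z in refSquare, dot (evalVec v z) (evalVec G z))
        - ∫ z in refSquare, dot (u z) (evalVec G z) := by
    rw [← integral_sub hvG huG]
    congr 1; ext z; simp only [dot, Prod.fst_sub, Prod.snd_sub]; ring
  have h4 : ∫ z in refSquare, (divPoly v z - w z) * (z.1 ^ a * z.2 ^ b) =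
      (∫ z in refSquare, divPoly v z * evalPt (mono a b) z)
        - ∫ z in refSquare, w z * evalPt (mono a b) z := by
    rw [← integral_sub hdG hwG]
    congr 1; ext z; rw [evalPt_mono]; ring
  rw [h4]
  linarith

/-! ### Unisolvence -/

lemma _root_.Polynomial.eq_zero_of_forall_integral_eq_zero {k : ℕ} {P : Polynomial ℝ}
    (hP : P.natDegree ≤ k)
    (h : ∀ q : Polynomial ℝ, q.natDegree ≤ k →
      ∫ t in Set.Icc (0 : ℝ) 1, P.eval t * q.eval t = 0) : P = 0 := by
  have h1 := h P hP
  have hc : Continuous fun t => P.eval t * P.eval t := by fun_prop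
  rw [setIntegral_eq_zero_iff_of_nonneg_ae
    (Filter.Eventually.of_forall fun t => mul_self_nonneg (P.eval t))
    (hc.continuousOn.integrableOn_compact isCompact_Icc),
    ← Measure.restrict_congr_set Ioo_ae_eq_Icc] at h1
  have h2 := Measure.eqOn_open_of_ae_eq h1 isOpen_Ioo hc.continuousOn continuousOn_const
  refine Polynomial.eq_zero_of_infinite_isRoot _
    ((Set.Ioo_infinite (zero_lt_one (α := ℝ))).mono fun t ht => ?_)
  exact mul_self_eq_zero.1 (h2 ht)

/-- A polynomial of degree at most `k + 1` in `x` that vanishes on the two sides `x = 0` and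
`x = 1` and is orthogonal to the polynomials of degree less than `k` in `x` vanishes. -/
lemma eq_zero_of_side_of_interior {k : ℕ} {q : MvPolynomial (Fin 2) ℝ}
    (hq : q ∈ polySpan (box (k + 1) k))
    (h0 : ∀ r : Polynomial ℝ, r.natDegree ≤ k →
      ∫ t in Set.Icc (0 : ℝ) 1, evalPt q (0, t) * r.eval t = 0)
    (h1 : ∀ r : Polynomial ℝ, r.natDegree ≤ k →
      ∫ t in Set.Icc (0 : ℝ) 1, evalPt q (1, t) * r.eval t = 0)
    (hint : ∀ r ∈ polySpan (box (k - 1) k), ∫ z in refSquare, evalPt q z * evalPt r z = 0) :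
    q = 0 := by
  -- `V j` is the coefficient of `y^j` in `q`, as a polynomial in `x` of degree at most `k + 1`.
  let V : ℕ → Polynomial ℝ := fun j =>
    ∑ i ∈ Finset.range (k + 2), Polynomial.C (q.coeff (expo i j)) * Polynomial.X ^ i
  have hVdeg : ∀ j, (V j).degree < (k + 2 : ℕ) := fun j => by
    refine (Polynomial.degree_sum_le _ _).trans_lt ?_
    rw [Finset.sup_lt_iff (WithBot.bot_lt_coe _)]
    intro i hi
    exact (Polynomial.degree_C_mul_X_pow_le _ _).trans_lt
      (by exact_mod_cast Finset.mem_range.1 hi)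
  have hqV : ∀ z : ℝ × ℝ, evalPt q z = ∑ j ∈ Finset.range (k + 1), (V j).eval z.1 * z.2 ^ j := by
    intro z
    have hq' : q ∈ polySpan (Finset.range (k + 2) ×ˢ Finset.range (k + 1) : Finset (ℕ × ℕ)) :=
      polySpan_mono (fun i hi => by
        simp only [box, Set.mem_ofPred_eq] at hi
        simp only [Finset.mem_coe, Finset.mem_product, Finset.mem_range]; omega) hq
    conv_lhs => rw [eq_sum_of_mem_polySpan hq', evalPt_sum, Finset.sum_product_right]
    refine Finset.sum_congr rfl fun j _ => ?_
    simp only [V, Polynomial.eval_finsetSum, Finset.sum_mul]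
    refine Finset.sum_congr rfl fun i _ => ?_
    simp; ring
  have side : ∀ x : ℝ, (∀ r : Polynomial ℝ, r.natDegree ≤ k →
      ∫ t in Set.Icc (0 : ℝ) 1, evalPt q (x, t) * r.eval t = 0) →
      ∀ j ∈ Finset.range (k + 1), (V j).eval x = 0 := by
    intro x hx j hj
    -- `P` is the trace of `q` on the line of abscissa `x`. Its degree is at most `k`, so it is
    -- orthogonal to itself and all its coefficients `V j (x)` vanish.
    let P : Polynomial ℝ :=
      ∑ j ∈ Finset.range (k + 1), Polynomial.C ((V j).eval x) * Polynomial.X ^ j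
    have hP : P.natDegree ≤ k := Polynomial.natDegree_sum_le_of_forall_le _ _ fun i hi =>
      (Polynomial.natDegree_C_mul_X_pow_le _ _).trans
        (by simpa [Nat.lt_succ_iff] using hi)
    have hPe : ∀ t, P.eval t = evalPt q (x, t) := fun t => by
      simp [P, hqV, Polynomial.eval_finsetSum]
    have hP0 : P = 0 := Polynomial.eq_zero_of_forall_integral_eq_zero hP fun r hr => by
      simpa only [hPe] using hx r hr
    have : P.coeff j = (V j).eval x := by
      simp only [P, Polynomial.finsetSum_coeff, Polynomial.coeff_C_mul_X_pow]
      simp only [Finset.sum_ite_eq, hj, if_true]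
    rw [← this, hP0, Polynomial.coeff_zero]
  -- Both `0` and `1` are roots of `V j`, and the factors `X` and `X - 1` are coprime; dividing by
  -- their product lowers the degree bound by two.
  have hfac : ∀ j ∈ Finset.range (k + 1), ∃ G : Polynomial ℝ, G.degree < (k : ℕ) ∧
      V j = Polynomial.X * (Polynomial.X - 1) * G := by
    intro j hj
    have hd0 : (Polynomial.X : Polynomial ℝ) ∣ V j := by
      rw [Polynomial.X_dvd_iff, Polynomial.coeff_zero_eq_eval_zero]; exact side 0 h0 j hj
    have hd1 : (Polynomial.X - 1 : Polynomial ℝ) ∣ V j := by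
      rw [← Polynomial.C_1, Polynomial.dvd_iff_isRoot]; exact side 1 h1 j hj
    have hco : IsCoprime (Polynomial.X : Polynomial ℝ) (Polynomial.X - 1) :=
      ⟨1, -1, by ring⟩
    obtain ⟨G, hG⟩ := hco.mul_dvd hd0 hd1
    refine ⟨G, ?_, hG⟩
    by_cases hG0 : G = 0
    · simp [hG0]
    have hX1 : (Polynomial.X - 1 : Polynomial ℝ).degree = 1 := by
      rw [← Polynomial.C_1, Polynomial.degree_X_sub_C]
    have := hVdeg j
    rw [hG, Polynomial.degree_mul, Polynomial.degree_mul, hX1, Polynomial.degree_X,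
      Polynomial.degree_eq_natDegree hG0] at this
    rw [Polynomial.degree_eq_natDegree hG0]
    have h' : 1 + 1 + G.natDegree < k + 2 := by exact_mod_cast this
    exact_mod_cast (by omega : G.natDegree < k)
  choose! G hGdeg hG using hfac
  -- `r` is the quotient of `q` by `x (x - 1)`. It lies in `Q_{k-1,k}`, so it may be used as a test
  -- function in `hint`, which gives `∫ x (1 - x) r² = 0` with a weight positive inside the square.
  let r : MvPolynomial (Fin 2) ℝ :=
    ∑ j ∈ Finset.range (k + 1), ∑ i ∈ Finset.range k, (G j).coeff i • mono i j
  have hr : r ∈ polySpan (box (k - 1) k) :=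
    Submodule.sum_mem _ fun j hj => Submodule.sum_mem _ fun i hi =>
      Submodule.smul_mem _ _ (mono_mem_polySpan (by
        simp only [Finset.mem_range] at hi hj
        simp only [box, Set.mem_ofPred_eq]; omega))
  have hre : ∀ z : ℝ × ℝ, evalPt q z = -(z.1 * (1 - z.1) * evalPt r z) := by
    intro z
    rw [hqV]
    simp only [r, evalPt_sum, evalPt_smul, evalPt_mono, Finset.mul_sum]
    rw [← Finset.sum_neg_distrib]
    refine Finset.sum_congr rfl fun j hj => ?_
    rw [hG j hj]
    have : (G j).eval z.1 = ∑ i ∈ Finset.range k, (G j).coeff i * z.1 ^ i := by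
      -- For `k = 0` the bound on the degree leaves only the zero quotient, matching the empty sum.
      rcases Nat.eq_zero_or_pos k with hk | hk
      · have : G j = 0 := by
          have := hGdeg j hj
          rw [hk] at this
          by_contra hne
          rw [Polynomial.degree_eq_natDegree hne] at this
          exact Nat.not_lt_zero _ (by exact_mod_cast this)
        simp [this]
      · refine Polynomial.eval_eq_sum_range' ?_ _
        by_cases hG0 : G j = 0
        · simpa [hG0] using hk
        · exact (Polynomial.natDegree_lt_iff_degree_lt hG0).2 (hGdeg j hj)
    simp only [Polynomial.eval_mul, Polynomial.eval_X, Polynomial.eval_sub, Polynomial.eval_one,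
      this, Finset.mul_sum, Finset.sum_mul]
    rw [← Finset.sum_neg_distrib]
    refine Finset.sum_congr rfl fun i _ => ?_
    ring
  have hz := hint r hr
  have hz' : ∫ z in refSquare, z.1 * (1 - z.1) * (evalPt r z * evalPt r z) = 0 := by
    rw [← neg_eq_zero, ← integral_neg, ← hz]
    congr 1; ext z; rw [hre]; ring
  have hr0 : r = 0 := by
    refine eq_zero_of_evalPt_eq_zero fun z hz => ?_
    have := eq_zero_of_integral_refSquare_eq_zero (by fun_prop) (fun z hz => ?_) hz' z hz
    · have h1 := hz.1.1
      have h2 : 0 < 1 - z.1 := sub_pos.2 hz.1.2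
      rcases mul_eq_zero.1 this with h | h
      · exact absurd h (mul_pos h1 h2).ne'
      · exact mul_self_eq_zero.1 h
    · exact mul_nonneg (mul_nonneg hz.1.1 (sub_nonneg.2 hz.1.2)) (mul_self_nonneg _)
  refine eq_zero_of_evalPt_eq_zero fun z _ => ?_
  rw [hre, hr0]; simp

/-- Exchange of the two variables. -/
def swapP : MvPolynomial (Fin 2) ℝ →ₐ[ℝ] MvPolynomial (Fin 2) ℝ :=
  MvPolynomial.rename (Equiv.swap 0 1)

lemma evalPt_swapP (q : MvPolynomial (Fin 2) ℝ) (z : ℝ × ℝ) :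
    evalPt (swapP q) z = evalPt q z.swap := by
  rw [evalPt, swapP, MvPolynomial.eval_rename, evalPt]
  congr 2
  ext i; fin_cases i <;> simp

lemma swapP_mono (a b : ℕ) : swapP (mono a b) = mono b a := by
  rw [swapP, mono, MvPolynomial.rename_monomial, mono]
  congr 1
  simp [expo, Finsupp.mapDomain_add, Finsupp.mapDomain_single, add_comm]

lemma swapP_mem {a b : ℤ} {q : MvPolynomial (Fin 2) ℝ} (hq : q ∈ polySpan (box a b)) :
    swapP q ∈ polySpan (box b a) :=
  map_mem_of_mono swapP.toLinearMap _ (fun i j hij => by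
    simp only [AlgHom.toLinearMap_apply, swapP_mono]
    exact mono_mem_polySpan ⟨hij.2, hij.1⟩) hq

lemma swapP_injective : Function.Injective swapP :=
  MvPolynomial.rename_injective _ (Equiv.injective _)

lemma green_zero (q : MvPolynomial (Fin 2) ℝ) : Green 0 0 0 q := by
  simp [Green, dot]

/-- The divergence lies in the span of the monomials against which its moments vanish, so it is
orthogonal to itself. -/
lemma IsInterpolant.divP_eq_zero {k : ℕ} {v : VecPoly} (hv : IsInterpolant k 0 0 0 v) :
    divP v = 0 := by
  refine eq_zero_of_integral_sq_eq_zero ?_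
  refine integral_mul_evalPt_eq_zero (continuous_evalPt _).integrableOn_refSquare
    (fun a b hab => ?_) (divP_mem hv.mem)
  have := hv.integral_div_sub_eq_zero integrableOn_zero integrableOn_zero
    (fun _ => integrableOn_zero) (fun a b _ _ => green_zero _) hab
  simpa [divPoly_eq] using this

/-- Injectivity of the degrees of freedom. The vanishing divergence first lowers the degrees to
those of a Raviart–Thomas field; the face and interior moments then treat each component separately.
-/
lemma IsInterpolant.eq_zero {k : ℕ} {v : VecPoly} (hv : IsInterpolant k 0 0 0 v) : v = 0 := by
  have hdiv := hv.divP_eq_zero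
  obtain ⟨hm1, hm2⟩ := hv.mem
  rw [SetLike.mem_coe, Q_eq] at hm1 hm2
  have hm1' : v.1 ∈ polySpan (box (k + 1) k) := by
    refine mem_polySpan_of_coeff fun a b hab => ?_
    by_cases h : (a, b) ∈ box (k + 2) k
    -- The coefficient of `x^(k+1) y^b` in the divergence comes from `x^(k+2) y^b` in the first
    -- component alone, because the second component has degree at most `k` in `x`.
    · obtain rfl : a = k + 2 := by
        simp only [box, Set.mem_ofPred_eq] at h hab; omega
      have h1 := congrArg (MvPolynomial.coeff (expo (k + 1) b)) hdiv
      simp only [divP, LinearMap.coe_mk, AddHom.coe_mk, MvPolynomial.coeff_add,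
        MvPolynomial.coeff_pderiv, MvPolynomial.coeff_zero] at h1
      rw [show expo (k + 1) b + Finsupp.single 1 1 = expo (k + 1) (b + 1) by
          ext i; fin_cases i <;> simp,
        show expo (k + 1) b + Finsupp.single 0 1 = expo (k + 2) b by
          ext i; fin_cases i <;> simp,
        coeff_eq_zero_of_mem_polySpan hm2 (a := k + 1) (b := b + 1)
          (by simp only [box, Set.mem_ofPred_eq]; omega), zero_mul, add_zero] at h1
      refine (mul_eq_zero.1 h1).resolve_right ?_
      positivity
    · exact coeff_eq_zero_of_mem_polySpan hm1 h
  have hm2' : v.2 ∈ polySpan (box k (k + 1)) := by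
    refine mem_polySpan_of_coeff fun a b hab => ?_
    by_cases h : (a, b) ∈ box k (k + 2)
    · obtain rfl : b = k + 2 := by
        simp only [box, Set.mem_ofPred_eq] at h hab; omega
      have h1 := congrArg (MvPolynomial.coeff (expo a (k + 1))) hdiv
      simp only [divP, LinearMap.coe_mk, AddHom.coe_mk, MvPolynomial.coeff_add,
        MvPolynomial.coeff_pderiv, MvPolynomial.coeff_zero] at h1
      rw [show expo a (k + 1) + Finsupp.single 0 1 = expo (a + 1) (k + 1) by
          ext i; fin_cases i <;> simp,
        show expo a (k + 1) + Finsupp.single 1 1 = expo a (k + 2) by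
          ext i; fin_cases i <;> simp,
        coeff_eq_zero_of_mem_polySpan hm1 (a := a + 1) (b := k + 1)
          (by simp only [box, Set.mem_ofPred_eq]; omega), zero_mul, zero_add] at h1
      refine (mul_eq_zero.1 h1).resolve_right ?_
      positivity
    · exact coeff_eq_zero_of_mem_polySpan hm2 h
  have hf := hv.face
  have e1 : v.1 = 0 := by
    refine eq_zero_of_side_of_interior hm1' (fun r hr => ?_) (fun r hr => ?_) (fun r hr => ?_)
    · have := hf .left r hr
      simpa [dot, evalVec, Face.param, Face.normal, integral_neg] using this
    · simpa [dot, evalVec, Face.param, Face.normal] using hf .right r hr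
    · have := hv.interior (r, 0) ⟨hr, Submodule.zero_mem _⟩
      simpa [dot, evalVec] using this
  -- Exchanging the variables turns bottom and top into left and right, so the argument for the
  -- first component applies to the second.
  have e2 : swapP v.2 = 0 := by
    refine eq_zero_of_side_of_interior (swapP_mem hm2') (fun r hr => ?_) (fun r hr => ?_)
      (fun r hr => ?_)
    · have := hf .bottom r hr
      simpa [dot, evalVec, Face.param, Face.normal, integral_neg, evalPt_swapP] using this
    · simpa [dot, evalVec, Face.param, Face.normal, evalPt_swapP] using hf .top r hr
    · have := hv.interior (0, swapP r) ⟨Submodule.zero_mem _, swapP_mem hr⟩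
      rw [← integral_refSquare_swap]
      simpa [dot, evalVec, evalPt_swapP] using this
  exact Prod.ext e1 (swapP_injective (by rw [e2, Prod.snd_zero, map_zero]))

lemma dot_sub (u v n : ℝ × ℝ) : dot (u - v) n = dot u n - dot v n := by
  simp only [dot, Prod.fst_sub, Prod.snd_sub]; ring

lemma evalVec_sub (v v' : VecPoly) (z : ℝ × ℝ) :
    evalVec (v - v') z = evalVec v z - evalVec v' z := by
  simp [evalVec]

lemma divPoly_sub (v v' : VecPoly) (z : ℝ × ℝ) :
    divPoly (v - v') z = divPoly v z - divPoly v' z := by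
  simp only [divPoly_eq, map_sub, evalPt_sub]

/-- Two interpolants of the same data differ by an interpolant of zero. -/
lemma IsInterpolant.sub {k : ℕ} {u : ℝ × ℝ → ℝ × ℝ} {w : ℝ × ℝ → ℝ}
    {g : Face → ℝ → ℝ} {v v' : VecPoly} (hv : IsInterpolant k u w g v)
    (hv' : IsInterpolant k u w g v')
    (hu : IntegrableOn u refSquare) (hw : IntegrableOn w refSquare)
    (hg : ∀ F, IntegrableOn (g F) (Set.Icc 0 1)) : IsInterpolant k 0 0 0 (v - v') := by
  have hdiv : ∀ (q : MvPolynomial (Fin 2) ℝ),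
      (∫ z in refSquare, (divPoly v z - w z) * evalPt q z = 0) →
      (∫ z in refSquare, (divPoly v' z - w z) * evalPt q z = 0) →
      ∫ z in refSquare, (divPoly (v - v') z - (0 : ℝ × ℝ → ℝ) z) * evalPt q z = 0 := by
    intro q h1 h2
    refine Eq.trans ?_ (sub_eq_zero.2 (h1.trans h2.symm))
    rw [← integral_sub]
    · congr 1; ext z; simp only [divPoly_sub, Pi.zero_apply]; ring
    · exact ((continuous_divPoly v).integrableOn_refSquare.sub hw).mul_continuous_refSquare
        (continuous_evalPt q)
    · exact ((continuous_divPoly v').integrableOn_refSquare.sub hw).mul_continuous_refSquare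
        (continuous_evalPt q)
  refine ⟨Submodule.sub_mem _ hv.mem hv'.mem, fun F q hq => ?_, fun q hq => ?_, fun i hi => ?_,
    fun i hi => ?_⟩
  · have hc : ∀ v, IntegrableOn (normalTrace v F) (Set.Icc 0 1) := fun v =>
      (continuous_normalTrace v F).continuousOn.integrableOn_compact isCompact_Icc
    have h1 := hv.face F q hq
    have h2 := hv'.face F q hq
    refine Eq.trans ?_ (sub_eq_zero.2 (h1.trans h2.symm))
    rw [← integral_sub]
    · congr 1; ext t; simp only [evalVec_sub, dot_sub, Pi.zero_apply]; ring
    · exact ((hc v).sub (hg F)).mul_continuous_Icc (Polynomial.continuous q)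
    · exact ((hc v').sub (hg F)).mul_continuous_Icc (Polynomial.continuous q)
  · have h1 := hv.interior q hq
    have h2 := hv'.interior q hq
    refine Eq.trans ?_ (sub_eq_zero.2 (h1.trans h2.symm))
    rw [← integral_sub]
    · congr 1; ext t
      simp only [evalVec_sub, Pi.zero_apply, dot, Prod.fst_sub, Prod.snd_sub, sub_zero]; ring
    · exact integrableOn_dot ((integrableOn_evalVec v).sub hu) q
    · exact integrableOn_dot ((integrableOn_evalVec v').sub hu) q
  · simpa only [evalPt_mono] using hdiv (mono i (k + 1))
      (by simpa only [evalPt_mono] using hv.div_x i hi)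
      (by simpa only [evalPt_mono] using hv'.div_x i hi)
  · simpa only [evalPt_mono] using hdiv (mono (k + 1) i)
      (by simpa only [evalPt_mono] using hv.div_y i hi)
      (by simpa only [evalPt_mono] using hv'.div_y i hi)

/-! ### Existence of the interpolant -/

/-- The indices of the degrees of freedom of `ABF_k`. -/
abbrev DofIdx (k : ℕ) : Type :=
  (Face × Fin (k + 1)) ⊕ (Fin k × Fin (k + 1)) ⊕ (Fin (k + 1) × Fin k) ⊕ Fin (k + 1) ⊕ Fin (k + 1)

/-- The degrees of freedom of a field `u` with divergence `w` and normal trace `g`. -/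
def dof (k : ℕ) (u : ℝ × ℝ → ℝ × ℝ) (w : ℝ × ℝ → ℝ) (g : Face → ℝ → ℝ) : DofIdx k → ℝ
  | .inl (F, i) => ∫ t in Set.Icc (0 : ℝ) 1, g F t * t ^ (i : ℕ)
  | .inr (.inl (a, b)) => ∫ z in refSquare, (u z).1 * (z.1 ^ (a : ℕ) * z.2 ^ (b : ℕ))
  | .inr (.inr (.inl (a, b))) => ∫ z in refSquare, (u z).2 * (z.1 ^ (a : ℕ) * z.2 ^ (b : ℕ))
  | .inr (.inr (.inr (.inl i))) => ∫ z in refSquare, w z * (z.1 ^ (i : ℕ) * z.2 ^ (k + 1))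
  | .inr (.inr (.inr (.inr i))) => ∫ z in refSquare, w z * (z.1 ^ (k + 1) * z.2 ^ (i : ℕ))

lemma integral_sub_mul_eq_zero {α : Type*} [MeasurableSpace α] {μ : Measure α} {f f' h : α → ℝ}
    (hf : Integrable (fun z => f z * h z) μ) (hf' : Integrable (fun z => f' z * h z) μ)
    (heq : ∫ z, f z * h z ∂μ = ∫ z, f' z * h z ∂μ) : ∫ z, (f z - f' z) * h z ∂μ = 0 := by
  simp only [sub_mul]
  rw [integral_sub hf hf', heq, sub_self]

lemma integrableOn_mul_xy {f : ℝ × ℝ → ℝ} (hf : IntegrableOn f refSquare) (a b : ℕ) :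
    IntegrableOn (fun z => f z * (z.1 ^ a * z.2 ^ b)) refSquare :=
  hf.mul_continuous_refSquare (by fun_prop)

/-- Every interpolation condition is linear in its test polynomial, so monomial tests suffice. This
makes interpolation a finite linear system. -/
lemma isInterpolant_of_dof_eq {k : ℕ} {u : ℝ × ℝ → ℝ × ℝ} {w : ℝ × ℝ → ℝ} {g : Face → ℝ → ℝ}
    (hu : IntegrableOn u refSquare) (hw : IntegrableOn w refSquare)
    (hg : ∀ F, IntegrableOn (g F) (Set.Icc 0 1)) {v : VecPoly} (hv : v ∈ abfSpace k)
    (h : dof k (evalVec v) (divPoly v) (normalTrace v) = dof k u w g) :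
    IsInterpolant k u w g v := by
  have hv' := integrableOn_evalVec v
  have hd := (continuous_divPoly v).integrableOn_refSquare
  refine ⟨hv, fun F q hq => ?_, fun q hq => ?_, fun i hi => ?_, fun i hi => ?_⟩
  · have hn : IntegrableOn (normalTrace v F) (Set.Icc 0 1) :=
      (continuous_normalTrace v F).continuousOn.integrableOn_compact isCompact_Icc
    refine integral_mul_eval_eq_zero (hn.sub (hg F)) (fun i hi => ?_) hq
    exact integral_sub_mul_eq_zero (hn.mul_continuous_Icc (by fun_prop))
      ((hg F).mul_continuous_Icc (by fun_prop)) (congrFun h (.inl (F, ⟨i, by omega⟩)))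
  · have h1 := integral_mul_evalPt_eq_zero
      ((fst_integrableOn hv').sub (fst_integrableOn hu)) (s := box (k - 1) k)
      (fun a b hab => by
        simp only [box, Set.mem_ofPred_eq] at hab
        exact integral_sub_mul_eq_zero (integrableOn_mul_xy (fst_integrableOn hv') a b)
          (integrableOn_mul_xy (fst_integrableOn hu) a b)
          (congrFun h (.inr (.inl (⟨a, by omega⟩, ⟨b, by omega⟩))))) hq.1
    have h2 := integral_mul_evalPt_eq_zero
      ((snd_integrableOn hv').sub (snd_integrableOn hu)) (s := box k (k - 1))
      (fun a b hab => by
        simp only [box, Set.mem_ofPred_eq] at hab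
        exact integral_sub_mul_eq_zero (integrableOn_mul_xy (snd_integrableOn hv') a b)
          (integrableOn_mul_xy (snd_integrableOn hu) a b)
          (congrFun h (.inr (.inr (.inl (⟨a, by omega⟩, ⟨b, by omega⟩)))))) hq.2
    simp only [dot, evalVec, Prod.fst_sub, Prod.snd_sub]
    rw [integral_add]
    · exact (congrArg₂ (· + ·) h1 h2).trans (add_zero 0)
    · exact ((fst_integrableOn hv').sub (fst_integrableOn hu)).mul_continuous_refSquare
        (continuous_evalPt _)
    · exact ((snd_integrableOn hv').sub (snd_integrableOn hu)).mul_continuous_refSquare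
        (continuous_evalPt _)
  · exact integral_sub_mul_eq_zero (integrableOn_mul_xy hd _ _) (integrableOn_mul_xy hw _ _)
      (congrFun h (.inr (.inr (.inr (.inl ⟨i, by omega⟩)))))
  · exact integral_sub_mul_eq_zero (integrableOn_mul_xy hd _ _) (integrableOn_mul_xy hw _ _)
      (congrFun h (.inr (.inr (.inr (.inr ⟨i, by omega⟩)))))

lemma evalVec_add (v v' : VecPoly) (z : ℝ × ℝ) :
    evalVec (v + v') z = evalVec v z + evalVec v' z := by simp [evalVec]

lemma evalVec_smul (c : ℝ) (v : VecPoly) (z : ℝ × ℝ) : evalVec (c • v) z = c • evalVec v z := by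
  simp [evalVec]

lemma normalTrace_add (v v' : VecPoly) (F : Face) (t : ℝ) :
    normalTrace (v + v') F t = normalTrace v F t + normalTrace v' F t := by
  simp only [normalTrace, evalVec_add, dot, Prod.fst_add, Prod.snd_add]; ring

lemma normalTrace_smul (c : ℝ) (v : VecPoly) (F : Face) (t : ℝ) :
    normalTrace (c • v) F t = c * normalTrace v F t := by
  simp only [normalTrace, evalVec_smul, dot, Prod.smul_fst, Prod.smul_snd, smul_eq_mul]; ring

/-- The degrees of freedom of a polynomial field, as a linear map. -/
def dofL (k : ℕ) : VecPoly →ₗ[ℝ] DofIdx k → ℝ where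
  toFun v := dof k (evalVec v) (divPoly v) (normalTrace v)
  map_add' v v' := by
    have hI : ∀ F : Face, ∀ v i, IntegrableOn (fun t => normalTrace v F t * t ^ i) (Set.Icc 0 1) :=
      fun F v i => ((continuous_normalTrace v F).mul
        (continuous_pow i)).continuousOn.integrableOn_compact isCompact_Icc
    have hJ : ∀ (q : MvPolynomial (Fin 2) ℝ) (a b : ℕ),
        IntegrableOn (fun z => evalPt q z * (z.1 ^ a * z.2 ^ b)) refSquare := fun q a b =>
      integrableOn_mul_xy (continuous_evalPt q).integrableOn_refSquare a b
    ext (⟨F, i⟩ | ⟨a, b⟩ | ⟨a, b⟩ | i | i)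
    · simp only [dof, Pi.add_apply, normalTrace_add, add_mul]
      exact integral_add (hI F v i) (hI F v' i)
    · simp only [dof, Pi.add_apply, evalVec_add, Prod.fst_add, add_mul]
      exact integral_add (hJ v.1 _ _) (hJ v'.1 _ _)
    · simp only [dof, Pi.add_apply, evalVec_add, Prod.snd_add, add_mul]
      exact integral_add (hJ v.2 _ _) (hJ v'.2 _ _)
    · simp only [dof, Pi.add_apply, divPoly_eq, map_add, evalPt_add, add_mul]
      exact integral_add (hJ _ _ _) (hJ _ _ _)
    · simp only [dof, Pi.add_apply, divPoly_eq, map_add, evalPt_add, add_mul]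
      exact integral_add (hJ _ _ _) (hJ _ _ _)
  map_smul' c v := by
    ext (⟨F, i⟩ | ⟨a, b⟩ | ⟨a, b⟩ | i | i) <;>
    simp only [dof, Pi.smul_apply, normalTrace_smul, mul_assoc, evalVec_smul, divPoly_eq, map_smul,
      evalPt_smul, Prod.smul_fst, Prod.smul_snd, smul_eq_mul, RingHom.id_apply, integral_const_mul]

/-- The indices of the coefficients of the elements of `ABF_k`. -/
abbrev CoeffIdx (k : ℕ) : Type := (Fin (k + 3) × Fin (k + 1)) ⊕ (Fin (k + 1) × Fin (k + 3))

/-- The element of `ABF_k` with given coefficients. -/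
def ofCoeff (k : ℕ) : (CoeffIdx k → ℝ) →ₗ[ℝ] VecPoly where
  toFun c := (∑ i, c (.inl i) • mono i.1 i.2, ∑ i, c (.inr i) • mono i.1 i.2)
  map_add' c c' := by simp [add_smul, Finset.sum_add_distrib]
  map_smul' r c := by simp [Finset.smul_sum, smul_smul]

lemma ofCoeff_mem (k : ℕ) (c : CoeffIdx k → ℝ) : ofCoeff k c ∈ abfSpace k := by
  constructor
  · refine Submodule.sum_mem (p := Q (k + 2) k) fun i _ => Submodule.smul_mem _ _ ?_
    rw [Q_eq]
    exact mono_mem_polySpan (by simp only [box, Set.mem_ofPred_eq]; omega)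
  · refine Submodule.sum_mem (p := Q k (k + 2)) fun i _ => Submodule.smul_mem _ _ ?_
    rw [Q_eq]
    exact mono_mem_polySpan (by simp only [box, Set.mem_ofPred_eq]; omega)

lemma expo_inj {a b c d : ℕ} : expo a b = expo c d ↔ a = c ∧ b = d := by
  refine ⟨fun h => ⟨?_, ?_⟩, fun h => by rw [h.1, h.2]⟩
  · simpa using DFunLike.congr_fun h 0
  · simpa using DFunLike.congr_fun h 1

lemma coeff_sum_mono {m n : ℕ} (c : Fin m × Fin n → ℝ) (j : Fin m × Fin n) :
    MvPolynomial.coeff (expo j.1 j.2) (∑ i, c i • mono i.1 i.2) = c j := by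
  simp only [MvPolynomial.coeff_sum, MvPolynomial.coeff_smul, mono, MvPolynomial.coeff_monomial,
    expo_inj, smul_eq_mul]
  rw [Finset.sum_eq_single j]
  · simp
  · intro i _ hij
    rw [if_neg, mul_zero]
    rintro ⟨h1, h2⟩
    exact hij (Prod.ext (Fin.ext h1) (Fin.ext h2))
  · simp

lemma ofCoeff_injective (k : ℕ) : Function.Injective (ofCoeff k) := by
  rw [injective_iff_map_eq_zero]
  intro c hc
  have h1 : ∑ i : Fin (k + 3) × Fin (k + 1), c (.inl i) • mono i.1 i.2 = 0 := congrArg Prod.fst hc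
  have h2 : ∑ i : Fin (k + 1) × Fin (k + 3), c (.inr i) • mono i.1 i.2 = 0 := congrArg Prod.snd hc
  ext (j | j)
  · rw [← coeff_sum_mono (fun i => c (.inl i)) j, h1]; simp
  · rw [← coeff_sum_mono (fun i => c (.inr i)) j, h2]; simp

/-- Unisolvence gives injectivity. The system is square, since `4(k+1) + 2k(k+1) + 2(k+1) =
2(k+1)(k+3)`, hence it is also surjective. -/
lemma dofL_comp_ofCoeff_bijective (k : ℕ) : Function.Bijective (dofL k ∘ₗ ofCoeff k) := by
  have hinj : Function.Injective (dofL k ∘ₗ ofCoeff k) := by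
    rw [injective_iff_map_eq_zero]
    intro c hc
    refine ofCoeff_injective k ?_
    rw [map_zero]
    refine IsInterpolant.eq_zero (isInterpolant_of_dof_eq integrableOn_zero integrableOn_zero
      (fun _ => integrableOn_zero) (ofCoeff_mem k c) (Eq.trans hc ?_))
    ext (⟨F, i⟩ | ⟨a, b⟩ | ⟨a, b⟩ | i | i) <;> simp [dof]
  refine ⟨hinj, (LinearMap.injective_iff_surjective_of_finrank_eq_finrank ?_).1 hinj⟩
  rw [Module.finrank_fintype_fun_eq_card, Module.finrank_fintype_fun_eq_card]
  simp only [Fintype.card_sum, Fintype.card_prod, Fintype.card_fin, show Fintype.card Face = 4 from rfl]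
  ring

/-- The interpolant of integrable data exists and is unique. -/
lemma existsUnique_isInterpolant (k : ℕ) {u : ℝ × ℝ → ℝ × ℝ} {w : ℝ × ℝ → ℝ} {g : Face → ℝ → ℝ}
    (hu : IntegrableOn u refSquare) (hw : IntegrableOn w refSquare)
    (hg : ∀ F, IntegrableOn (g F) (Set.Icc 0 1)) : ∃! v : VecPoly, IsInterpolant k u w g v := by
  obtain ⟨c, hc⟩ := (dofL_comp_ofCoeff_bijective k).2 (dof k u w g)
  refine ⟨ofCoeff k c, isInterpolant_of_dof_eq hu hw hg (ofCoeff_mem k c) hc, fun v' hv' => ?_⟩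
  exact sub_eq_zero.1 (hv'.sub (isInterpolant_of_dof_eq hu hw hg (ofCoeff_mem k c) hc)
    hu hw hg).eq_zero

lemma IsClassicalNormalTrace.integrableOn {u : ℝ × ℝ → ℝ × ℝ} {g : Face → ℝ → ℝ}
    (h : IsClassicalNormalTrace u g) (F : Face) : IntegrableOn (g F) (Set.Icc 0 1) := by
  have hmaps : Set.MapsTo F.param (Set.Icc 0 1) refSquare := by
    intro t ht
    cases F <;> simp only [Face.param, refSquare, Set.mem_prod] <;> exact ⟨by simp_all, by simp_all⟩
  have hc : ContinuousOn (fun t => u (F.param t)) (Set.Icc 0 1) :=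
    h.1.comp (continuous_param F).continuousOn hmaps
  have hc' : ContinuousOn (fun t => dot (u (F.param t)) F.normal) (Set.Icc 0 1) := by
    unfold dot
    exact (hc.fst.mul continuousOn_const).add (hc.snd.mul continuousOn_const)
  exact (hc'.congr fun t ht => h.2 F t ht).integrableOn_compact isCompact_Icc

/-! ### Cutoff functions -/

/-- A smooth function that rises from `0` at `x ≤ 1 / (n + 4)` to `1` at `x ≥ 2 / (n + 4)`. -/
def ramp (n : ℕ) (x : ℝ) : ℝ := Real.smoothTransition ((n + 4) * x - 1)

lemma contDiff_ramp (n : ℕ) : ContDiff ℝ ∞ (ramp n) :=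
  Real.smoothTransition.contDiff.comp (by fun_prop)

lemma ramp_nonneg (n : ℕ) (x : ℝ) : 0 ≤ ramp n x := Real.smoothTransition.nonneg _

lemma ramp_le_one (n : ℕ) (x : ℝ) : ramp n x ≤ 1 := Real.smoothTransition.le_one _

lemma ramp_eq_zero {n : ℕ} {x : ℝ} (h : (n + 4) * x ≤ 1) : ramp n x = 0 :=
  Real.smoothTransition.zero_of_nonpos (by linarith)

lemma ramp_eq_one {n : ℕ} {x : ℝ} (h : 2 ≤ (n + 4) * x) : ramp n x = 1 :=
  Real.smoothTransition.one_of_one_le (by linarith)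

lemma deriv_ramp_nonneg (n : ℕ) (x : ℝ) : 0 ≤ deriv (ramp n) x :=
  Monotone.deriv_nonneg fun a b hab =>
    Real.smoothTransition.monotone (by gcongr)

lemma continuous_deriv_ramp (n : ℕ) : Continuous (deriv (ramp n)) :=
  (contDiff_ramp n).continuous_deriv (by simp)

lemma hasDerivAt_ramp (n : ℕ) (x : ℝ) : HasDerivAt (ramp n) (deriv (ramp n) x) x :=
  ((contDiff_ramp n).differentiable (by simp) x).hasDerivAt

lemma deriv_ramp_eq_zero {n : ℕ} {x : ℝ} (h : 2 < (n + 4) * x) : deriv (ramp n) x = 0 := by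
  have : ramp n =ᶠ[𝓝 x] fun _ => 1 := by
    have ho : IsOpen {y : ℝ | 2 < (n + 4) * y} := isOpen_lt continuous_const (by fun_prop)
    filter_upwards [ho.mem_nhds h] with y hy using ramp_eq_one (le_of_lt hy)
  rw [this.deriv_eq, deriv_const]

lemma integral_deriv_ramp (n : ℕ) : ∫ x in Set.Icc (0 : ℝ) 1, deriv (ramp n) x = 1 := by
  rw [integral_Icc_eq_integral_Ioc, ← intervalIntegral.integral_of_le zero_le_one,
    intervalIntegral.integral_deriv_eq_sub
      (fun x _ => (contDiff_ramp n).differentiable (by simp) x)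
      ((continuous_deriv_ramp n).intervalIntegrable _ _),
    ramp_eq_zero (x := 0) (by simp), ramp_eq_one, sub_zero]
  have : (0 : ℝ) ≤ n := n.cast_nonneg
  linarith

/-- The derivatives of the ramps form an approximate identity at `0`: they are nonnegative, have
mass one on `[0,1]`, and vanish beyond `2 / (n + 4)`. -/
lemma tendsto_integral_deriv_ramp {f : ℝ → ℝ} (hf : ContinuousOn f (Set.Icc 0 1)) :
    Tendsto (fun n => ∫ x in Set.Icc (0 : ℝ) 1, deriv (ramp n) x * f x) atTop (𝓝 (f 0)) := by
  refine tendsto_setIntegral_peak_smul_of_integrableOn_of_tendsto (φ := fun n => deriv (ramp n))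
    measurableSet_Icc measurableSet_Icc le_rfl self_mem_nhdsWithin (by simp)
    (Eventually.of_forall fun n x _ => deriv_ramp_nonneg n x) (fun u hu h0 => ?_) ?_
    (Eventually.of_forall fun n => (continuous_deriv_ramp n).aestronglyMeasurable)
    (hf.integrableOn_compact isCompact_Icc) (hf 0 (by simp))
  · obtain ⟨δ, hδ, hball⟩ := Metric.isOpen_iff.1 hu 0 h0
    obtain ⟨N, hN⟩ := exists_nat_gt (2 / δ)
    rw [Metric.tendstoUniformlyOn_iff]
    intro ε hε
    filter_upwards [eventually_ge_atTop N] with n hn x hx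
    have hxδ : δ ≤ x := by
      by_contra! hlt
      exact hx.2 (hball (by simpa [abs_of_nonneg hx.1.1] using hlt))
    have h2 : 2 < (n + 4) * x := by
      have h3 : (2 : ℝ) < N * δ := by rwa [div_lt_iff₀ hδ] at hN
      have h4 : (N : ℝ) * δ ≤ (n + 4) * x := by
        have : (N : ℝ) ≤ n := by exact_mod_cast hn
        gcongr; linarith
      linarith
    simpa [deriv_ramp_eq_zero h2] using hε
  · simp only [integral_deriv_ramp]; exact tendsto_const_nhds

lemma norm_integral_deriv_ramp_le {f : ℝ → ℝ} {M : ℝ} (hM : ∀ x ∈ Set.Icc (0 : ℝ) 1, |f x| ≤ M)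
    (n : ℕ) : ‖∫ x in Set.Icc (0 : ℝ) 1, deriv (ramp n) x * f x‖ ≤ M := by
  have hi : IntegrableOn (fun x => deriv (ramp n) x * M) (Set.Icc 0 1) :=
    (((continuous_deriv_ramp n).mul continuous_const).continuousOn).integrableOn_compact
      isCompact_Icc
  calc _ ≤ ∫ x in Set.Icc (0 : ℝ) 1, deriv (ramp n) x * M := by
        refine norm_integral_le_of_norm_le hi (ae_restrict_of_forall_mem measurableSet_Icc ?_)
        intro x hx
        rw [norm_mul, Real.norm_of_nonneg (deriv_ramp_nonneg n x)]
        exact mul_le_mul_of_nonneg_left (hM x hx) (deriv_ramp_nonneg n x)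
    _ = M := by rw [integral_mul_const, integral_deriv_ramp, one_mul]

/-- A smooth cutoff function of the unit interval. -/
def cutoff (n : ℕ) (x : ℝ) : ℝ := ramp n x + ramp n (1 - x) - 1

lemma contDiff_cutoff (n : ℕ) : ContDiff ℝ ∞ (cutoff n) :=
  ((contDiff_ramp n).add ((contDiff_ramp n).comp (contDiff_const.sub contDiff_id))).sub
    contDiff_const

/-- Where one ramp vanishes the other is already saturated, because its argument scaled by `n + 4`
is at least `n + 3`. This is where the offset `4` leaves ample room. -/
lemma cutoff_eq_zero {n : ℕ} {x : ℝ} (h : (n + 4) * x ≤ 1 ∨ (n + 4) * (1 - x) ≤ 1) :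
    cutoff n x = 0 := by
  have hn : (0 : ℝ) ≤ n := n.cast_nonneg
  rcases h with h | h
  · rw [cutoff, ramp_eq_zero h, ramp_eq_one (by linarith)]; ring
  · rw [cutoff, ramp_eq_zero h, ramp_eq_one (by linarith)]; ring

lemma abs_cutoff_le (n : ℕ) (x : ℝ) : |cutoff n x| ≤ 1 := by
  rw [abs_le, cutoff]
  constructor <;> linarith [ramp_nonneg n x, ramp_le_one n x, ramp_nonneg n (1 - x),
    ramp_le_one n (1 - x)]

lemma tendsto_ramp {x : ℝ} (hx : 0 < x) : Tendsto (fun n => ramp n x) atTop (𝓝 1) := by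
  refine tendsto_const_nhds.congr' ?_
  obtain ⟨N, hN⟩ := exists_nat_gt (2 / x)
  filter_upwards [eventually_ge_atTop N] with n hn
  rw [ramp_eq_one]
  rw [div_lt_iff₀ hx] at hN
  have : (N : ℝ) * x ≤ (n + 4) * x := by
    have : (N : ℝ) ≤ n := by exact_mod_cast hn
    gcongr; linarith
  linarith

lemma tendsto_cutoff {x : ℝ} (hx : x ∈ Set.Ioo (0 : ℝ) 1) :
    Tendsto (fun n => cutoff n x) atTop (𝓝 1) := by
  have := ((tendsto_ramp hx.1).add (tendsto_ramp (sub_pos.2 hx.2))).sub_const 1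
  simpa [cutoff] using this

/-- Since the cutoff is a sum of ramps and not a product, its derivative is just a peak near `0`
minus the mirrored peak near `1`. These peaks produce the boundary terms of Green's formula. -/
lemma hasDerivAt_cutoff (n : ℕ) (x : ℝ) :
    HasDerivAt (cutoff n) (deriv (ramp n) x - deriv (ramp n) (1 - x)) x := by
  have h := ((hasDerivAt_ramp n x).add
    ((hasDerivAt_ramp n (1 - x)).comp x ((hasDerivAt_id x).const_sub 1))).sub_const 1
  simp only [mul_neg, mul_one, ← sub_eq_add_neg] at h
  exact h

lemma deriv_cutoff (n : ℕ) (x : ℝ) :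
    deriv (cutoff n) x = deriv (ramp n) x - deriv (ramp n) (1 - x) := (hasDerivAt_cutoff n x).deriv

lemma continuous_deriv_cutoff (n : ℕ) : Continuous (deriv (cutoff n)) :=
  (contDiff_cutoff n).continuous_deriv (by simp)

lemma integral_Icc_one_sub (f : ℝ → ℝ) :
    ∫ x in Set.Icc (0 : ℝ) 1, f (1 - x) = ∫ x in Set.Icc (0 : ℝ) 1, f x := by
  simp only [integral_Icc_eq_integral_Ioc, ← intervalIntegral.integral_of_le zero_le_one]
  rw [intervalIntegral.integral_comp_sub_left]; simp

lemma integral_deriv_cutoff_mul {f : ℝ → ℝ} (hf : ContinuousOn f (Set.Icc 0 1)) (n : ℕ) :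
    ∫ x in Set.Icc (0 : ℝ) 1, deriv (cutoff n) x * f x =
      (∫ x in Set.Icc (0 : ℝ) 1, deriv (ramp n) x * f x)
        - ∫ x in Set.Icc (0 : ℝ) 1, deriv (ramp n) x * f (1 - x) := by
  have h1 : IntegrableOn (fun x => deriv (ramp n) x * f x) (Set.Icc 0 1) :=
    ((continuous_deriv_ramp n).continuousOn.mul hf).integrableOn_compact isCompact_Icc
  have h2 : IntegrableOn (fun x => deriv (ramp n) (1 - x) * f x) (Set.Icc 0 1) :=
    ((((continuous_deriv_ramp n).comp (continuous_const.sub continuous_id))).continuousOn.mul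
      hf).integrableOn_compact isCompact_Icc
  have h3 := integral_Icc_one_sub fun x => deriv (ramp n) (1 - x) * f x
  simp only [sub_sub_cancel] at h3
  rw [h3, ← integral_sub h1 h2]
  simp only [deriv_cutoff, sub_mul]

lemma continuousOn_comp_one_sub {f : ℝ → ℝ} (hf : ContinuousOn f (Set.Icc 0 1)) :
    ContinuousOn (fun x => f (1 - x)) (Set.Icc 0 1) :=
  hf.comp (by fun_prop) fun x hx => ⟨by linarith [hx.2], by linarith [hx.1]⟩

lemma tendsto_integral_deriv_cutoff {f : ℝ → ℝ} (hf : ContinuousOn f (Set.Icc 0 1)) :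
    Tendsto (fun n => ∫ x in Set.Icc (0 : ℝ) 1, deriv (cutoff n) x * f x) atTop
      (𝓝 (f 0 - f 1)) := by
  simp only [integral_deriv_cutoff_mul hf]
  have := (tendsto_integral_deriv_ramp hf).sub
    (tendsto_integral_deriv_ramp (continuousOn_comp_one_sub hf))
  simpa using this

lemma norm_integral_deriv_cutoff_le {f : ℝ → ℝ} (hf : ContinuousOn f (Set.Icc 0 1)) {M : ℝ}
    (hM : ∀ x ∈ Set.Icc (0 : ℝ) 1, |f x| ≤ M) (n : ℕ) :
    ‖∫ x in Set.Icc (0 : ℝ) 1, deriv (cutoff n) x * f x‖ ≤ 2 * M := by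
  rw [integral_deriv_cutoff_mul hf]
  refine (norm_sub_le _ _).trans ?_
  have h1 := norm_integral_deriv_ramp_le hM n
  have h2 := norm_integral_deriv_ramp_le (f := fun x => f (1 - x))
    (fun x hx => hM (1 - x) ⟨by linarith [hx.2], by linarith [hx.1]⟩) n
  linarith

lemma ae_Icc_of_forall_Ioo {p : ℝ → Prop} (h : ∀ y ∈ Set.Ioo (0 : ℝ) 1, p y) :
    ∀ᵐ y ∂volume.restrict (Set.Icc (0 : ℝ) 1), p y := by
  rw [← Measure.restrict_congr_set Ioo_ae_eq_Icc]
  exact ae_restrict_of_forall_mem measurableSet_Ioo h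

/-- By Fubini the inner integral in `x` tends to `F(0,y) - F(1,y)`, while the factor `cutoff n y`
tends to one. The bound `2 M` on the inner integrals gives dominated convergence in `y`. -/
lemma tendsto_integral_deriv_cutoff_fst {F : ℝ × ℝ → ℝ} (hF : ContinuousOn F refSquare) :
    Tendsto (fun n => ∫ z in refSquare, deriv (cutoff n) z.1 * cutoff n z.2 * F z) atTop
      (𝓝 (∫ y in Set.Icc (0 : ℝ) 1, (F (0, y) - F (1, y)))) := by
  obtain ⟨M, hM⟩ := isCompact_refSquare.exists_bound_of_continuousOn hF
  have hslice : ∀ y ∈ Set.Icc (0 : ℝ) 1, ContinuousOn (fun x => F (x, y)) (Set.Icc 0 1) :=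
    fun y hy => hF.comp (by fun_prop) fun x hx => ⟨hx, hy⟩
  have hint : ∀ n, Integrable (fun z : ℝ × ℝ => deriv (cutoff n) z.1 * cutoff n z.2 * F z)
      (unitMeasure.prod unitMeasure) := fun n => by
    rw [← restrict_refSquare]
    refine ContinuousOn.integrableOn_compact isCompact_refSquare (ContinuousOn.mul ?_ hF)
    have h1 := continuous_deriv_cutoff n
    have h2 := (contDiff_cutoff n).continuous
    fun_prop
  have heq : ∀ n, ∫ z in refSquare, deriv (cutoff n) z.1 * cutoff n z.2 * F z =
      ∫ y in Set.Icc (0 : ℝ) 1, cutoff n y * ∫ x in Set.Icc (0 : ℝ) 1,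
        deriv (cutoff n) x * F (x, y) := fun n => by
    rw [restrict_refSquare, integral_prod_symm _ (hint n)]
    change ∫ y in Set.Icc (0 : ℝ) 1, _ = _
    congr 1; ext y
    rw [← integral_const_mul]
    change ∫ x in Set.Icc (0 : ℝ) 1, _ = _
    congr 1; ext x
    ring
  simp only [heq]
  refine tendsto_integral_of_dominated_convergence (fun _ => 2 * M) (fun n => ?_)
    (integrable_const _) (fun n => ?_) ?_
  · have := (hint n).swap.integral_prod_left.aestronglyMeasurable
    refine this.congr (Eventually.of_forall fun y => ?_)
    change ∫ x in Set.Icc (0 : ℝ) 1, deriv (cutoff n) x * cutoff n y * F (x, y)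
      = cutoff n y * ∫ x in Set.Icc (0 : ℝ) 1, deriv (cutoff n) x * F (x, y)
    rw [← integral_const_mul]
    congr 1; ext x; ring
  · refine ae_Icc_of_forall_Ioo fun y hy => ?_
    have hy' := Set.Ioo_subset_Icc_self hy
    rw [norm_mul]
    have h1 := abs_cutoff_le n y
    have h2 := norm_integral_deriv_cutoff_le (hslice y hy')
      (fun x hx => hM (x, y) ⟨hx, hy'⟩) n
    calc _ ≤ 1 * (2 * M) := mul_le_mul h1 h2 (norm_nonneg _) zero_le_one
      _ = _ := one_mul _
  · refine ae_Icc_of_forall_Ioo fun y hy => ?_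
    simpa using (tendsto_cutoff hy).mul
      (tendsto_integral_deriv_cutoff (hslice y (Set.Ioo_subset_Icc_self hy)))

lemma swap_mem_refSquare {z : ℝ × ℝ} (h : z ∈ refSquare) : z.swap ∈ refSquare := ⟨h.2, h.1⟩

lemma tendsto_integral_deriv_cutoff_snd {F : ℝ × ℝ → ℝ} (hF : ContinuousOn F refSquare) :
    Tendsto (fun n => ∫ z in refSquare, cutoff n z.1 * deriv (cutoff n) z.2 * F z) atTop
      (𝓝 (∫ x in Set.Icc (0 : ℝ) 1, (F (x, 0) - F (x, 1)))) := by
  have := tendsto_integral_deriv_cutoff_fst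
    (hF.comp continuous_swap.continuousOn fun z hz => swap_mem_refSquare hz)
  refine this.congr fun n => ?_
  rw [← integral_refSquare_swap]
  simp [mul_comm]

lemma isTestFunction_cutoff_mul (n : ℕ) {h : ℝ × ℝ → ℝ} (hh : ContDiff ℝ ∞ h) :
    IsTestFunction fun z => cutoff n z.1 * cutoff n z.2 * h z := by
  have hpos : (0 : ℝ) < n + 4 := by positivity
  let c : ℝ := 1 / (n + 4)
  have hc : 0 < c := by positivity
  have hc' : (n + 4) * c = 1 := by simp only [c]; field_simp
  let K : Set (ℝ × ℝ) := Set.Icc c (1 - c) ×ˢ Set.Icc c (1 - c)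
  have hK : IsCompact K := isCompact_Icc.prod isCompact_Icc
  have hcut : ∀ x, x ∉ Set.Icc c (1 - c) → cutoff n x = 0 := fun x hx => by
    apply cutoff_eq_zero
    by_contra! hlt
    refine hx ⟨?_, ?_⟩
    · nlinarith [hlt.1]
    · nlinarith [hlt.2]
  have hsub : Function.support (fun z : ℝ × ℝ => cutoff n z.1 * cutoff n z.2 * h z) ⊆ K := by
    intro z hz
    by_contra hzK
    refine hz ?_
    change _ * _ * _ = (0 : ℝ)
    by_cases h1 : z.1 ∈ Set.Icc c (1 - c)
    · rw [hcut z.2 fun h2 => hzK ⟨h1, h2⟩]; ring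
    · rw [hcut z.1 h1]; ring
  refine ⟨?_, HasCompactSupport.of_support_subset_isCompact hK hsub,
    (closure_minimal hsub hK.isClosed).trans ?_⟩
  · exact (((contDiff_cutoff n).comp contDiff_fst).mul ((contDiff_cutoff n).comp contDiff_snd)).mul
      hh
  · have : Set.Icc c (1 - c) ⊆ Set.Ioo 0 1 := fun x hx =>
      ⟨hc.trans_le hx.1, hx.2.trans_lt (by linarith)⟩
    exact Set.prod_mono this this

lemma tendsto_integral_cutoff_mul {F : ℝ × ℝ → ℝ} (hF : IntegrableOn F refSquare) :
    Tendsto (fun n => ∫ z in refSquare, cutoff n z.1 * cutoff n z.2 * F z) atTop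
      (𝓝 (∫ z in refSquare, F z)) := by
  refine tendsto_integral_of_dominated_convergence (fun z => ‖F z‖) (fun n => ?_) hF.norm
    (fun n => Eventually.of_forall fun z => ?_) ?_
  · have := (contDiff_cutoff n).continuous
    exact AEStronglyMeasurable.mul (Continuous.aestronglyMeasurable (by fun_prop))
      hF.aestronglyMeasurable
  · rw [norm_mul, norm_mul]
    have h1 := abs_cutoff_le n z.1
    have h2 := abs_cutoff_le n z.2
    exact mul_le_of_le_one_left (norm_nonneg _) (mul_le_one₀ h1 (norm_nonneg _) h2)
  · rw [← restrict_openSquare]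
    refine ae_restrict_of_forall_mem measurableSet_openSquare fun z hz => ?_
    simpa using ((tendsto_cutoff hz.1).mul (tendsto_cutoff hz.2)).mul_const (F z)

/-! ### Green's formula for fields with an integrable normal trace -/

lemma hasFDerivAt_tensor_mul {a b : ℝ → ℝ} (ha : Differentiable ℝ a) (hb : Differentiable ℝ b)
    {h : ℝ × ℝ → ℝ} (hh : Differentiable ℝ h) (z : ℝ × ℝ) :
    HasFDerivAt (fun z : ℝ × ℝ => a z.1 * b z.2 * h z)
      ((a z.1 * b z.2) • fderiv ℝ h z + h z • (a z.1 • (deriv b z.2 • ContinuousLinearMap.snd ℝ ℝ ℝ)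
        + b z.2 • (deriv a z.1 • ContinuousLinearMap.fst ℝ ℝ ℝ))) z := by
  have h1 : HasFDerivAt (fun z : ℝ × ℝ => a z.1) (deriv a z.1 • ContinuousLinearMap.fst ℝ ℝ ℝ) z :=
    (ha z.1).hasDerivAt.comp_hasFDerivAt z hasFDerivAt_fst
  have h2 : HasFDerivAt (fun z : ℝ × ℝ => b z.2) (deriv b z.2 • ContinuousLinearMap.snd ℝ ℝ ℝ) z :=
    (hb z.2).hasDerivAt.comp_hasFDerivAt z hasFDerivAt_snd
  exact (h1.mul h2).mul (hh z).hasFDerivAt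

lemma dx_tensor_mul {a b : ℝ → ℝ} (ha : Differentiable ℝ a) (hb : Differentiable ℝ b)
    {h : ℝ × ℝ → ℝ} (hh : Differentiable ℝ h) (z : ℝ × ℝ) :
    dx (fun z : ℝ × ℝ => a z.1 * b z.2 * h z) z =
      a z.1 * b z.2 * dx h z + deriv a z.1 * b z.2 * h z := by
  rw [dx, (hasFDerivAt_tensor_mul ha hb hh z).fderiv]
  simp [dx]; ring

lemma dy_tensor_mul {a b : ℝ → ℝ} (ha : Differentiable ℝ a) (hb : Differentiable ℝ b)
    {h : ℝ × ℝ → ℝ} (hh : Differentiable ℝ h) (z : ℝ × ℝ) :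
    dy (fun z : ℝ × ℝ => a z.1 * b z.2 * h z) z =
      a z.1 * b z.2 * dy h z + a z.1 * deriv b z.2 * h z := by
  rw [dy, (hasFDerivAt_tensor_mul ha hb hh z).fderiv]
  simp [dy]; ring

/-- A polynomial is not a test function, but its product with the cutoffs is. When the derivative
falls on a cutoff it concentrates on a pair of opposite faces, and continuity of `u` up to the
boundary identifies the limit with the pointwise normal component. -/
lemma IsClassicalNormalTrace.green {u : ℝ × ℝ → ℝ × ℝ} {w : ℝ × ℝ → ℝ} {g : Face → ℝ → ℝ}
    (hu : IsClassicalNormalTrace u g) (hdiv : IsWeakDiv u w) (hw : IntegrableOn w refSquare)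
    (q : MvPolynomial (Fin 2) ℝ) : Green u w g q := by
  have hint : IntegrableOn u refSquare := hu.1.integrableOn_compact isCompact_refSquare
  set G : VecPoly := (MvPolynomial.pderiv 0 q, MvPolynomial.pderiv 1 q) with hG
  have hA : IntegrableOn (fun z => dot (u z) (evalVec G z) + w z * evalPt q z) refSquare :=
    (integrableOn_dot hint G).add (hw.mul_continuous_refSquare (continuous_evalPt q))
  have hc1 : ContinuousOn (fun z => (u z).1 * evalPt q z) refSquare :=
    hu.1.fst.mul (continuous_evalPt q).continuousOn
  have hc2 : ContinuousOn (fun z => (u z).2 * evalPt q z) refSquare :=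
    hu.1.snd.mul (continuous_evalPt q).continuousOn
  have hcc : ∀ n, Continuous fun z : ℝ × ℝ => cutoff n z.1 * cutoff n z.2 := fun n => by
    have := (contDiff_cutoff n).continuous
    fun_prop
  -- The definition of weak divergence, with the terms sorted by whether the derivative falls on `q`
  -- or on a cutoff.
  have key : ∀ n, ∫ z in refSquare, cutoff n z.1 * cutoff n z.2 *
        (dot (u z) (evalVec G z) + w z * evalPt q z) =
      -((∫ z in refSquare, deriv (cutoff n) z.1 * cutoff n z.2 * ((u z).1 * evalPt q z)) +
        ∫ z in refSquare, cutoff n z.1 * deriv (cutoff n) z.2 * ((u z).2 * evalPt q z)) := by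
    intro n
    have hd : Differentiable ℝ (cutoff n) := (contDiff_cutoff n).differentiable (by simp)
    have h := hdiv.integral_eq _ (isTestFunction_cutoff_mul n (contDiff_evalPt q))
    simp only [dx_tensor_mul hd hd (differentiable_evalPt q),
      dy_tensor_mul hd hd (differentiable_evalPt q), dx_evalPt, dy_evalPt,
      restrict_openSquare] at h
    have cc1 := continuous_deriv_cutoff n
    have cc2 := (contDiff_cutoff n).continuous
    have i1 : IntegrableOn (fun z : ℝ × ℝ => deriv (cutoff n) z.1 * cutoff n z.2 *
        ((u z).1 * evalPt q z)) refSquare :=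
      (ContinuousOn.mul (Continuous.continuousOn (by fun_prop)) hc1).integrableOn_compact
        isCompact_refSquare
    have i2 : IntegrableOn (fun z : ℝ × ℝ => cutoff n z.1 * deriv (cutoff n) z.2 *
        ((u z).2 * evalPt q z)) refSquare :=
      (ContinuousOn.mul (Continuous.continuousOn (by fun_prop)) hc2).integrableOn_compact
        isCompact_refSquare
    have i3 : IntegrableOn (fun z : ℝ × ℝ => dot (u z) (evalVec G z) *
        (cutoff n z.1 * cutoff n z.2)) refSquare :=
      (integrableOn_dot hint G).mul_continuous_refSquare (hcc n)
    have i4 : IntegrableOn (fun z : ℝ × ℝ => w z * (cutoff n z.1 * cutoff n z.2 * evalPt q z))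
        refSquare :=
      hw.mul_continuous_refSquare ((hcc n).mul (continuous_evalPt q))
    have h' : ∫ z in refSquare, (dot (u z) (evalVec G z) * (cutoff n z.1 * cutoff n z.2) +
        (deriv (cutoff n) z.1 * cutoff n z.2 * ((u z).1 * evalPt q z) +
          cutoff n z.1 * deriv (cutoff n) z.2 * ((u z).2 * evalPt q z))) =
        -∫ z in refSquare, w z * (cutoff n z.1 * cutoff n z.2 * evalPt q z) := by
      rw [← h]
      congr 1; ext z
      simp only [dot, evalVec, hG]; ring
    have hi12 := Integrable.add i1 i2
    have e1 := integral_add i3 hi12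
    have e2 := integral_add i1 i2
    have e3 := integral_add i3 i4
    simp only [Pi.add_apply] at e1
    rw [e1, e2] at h'
    have h'' : ∫ z in refSquare, cutoff n z.1 * cutoff n z.2 *
        (dot (u z) (evalVec G z) + w z * evalPt q z) =
        ∫ z in refSquare, (dot (u z) (evalVec G z) * (cutoff n z.1 * cutoff n z.2) +
          w z * (cutoff n z.1 * cutoff n z.2 * evalPt q z)) := by
      congr 1; ext z; ring
    rw [h'', e3]
    linarith
  have L1 := tendsto_integral_cutoff_mul hA
  simp only [key] at L1
  have L2 := ((tendsto_integral_deriv_cutoff_fst hc1).add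
    (tendsto_integral_deriv_cutoff_snd hc2)).neg
  have huniq := tendsto_nhds_unique L1 L2
  unfold Green
  rw [huniq, sum_face]
  have hcont : ∀ F : Face, ∀ f : ℝ × ℝ → ℝ, ContinuousOn f refSquare →
      IntegrableOn (fun t => f (F.param t)) (Set.Icc 0 1) := by
    intro F f hf
    refine (hf.comp (continuous_param F).continuousOn fun t ht => ?_).integrableOn_compact
      isCompact_Icc
    cases F <;> simp only [Face.param, refSquare, Set.mem_prod] <;> exact ⟨by simp_all, by simp_all⟩
  have hface : ∀ F : Face, ∫ t in Set.Icc (0 : ℝ) 1, g F t * evalPt q (F.param t) =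
      ∫ t in Set.Icc (0 : ℝ) 1, dot (u (F.param t)) F.normal * evalPt q (F.param t) := fun F =>
    setIntegral_congr_fun measurableSet_Icc fun t ht => by simp only [hu.2 F t ht]
  simp only [hface]
  have e1 := integral_sub (hcont .left _ hc1) (hcont .right _ hc1)
  have e2 := integral_sub (hcont .bottom _ hc2) (hcont .top _ hc2)
  simp only [Face.param] at e1 e2
  rw [e1, e2]
  simp only [dot, Face.param, Face.normal, mul_neg, mul_one, mul_zero, add_zero, zero_add, neg_mul,
    integral_neg]
  ring

lemma IsWeakNormalTrace.green {u : ℝ × ℝ → ℝ × ℝ} {w : ℝ × ℝ → ℝ} {g : Face → ℝ → ℝ}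
    (hu : IsWeakNormalTrace u w g) (q : MvPolynomial (Fin 2) ℝ) : Green u w g q := by
  unfold Green
  rw [sum_face, hu.2 _ (contDiff_evalPt q)]
  simp only [dx_evalPt, dy_evalPt, dot, evalVec]

lemma integrableOn_normalTrace {u : ℝ × ℝ → ℝ × ℝ} {w : ℝ × ℝ → ℝ} {g : Face → ℝ → ℝ}
    (h : IsClassicalNormalTrace u g ∨ IsWeakNormalTrace u w g) (F : Face) :
    IntegrableOn (g F) (Set.Icc 0 1) :=
  h.elim (fun h => h.integrableOn F) fun h => h.1 F

/-! ### Stability of the divergence of the interpolant -/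

/-- A polynomial with exponents in `s` is bounded on the square by its moments. -/
lemma exists_bound_of_moments (s : Finset (ℕ × ℕ)) : ∃ C : ℝ, 0 ≤ C ∧ ∀ q ∈ polySpan s, ∀ M : ℝ,
    0 ≤ M → (∀ i ∈ s, |∫ z in refSquare, evalPt q z * (z.1 ^ i.1 * z.2 ^ i.2)| ≤ M) →
    ∀ z ∈ refSquare, |evalPt q z| ≤ C * M := by
  let P : (s → ℝ) →ₗ[ℝ] MvPolynomial (Fin 2) ℝ :=
    { toFun := fun c => ∑ i, c i • mono i.1.1 i.1.2
      map_add' := fun c c' => by simp [add_smul, Finset.sum_add_distrib]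
      map_smul' := fun r c => by simp [Finset.smul_sum, smul_smul] }
  have hPmem : ∀ c, P c ∈ polySpan s := fun c =>
    Submodule.sum_mem _ fun i _ => Submodule.smul_mem _ _ (mono_mem_polySpan (by simp))
  have hint : ∀ (q : MvPolynomial (Fin 2) ℝ) (i : ℕ × ℕ),
      IntegrableOn (fun z => evalPt q z * (z.1 ^ i.1 * z.2 ^ i.2)) refSquare := fun q i =>
    integrableOn_mul_xy (continuous_evalPt q).integrableOn_refSquare _ _
  let A : (s → ℝ) →ₗ[ℝ] (s → ℝ) :=
    { toFun := fun c i => ∫ z in refSquare, evalPt (P c) z * (z.1 ^ i.1.1 * z.2 ^ i.1.2)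
      map_add' := fun c c' => by
        ext i
        simp only [map_add, evalPt_add, add_mul, Pi.add_apply]
        exact integral_add (hint _ _) (hint _ _)
      map_smul' := fun r c => by
        ext i
        simp only [map_smul, evalPt_smul, mul_assoc, integral_const_mul, Pi.smul_apply,
          smul_eq_mul, RingHom.id_apply] }
  have hcoeff : ∀ c (i : s), MvPolynomial.coeff (expo i.1.1 i.1.2) (P c) = c i := by
    intro c i
    simp only [P, LinearMap.coe_mk, AddHom.coe_mk, MvPolynomial.coeff_sum, MvPolynomial.coeff_smul,
      mono, MvPolynomial.coeff_monomial, expo_inj, smul_eq_mul]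
    rw [Finset.sum_eq_single i]
    · simp
    · intro j _ hji
      rw [if_neg, mul_zero]
      rintro ⟨h1, h2⟩
      exact hji (Subtype.ext (Prod.ext h1 h2))
    · simp
  -- `A` is the Gram matrix of the monomials: a combination with vanishing moments is orthogonal to
  -- itself. Injectivity in finite dimension then yields a quantitative lower bound.
  have hA : LinearMap.ker A = ⊥ := by
    rw [LinearMap.ker_eq_bot']
    intro c hc
    have hP : P c = 0 := by
      refine eq_zero_of_integral_sq_eq_zero (integral_mul_evalPt_eq_zero
        (continuous_evalPt _).integrableOn_refSquare (s := s) (fun a b hab => ?_) (hPmem c))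
      exact congrFun hc ⟨(a, b), hab⟩
    ext i
    rw [← hcoeff c i, hP]; simp
  obtain ⟨K, -, hK⟩ := A.exists_antilipschitzWith hA
  -- Each coefficient is at most `K M` in absolute value, each monomial is at most one on the
  -- square, and there are `s.card` of them.
  refine ⟨s.card * K, by positivity, fun q hq M hM h z hz => ?_⟩
  let c : s → ℝ := fun i => q.coeff (expo i.1.1 i.1.2)
  have hPc : P c = q := by
    conv_rhs => rw [eq_sum_of_mem_polySpan hq, ← Finset.sum_coe_sort]
    rfl
  have hc : ‖c‖ ≤ K * M := by
    refine (ZeroHomClass.bound_of_antilipschitz A hK c).trans ?_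
    gcongr
    refine (pi_norm_le_iff_of_nonneg hM).2 fun i => ?_
    have := h i.1 i.2
    rw [← hPc] at this
    exact this
  have heval : evalPt q z = ∑ i : s, c i * (z.1 ^ i.1.1 * z.2 ^ i.1.2) := by
    rw [← hPc]
    change evalPt (∑ i : s, c i • mono i.1.1 i.1.2) z = _
    simp only [evalPt_sum, evalPt_smul, evalPt_mono]
  rw [heval]
  refine (Finset.abs_sum_le_sum_abs _ _).trans ?_
  have hterm : ∀ i : s, |c i * (z.1 ^ i.1.1 * z.2 ^ i.1.2)| ≤ K * M := fun i => by
    have h1 : |z.1 ^ i.1.1 * z.2 ^ i.1.2| ≤ 1 := by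
      rw [abs_of_nonneg (mul_nonneg (pow_nonneg hz.1.1 _) (pow_nonneg hz.2.1 _))]
      exact mul_le_one₀ (pow_le_one₀ hz.1.1 hz.1.2) (pow_nonneg hz.2.1 _)
        (pow_le_one₀ hz.2.1 hz.2.2)
    rw [abs_mul]
    have h2 : |c i| ≤ K * M := (norm_le_pi_norm c i).trans hc
    calc _ ≤ (K * M) * 1 := mul_le_mul h2 h1 (abs_nonneg _) (by positivity)
      _ = _ := mul_one _
  refine (Finset.sum_le_card_nsmul _ _ _ fun i _ => hterm i).trans ?_
  simp [mul_assoc]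

/-- The divergence of the interpolant is a quasi-optimal approximation of the divergence. -/
lemma exists_normLp_sub_divPoly_le (k : ℕ) {p : ℝ≥0∞} (hp : 1 ≤ p) :
    ∃ C : ℝ≥0, 1 ≤ C ∧ ∀ (u : ℝ × ℝ → ℝ × ℝ) (w : ℝ × ℝ → ℝ) (g : Face → ℝ → ℝ) (v : VecPoly),
      IntegrableOn u refSquare → IsWeakDiv u w → MemLp w p (volume.restrict refSquare) →
      (IsClassicalNormalTrace u g ∨ IsWeakNormalTrace u w g) → IsInterpolant k u w g v →
      ∀ r ∈ polySpan (divExpo k), normLp p (fun z => w z - divPoly v z) ≤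
        C * normLp p (fun z => w z - evalPt r z) := by
  obtain ⟨C, hC, hbound⟩ := exists_bound_of_moments (divExpo k)
  -- The constant comes from the triangle inequality for `w - div v = (w - r) - (div v - r)`, with
  -- the last term bounded by its moments.
  refine ⟨1 + C.toNNReal, by simp, fun u w g v hu hdiv hw hg hv r hr => ?_⟩
  have hw1 : IntegrableOn w refSquare := hw.integrable hp
  have hrc : IntegrableOn (evalPt r) refSquare := (continuous_evalPt r).integrableOn_refSquare
  have hf : IntegrableOn (fun z => w z - evalPt r z) refSquare := hw1.sub hrc
  have hproj : ∀ i ∈ divExpo k,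
      ∫ z in refSquare, (divPoly v z - w z) * (z.1 ^ i.1 * z.2 ^ i.2) = 0 := fun i hi =>
    hv.integral_div_sub_eq_zero hu hw1 (integrableOn_normalTrace hg)
      (fun a b _ _ => hg.elim (fun h => h.green hdiv hw1 _) fun h => h.green _) hi
  have hmem : divP v - r ∈ polySpan (divExpo k) := Submodule.sub_mem _ (divP_mem hv.mem) hr
  set M : ℝ := ∫ z in refSquare, ‖w z - evalPt r z‖ with hMdef
  have hM : 0 ≤ M := integral_nonneg fun _ => norm_nonneg _
  -- By the projection property `div v - r` and `w - r` have the same moments, and those of `w - r`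
  -- are at most its `L¹` norm, hence its `L^p` norm on a probability space.
  have hsup := hbound _ hmem M hM fun i hi => by
    have hd := integrableOn_mul_xy
      ((continuous_divPoly v).integrableOn_refSquare.sub hw1) i.1 i.2
    have hf' := integrableOn_mul_xy hf i.1 i.2
    have : ∫ z in refSquare, evalPt (divP v - r) z * (z.1 ^ i.1 * z.2 ^ i.2) =
        ∫ z in refSquare, (w z - evalPt r z) * (z.1 ^ i.1 * z.2 ^ i.2) := by
      rw [← zero_add (∫ z in refSquare, (w z - evalPt r z) * _), ← hproj i hi]
      refine Eq.trans ?_ (integral_add hd hf')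
      congr 1; ext z
      simp only [evalPt_sub, divPoly_eq]; ring
    rw [this]
    rw [← Real.norm_eq_abs]
    refine norm_integral_le_of_norm_le (Integrable.norm hf) (ae_restrict_of_forall_mem measurableSet_refSquare
      fun z hz => ?_)
    rw [norm_mul]
    refine mul_le_of_le_one_right (norm_nonneg _) ?_
    rw [Real.norm_of_nonneg (mul_nonneg (pow_nonneg hz.1.1 _) (pow_nonneg hz.2.1 _))]
    exact mul_le_one₀ (pow_le_one₀ hz.1.1 hz.1.2) (pow_nonneg hz.2.1 _)
      (pow_le_one₀ hz.2.1 hz.2.2)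
  have hsm : AEStronglyMeasurable (fun z => w z - evalPt r z) (volume.restrict refSquare) :=
    hf.aestronglyMeasurable
  have hME : ENNReal.ofReal M ≤ normLp p (fun z => w z - evalPt r z) := by
    rw [hMdef, ofReal_integral_norm_eq_lintegral_enorm hf, ← eLpNorm_one_eq_lintegral_enorm]
    exact eLpNorm_le_eLpNorm_of_exponent_le hp hsm
  have h2 : normLp p (evalPt (divP v - r)) ≤ C.toNNReal * normLp p (fun z => w z - evalPt r z) := by
    have := eLpNorm_le_of_ae_bound (p := p) (μ := volume.restrict refSquare)
      (f := evalPt (divP v - r))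
      (ae_restrict_of_forall_mem measurableSet_refSquare hsup)
    refine this.trans ?_
    simp only [measure_univ, ENNReal.one_rpow, one_mul]
    rw [ENNReal.ofReal_mul hC]
    exact mul_le_mul_right hME _
  have hsplit : (fun z => w z - divPoly v z) =
      (fun z => w z - evalPt r z) - evalPt (divP v - r) := by
    ext z; simp only [Pi.sub_apply, evalPt_sub, divPoly_eq]; ring
  rw [hsplit]
  refine (eLpNorm_sub_le hsm (continuous_evalPt _).aestronglyMeasurable hp).trans ?_
  rw [ENNReal.coe_add, add_mul, ENNReal.coe_one, one_mul]
  exact add_le_add le_rfl h2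

/-! ### Test functions on the unit interval -/

lemma integral_unitMeasure (f : ℝ → ℝ) : ∫ x, f x ∂unitMeasure = ∫ x in (0 : ℝ)..1, f x := by
  rw [intervalIntegral.integral_of_le zero_le_one, ← integral_Icc_eq_integral_Ioc, unitMeasure]

lemma _root_.Continuous.integrable_unitMeasure {f : ℝ → ℝ} (hf : Continuous f) :
    Integrable f unitMeasure :=
  hf.continuousOn.integrableOn_compact isCompact_Icc

/-- Smooth functions with compact support in the open unit interval. -/
structure IsUnitTest (φ : ℝ → ℝ) : Prop where
  smooth : ContDiff ℝ ∞ φ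
  eq_zero : ∃ c > 0, ∀ x, x ∉ Set.Icc c (1 - c) → φ x = 0

namespace IsUnitTest

variable {φ ψ : ℝ → ℝ}

lemma continuous (h : IsUnitTest φ) : Continuous φ := h.smooth.continuous

lemma differentiable (h : IsUnitTest φ) : Differentiable ℝ φ := h.smooth.differentiable (by simp)

lemma integrable (h : IsUnitTest φ) : Integrable φ unitMeasure :=
  h.continuous.integrable_unitMeasure

lemma zero_left (h : IsUnitTest φ) {x : ℝ} (hx : x ≤ 0) : φ x = 0 := by
  obtain ⟨c, hc, h0⟩ := h.eq_zero
  exact h0 x fun hx' => by linarith [hx'.1]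

lemma zero_right (h : IsUnitTest φ) {x : ℝ} (hx : 1 ≤ x) : φ x = 0 := by
  obtain ⟨c, hc, h0⟩ := h.eq_zero
  exact h0 x fun hx' => by linarith [hx'.2]

lemma const_mul (c : ℝ) (h : IsUnitTest φ) : IsUnitTest fun x => c * φ x := by
  obtain ⟨d, hd, h0⟩ := h.eq_zero
  exact ⟨contDiff_const.mul h.smooth, d, hd, fun x hx => by rw [h0 x hx, mul_zero]⟩

lemma sub (h : IsUnitTest φ) (h' : IsUnitTest ψ) : IsUnitTest fun x => φ x - ψ x := by
  obtain ⟨d, hd, h0⟩ := h.eq_zero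
  obtain ⟨d', hd', h0'⟩ := h'.eq_zero
  refine ⟨h.smooth.sub h'.smooth, min d d', lt_min hd hd', fun x hx => ?_⟩
  rw [h0 x, h0' x, sub_zero]
  · exact fun h => hx ⟨(min_le_right _ _).trans h.1, h.2.trans (by linarith [min_le_right d d'])⟩
  · exact fun h => hx ⟨(min_le_left _ _).trans h.1, h.2.trans (by linarith [min_le_left d d'])⟩

lemma deriv (h : IsUnitTest φ) : IsUnitTest (deriv φ) := by
  obtain ⟨d, hd, h0⟩ := h.eq_zero
  refine ⟨(contDiff_infty_iff_deriv.1 h.smooth).2, d, hd, fun x hx => ?_⟩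
  have : φ =ᶠ[𝓝 x] fun _ => 0 := by
    filter_upwards [isClosed_Icc.isOpen_compl.mem_nhds hx] with y hy using h0 y hy
  rw [this.deriv_eq, deriv_const]

lemma iteratedDeriv (h : IsUnitTest φ) (n : ℕ) : IsUnitTest (iteratedDeriv n φ) := by
  induction n with
  | zero => simpa using h
  | succ n ih => rw [iteratedDeriv_succ]; exact ih.deriv

/-- The primitive of a test function of zero mean is a test function. -/
lemma primitive (h : IsUnitTest φ) (h0 : ∫ x, φ x ∂unitMeasure = 0) :
    IsUnitTest fun t => ∫ s in (0 : ℝ)..t, φ s := by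
  have hd : ∀ t, HasDerivAt (fun t => ∫ s in (0 : ℝ)..t, φ s) (φ t) t := fun t =>
    intervalIntegral.integral_hasDerivAt_right (h.continuous.intervalIntegrable _ _)
      h.continuous.aestronglyMeasurable.stronglyMeasurableAtFilter h.continuous.continuousAt
  obtain ⟨c, hc, hz⟩ := h.eq_zero
  refine ⟨?_, min c (1 / 2), by positivity, fun x hx => ?_⟩
  · rw [contDiff_infty_iff_deriv, funext fun t => (hd t).deriv]
    exact ⟨fun t => (hd t).differentiableAt, h.smooth⟩
  · by_cases hxc : x < c
    · refine Eq.trans ?_ (intervalIntegral.integral_zero (a := 0) (b := x) (E := ℝ) (μ := volume))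
      refine intervalIntegral.integral_congr fun y hy => hz y fun hy' => ?_
      rcases le_total 0 x with h1 | h1
      · rw [Set.uIcc_of_le h1] at hy; linarith [hy.2, hy'.1]
      · rw [Set.uIcc_of_ge h1] at hy; linarith [hy.2, hy'.1]
    · have hx1 : 1 - c < x := by
        by_contra! hle
        refine hx ⟨(min_le_left _ _).trans (not_lt.1 hxc), hle.trans ?_⟩
        linarith [min_le_left c (1 / 2)]
      rw [integral_unitMeasure] at h0
      rw [← intervalIntegral.integral_add_adjacent_intervals
        (h.continuous.intervalIntegrable 0 1) (h.continuous.intervalIntegrable 1 x), h0, zero_add]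
      refine Eq.trans ?_ (intervalIntegral.integral_zero (a := 1) (b := x) (E := ℝ) (μ := volume))
      refine intervalIntegral.integral_congr fun y hy => hz y fun hy' => ?_
      rcases le_total 1 x with h1 | h1
      · rw [Set.uIcc_of_le h1] at hy; linarith [hy.1, hy'.2]
      · rw [Set.uIcc_of_ge h1] at hy; linarith [hy.1, hy'.2]

end IsUnitTest

lemma isUnitTest_of_tsupport {φ : ℝ → ℝ} (h : ContDiff ℝ ∞ φ) (hc : HasCompactSupport φ)
    (hs : tsupport φ ⊆ Set.Ioo 0 1) : IsUnitTest φ := by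
  rcases (tsupport φ).eq_empty_or_nonempty with he | hne
  · refine ⟨h, 1, one_pos, fun x _ => ?_⟩
    exact image_eq_zero_of_notMem_tsupport (by simp [he])
  · obtain ⟨a, ha⟩ := hc.exists_isLeast hne
    obtain ⟨b, hb⟩ := hc.exists_isGreatest hne
    refine ⟨h, min a (1 - b), lt_min (hs ha.1).1 (sub_pos.2 (hs hb.1).2), fun x hx => ?_⟩
    refine image_eq_zero_of_notMem_tsupport fun hxs => hx ⟨?_, ?_⟩
    · exact (min_le_left _ _).trans (ha.2 hxs)
    · linarith [min_le_right a (1 - b), hb.2 hxs]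

/-- A fixed smooth weight with compact support in the unit interval. -/
def weight : ℝ → ℝ :=
  ContDiffBump.normed (⟨1 / 8, 1 / 4, by norm_num, by norm_num⟩ : ContDiffBump (1 / 2 : ℝ)) volume

lemma isUnitTest_weight : IsUnitTest weight := by
  refine isUnitTest_of_tsupport (ContDiffBump.contDiff_normed _)
    (ContDiffBump.hasCompactSupport_normed _) ?_
  rw [weight, ContDiffBump.tsupport_normed_eq, Real.closedBall_eq_Icc]
  exact fun x hx => ⟨by linarith [hx.1], by linarith [hx.2]⟩

lemma weight_nonneg (x : ℝ) : 0 ≤ weight x := ContDiffBump.nonneg_normed _ _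

lemma integral_weight : ∫ x, weight x ∂unitMeasure = 1 := by
  have h : ∫ x, weight x = 1 := ContDiffBump.integral_normed _
  rw [unitMeasure, setIntegral_eq_integral_of_forall_compl_eq_zero, h]
  intro x hx
  by_contra hne
  refine hx ⟨?_, ?_⟩
  · by_contra! hlt; exact hne (isUnitTest_weight.zero_left hlt.le)
  · by_contra! hlt; exact hne (isUnitTest_weight.zero_right hlt.le)

/-! ### The adjoint of integration with weighted zero mean -/

/-- Minus the primitive of the part of `φ` with zero mean. -/
def lower (φ : ℝ → ℝ) (t : ℝ) : ℝ :=
  ∫ s in (0 : ℝ)..t, ((∫ x, φ x ∂unitMeasure) * weight s - φ s)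

section lower

variable {φ : ℝ → ℝ}

lemma IsUnitTest.aux_lower (h : IsUnitTest φ) :
    IsUnitTest fun s => (∫ x, φ x ∂unitMeasure) * weight s - φ s :=
  (isUnitTest_weight.const_mul _).sub h

/-- Subtracting `φ` from its mean times the weight leaves a function of zero mean, whose primitive
has compact support again. This is what allows iteration. -/
lemma IsUnitTest.lower (h : IsUnitTest φ) : IsUnitTest (lower φ) := by
  refine h.aux_lower.primitive ?_
  rw [integral_sub (isUnitTest_weight.const_mul _).integrable h.integrable, integral_const_mul,
    integral_weight, mul_one, sub_self]

/-- Read backwards: `φ` equals its mean times the weight minus the derivative of a test function.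
The whole Taylor expansion is the iteration of this identity. -/
lemma IsUnitTest.hasDerivAt_lower (h : IsUnitTest φ) (t : ℝ) :
    HasDerivAt (ABF.lower φ) ((∫ x, φ x ∂unitMeasure) * weight t - φ t) t :=
  intervalIntegral.integral_hasDerivAt_right (h.aux_lower.continuous.intervalIntegrable _ _)
    h.aux_lower.continuous.aestronglyMeasurable.stronglyMeasurableAtFilter
    h.aux_lower.continuous.continuousAt

lemma IsUnitTest.iterate_lower (h : IsUnitTest φ) (n : ℕ) : IsUnitTest (ABF.lower^[n] φ) := by
  induction n with
  | zero => exact h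
  | succ n ih => rw [Function.iterate_succ_apply']; exact ih.lower

/-- Taylor type expansion of a test function. -/
lemma IsUnitTest.expansion (h : IsUnitTest φ) (n : ℕ) (x : ℝ) :
    φ x = (∑ i ∈ Finset.range n,
        (-1) ^ i * (∫ y, (ABF.lower^[i] φ) y ∂unitMeasure) * _root_.iteratedDeriv i weight x)
      + (-1) ^ n * _root_.iteratedDeriv n (ABF.lower^[n] φ) x := by
  induction n with
  | zero => simp
  | succ n ih =>
    have hn := h.iterate_lower n
    -- The derivative formula for `lower`, applied to its `n`-th iterate and differentiated `n`
    -- times.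
    have key : _root_.iteratedDeriv n (ABF.lower^[n] φ) x =
        (∫ y, (ABF.lower^[n] φ) y ∂unitMeasure) * _root_.iteratedDeriv n weight x
          - _root_.iteratedDeriv (n + 1) (ABF.lower^[n + 1] φ) x := by
      rw [iteratedDeriv_succ', Function.iterate_succ_apply',
        funext fun t => (hn.hasDerivAt_lower t).deriv, iteratedDeriv_fun_sub,
        iteratedDeriv_const_mul_field]
      · ring
      · exact (contDiff_const.mul isUnitTest_weight.smooth).contDiffAt.of_le
          (by exact_mod_cast le_top)
      · exact hn.smooth.contDiffAt.of_le (by exact_mod_cast le_top)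
    rw [Finset.sum_range_succ]
    conv_lhs => rw [ih, key]
    ring

end lower

/-! ### The kernels of the iterated operators -/

/-- The primitive of the weight. -/
def weightPrim (t : ℝ) : ℝ := ∫ s in (0 : ℝ)..t, weight s

lemma continuous_weightPrim : Continuous weightPrim :=
  intervalIntegral.continuous_primitive
    (fun _ _ => isUnitTest_weight.continuous.intervalIntegrable _ _) 0

lemma weightPrim_nonneg {t : ℝ} (h : 0 ≤ t) : 0 ≤ weightPrim t :=
  intervalIntegral.integral_nonneg h fun x _ => weight_nonneg x

lemma weightPrim_le_one {t : ℝ} (h : t ≤ 1) : weightPrim t ≤ 1 := by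
  have h1 := integral_weight
  rw [integral_unitMeasure, ← intervalIntegral.integral_add_adjacent_intervals
    (isUnitTest_weight.continuous.intervalIntegrable 0 t)
    (isUnitTest_weight.continuous.intervalIntegrable t 1)] at h1
  have h2 : 0 ≤ ∫ s in t..1, weight s :=
    intervalIntegral.integral_nonneg h fun x _ => weight_nonneg x
  unfold weightPrim
  linarith

/-- The kernel of the `n + 1`-st power of `lower`. -/
def kernel : ℕ → ℝ × ℝ → ℝ
  | 0 => Set.indicator {z : ℝ × ℝ | z.2 ∈ Set.Icc 0 1}
      fun z => weightPrim z.2 - Set.indicator {z : ℝ × ℝ | z.1 ≤ z.2} 1 z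
  | n + 1 => fun z => ∫ r, kernel 0 (r, z.2) * kernel n (z.1, r) ∂unitMeasure

lemma measurable_kernel_zero : Measurable (kernel 0) := by
  unfold kernel
  refine Measurable.indicator ?_ (measurable_snd measurableSet_Icc)
  refine (continuous_weightPrim.measurable.comp measurable_snd).sub ?_
  exact measurable_one.indicator (measurableSet_le measurable_fst measurable_snd)

lemma stronglyMeasurable_kernel (n : ℕ) : StronglyMeasurable (kernel n) := by
  induction n with
  | zero => exact measurable_kernel_zero.stronglyMeasurable
  | succ n ih =>
    have : StronglyMeasurable fun a : (ℝ × ℝ) × ℝ => kernel 0 (a.2, a.1.2) * kernel n (a.1.1, a.2) :=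
      (measurable_kernel_zero.stronglyMeasurable.comp_measurable (by fun_prop)).mul
        (ih.comp_measurable (by fun_prop))
    rw [kernel]
    exact this.integral_prod_right' (ν := unitMeasure)

lemma kernel_zero_apply (x : ℝ) {t : ℝ} (ht : t ∈ Set.Icc (0 : ℝ) 1) :
    kernel 0 (x, t) = weightPrim t - if x ≤ t then 1 else 0 := by
  rw [kernel, Set.indicator_of_mem (by exact ht)]
  simp [Set.indicator_apply]

lemma abs_kernel_zero_le (x t : ℝ) : |kernel 0 (x, t)| ≤ 1 := by
  by_cases ht : t ∈ Set.Icc (0 : ℝ) 1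
  · rw [kernel_zero_apply x ht, abs_le]
    have h1 := weightPrim_nonneg ht.1
    have h2 := weightPrim_le_one ht.2
    split_ifs <;> constructor <;> linarith
  · rw [kernel, Set.indicator_of_notMem (by exact ht)]; simp

lemma abs_kernel_le (n : ℕ) (z : ℝ × ℝ) : |kernel n z| ≤ 1 := by
  induction n generalizing z with
  | zero => exact abs_kernel_zero_le z.1 z.2
  | succ n ih =>
    have : ‖∫ r, kernel 0 (r, z.2) * kernel n (z.1, r) ∂unitMeasure‖ ≤
        1 * unitMeasure.real Set.univ := by
      refine norm_integral_le_of_norm_le_const (Eventually.of_forall fun r => ?_)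
      rw [norm_mul]
      exact mul_le_one₀ (abs_kernel_zero_le r z.2) (norm_nonneg _) (ih (z.1, r))
    simpa [kernel] using this

lemma lower_eq_integral_kernel {φ : ℝ → ℝ} (h : IsUnitTest φ) {t : ℝ} (ht : t ∈ Set.Icc (0 : ℝ) 1) :
    lower φ t = ∫ x, kernel 0 (x, t) * φ x ∂unitMeasure := by
  have h1 : lower φ t = (∫ x, φ x ∂unitMeasure) * weightPrim t - ∫ s in (0 : ℝ)..t, φ s := by
    rw [lower, intervalIntegral.integral_sub
      ((isUnitTest_weight.const_mul _).continuous.intervalIntegrable _ _)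
      (h.continuous.intervalIntegrable _ _), intervalIntegral.integral_const_mul, weightPrim]
  have h2 : ∫ s in (0 : ℝ)..t, φ s = ∫ x, Set.indicator (Set.Iic t) φ x ∂unitMeasure := by
    rw [integral_indicator measurableSet_Iic, unitMeasure, Measure.restrict_restrict measurableSet_Iic,
      intervalIntegral.integral_of_le ht.1, ← integral_Icc_eq_integral_Ioc]
    congr 2
    ext x
    simp only [Set.mem_Icc, Set.mem_inter_iff, Set.mem_Iic]
    exact ⟨fun hx => ⟨hx.2, hx.1, hx.2.trans ht.2⟩, fun hx => ⟨hx.2.1, hx.1⟩⟩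
  rw [h1, h2, ← integral_mul_const, ← integral_sub]
  · congr 1; ext x
    rw [kernel_zero_apply x ht, Set.indicator_apply]
    simp only [Set.mem_Iic]
    split_ifs <;> ring
  · exact h.integrable.mul_const _
  · exact h.integrable.indicator measurableSet_Iic

lemma iterate_lower_eq_integral_kernel {φ : ℝ → ℝ} (h : IsUnitTest φ) (n : ℕ) {t : ℝ}
    (ht : t ∈ Set.Icc (0 : ℝ) 1) :
    (lower^[n + 1] φ) t = ∫ x, kernel n (x, t) * φ x ∂unitMeasure := by
  induction n generalizing t with
  | zero => exact lower_eq_integral_kernel h ht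
  | succ n ih =>
    rw [Function.iterate_succ_apply', lower_eq_integral_kernel (h.iterate_lower _) ht]
    have h1 : ∫ r, kernel 0 (r, t) * (lower^[n + 1] φ) r ∂unitMeasure =
        ∫ r, ∫ x, kernel 0 (r, t) * (kernel n (x, r) * φ x) ∂unitMeasure ∂unitMeasure := by
      refine setIntegral_congr_fun measurableSet_Icc fun r hr => ?_
      simp only [ih hr]
      rw [integral_const_mul]
    rw [h1, integral_integral_swap]
    · congr 1; ext x
      simp only [kernel]
      rw [← integral_mul_const]
      congr 1; ext r; ring
    · have hφ : Integrable (fun z : ℝ × ℝ => φ z.2) (unitMeasure.prod unitMeasure) :=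
        h.integrable.comp_snd _
      have hm : StronglyMeasurable fun z : ℝ × ℝ => kernel 0 (z.1, t) * kernel n (z.2, z.1) :=
        ((stronglyMeasurable_kernel 0).comp_measurable (by fun_prop)).mul
          ((stronglyMeasurable_kernel n).comp_measurable (by fun_prop))
      refine (hφ.bdd_mul (c := 1) hm.aestronglyMeasurable (Eventually.of_forall fun z => ?_)).congr
        (Eventually.of_forall fun z => ?_)
      · rw [norm_mul]
        exact mul_le_one₀ (abs_kernel_le _ _) (norm_nonneg _) (abs_kernel_le _ _)
      · simp only [Function.uncurry]; ring

/-! ### Moments of the iterated operators -/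

lemma exists_derivative_eq (q : Polynomial ℝ) :
    ∃ P : Polynomial ℝ, P.derivative = q ∧ P.natDegree ≤ q.natDegree + 1 := by
  refine ⟨∑ i ∈ Finset.range (q.natDegree + 1),
    Polynomial.C (q.coeff i / (i + 1)) * Polynomial.X ^ (i + 1), ?_, ?_⟩
  · conv_rhs => rw [q.as_sum_range_C_mul_X_pow]
    rw [Polynomial.derivative_sum]
    refine Finset.sum_congr rfl fun i _ => ?_
    rw [Polynomial.derivative_C_mul_X_pow]
    have : (i : ℝ) + 1 ≠ 0 := by positivity
    simp [div_mul_cancel₀ _ this]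
  · refine Polynomial.natDegree_sum_le_of_forall_le _ _ fun i hi => ?_
    exact (Polynomial.natDegree_C_mul_X_pow_le _ _).trans
      (by have := Finset.mem_range.1 hi; omega)

/-- Integrate by parts against a primitive `P` of `q`; the boundary terms vanish because `lower φ`
does. The weight contributes the constant `∫ P weight`, and `P` minus this constant is the
polynomial sought. -/
lemma exists_moment_lower (q : Polynomial ℝ) : ∃ r : Polynomial ℝ, r.natDegree ≤ q.natDegree + 1 ∧
    ∀ φ, IsUnitTest φ →
      ∫ x, q.eval x * lower φ x ∂unitMeasure = ∫ x, r.eval x * φ x ∂unitMeasure := by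
  obtain ⟨P, rfl, hdeg⟩ := exists_derivative_eq q
  set c : ℝ := ∫ x, P.eval x * weight x ∂unitMeasure with hc
  refine ⟨P - Polynomial.C c, (Polynomial.natDegree_sub_C).le.trans hdeg, fun φ h => ?_⟩
  have hparts := intervalIntegral.integral_deriv_mul_eq_sub (a := 0) (b := 1)
    (fun x _ => (P.hasDerivAt x)) (fun x _ => h.hasDerivAt_lower x)
    (P.derivative.continuous.intervalIntegrable _ _)
    (h.aux_lower.continuous.intervalIntegrable _ _)
  rw [h.lower.zero_left le_rfl, h.lower.zero_right le_rfl, mul_zero, mul_zero, sub_zero,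
    ← integral_unitMeasure] at hparts
  set m : ℝ := ∫ x, φ x ∂unitMeasure with hm
  have i1 : Integrable (fun x => P.derivative.eval x * lower φ x) unitMeasure :=
    (P.derivative.continuous.mul h.lower.continuous).integrable_unitMeasure
  have i2 : Integrable (fun x => m * (P.eval x * weight x)) unitMeasure :=
    (continuous_const.mul (P.continuous.mul isUnitTest_weight.continuous)).integrable_unitMeasure
  have i3 : Integrable (fun x => P.eval x * φ x) unitMeasure :=
    (P.continuous.mul h.continuous).integrable_unitMeasure
  have i4 : Integrable (fun x => c * φ x) unitMeasure := h.integrable.const_mul c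
  have e1 : (fun x => P.derivative.eval x * lower φ x + P.eval x * (m * weight x - φ x)) =
      fun x => P.derivative.eval x * lower φ x + (m * (P.eval x * weight x) - P.eval x * φ x) := by
    ext x; ring
  have e3 := integral_add i1 (i2.sub i3)
  simp only [Pi.sub_apply] at e3
  rw [e1, e3, integral_sub i2 i3, integral_const_mul, ← hc] at hparts
  have e2 : (fun x => (P - Polynomial.C c).eval x * φ x) =
      fun x => P.eval x * φ x - c * φ x := by
    ext x; simp; ring
  rw [e2, integral_sub i3 i4, integral_const_mul, ← hm]
  linarith

/-- The source of the polynomials in the expansion: the scalar factors in `IsUnitTest.expansion` are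
pairings of `φ` with polynomials, so by duality the main part of the expansion of `w` is polynomial.
-/
lemma exists_moment_iterate_lower (n : ℕ) : ∃ r : Polynomial ℝ, r.natDegree ≤ n ∧
    ∀ φ, IsUnitTest φ →
      ∫ x, (lower^[n] φ) x ∂unitMeasure = ∫ x, r.eval x * φ x ∂unitMeasure := by
  induction n with
  | zero => exact ⟨1, by simp, fun φ _ => by simp⟩
  | succ n ih =>
    obtain ⟨q, hq, h⟩ := ih
    obtain ⟨r, hr, h'⟩ := exists_moment_lower q
    refine ⟨r, hr.trans (by omega), fun φ hφ => ?_⟩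
    rw [Function.iterate_succ_apply, h _ hφ.lower, h' _ hφ]

/-- The polynomial representing the mean of the `n`-th power of `lower`. -/
def meanPoly (n : ℕ) : Polynomial ℝ := (exists_moment_iterate_lower n).choose

lemma natDegree_meanPoly_le (n : ℕ) : (meanPoly n).natDegree ≤ n :=
  (exists_moment_iterate_lower n).choose_spec.1

lemma integral_iterate_lower (n : ℕ) {φ : ℝ → ℝ} (h : IsUnitTest φ) :
    ∫ x, (lower^[n] φ) x ∂unitMeasure = ∫ x, (meanPoly n).eval x * φ x ∂unitMeasure :=
  (exists_moment_iterate_lower n).choose_spec.2 φ h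

/-! ### Testing against products of functions of one variable -/

lemma ae_eq_zero_of_forall_isUnitTest {f : ℝ → ℝ} (hf : Integrable f unitMeasure)
    (h : ∀ φ, IsUnitTest φ → ∫ x, f x * φ x ∂unitMeasure = 0) : f =ᵐ[unitMeasure] 0 := by
  have hI : IntegrableOn f (Set.Ioo 0 1) := by
    rw [unitMeasure_eq_Ioo] at hf; exact hf
  have key := isOpen_Ioo.ae_eq_zero_of_integral_contDiff_smul_eq_zero (U := Set.Ioo (0 : ℝ) 1)
    (f := f) hI.locallyIntegrableOn fun g hg hgc hgs => by
      have hgt := isUnitTest_of_tsupport hg hgc hgs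
      rw [← h g hgt, unitMeasure_eq_Ioo,
        ← setIntegral_eq_integral_of_forall_compl_eq_zero (s := Set.Ioo (0 : ℝ) 1)]
      · simp only [smul_eq_mul, mul_comm]
      · intro x hx
        rw [image_eq_zero_of_notMem_tsupport fun hx' => hx (hgs hx'), zero_smul]
  rw [unitMeasure_eq_Ioo]
  exact (ae_restrict_iff' measurableSet_Ioo).2 key

/-- The pairing of a function on the square with a product of functions of one variable. -/
def tpair (f : ℝ × ℝ → ℝ) (φ ψ : ℝ → ℝ) : ℝ :=
  ∫ z, f z * (φ z.1 * ψ z.2) ∂unitMeasure.prod unitMeasure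

lemma _root_.MeasureTheory.Integrable.mul_continuous_unit {f h : ℝ × ℝ → ℝ}
    (hf : Integrable f (unitMeasure.prod unitMeasure)) (hh : Continuous h) :
    Integrable (fun z => f z * h z) (unitMeasure.prod unitMeasure) := by
  rw [← restrict_refSquare] at hf ⊢
  exact IntegrableOn.mul_continuous_refSquare hf hh

lemma integrable_mul_tensor {f : ℝ × ℝ → ℝ} (hf : Integrable f (unitMeasure.prod unitMeasure))
    {φ ψ : ℝ → ℝ} (hφ : Continuous φ) (hψ : Continuous ψ) :
    Integrable (fun z => f z * (φ z.1 * ψ z.2)) (unitMeasure.prod unitMeasure) :=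
  hf.mul_continuous_unit (by fun_prop)

/-- Product test functions suffice. Two applications of the one-dimensional fundamental lemma, one
per variable and linked by Fubini, show that `f` has zero integral over every measurable rectangle,
and rectangles are a π-system generating the σ-algebra. -/
lemma ae_eq_zero_of_forall_tpair {f : ℝ × ℝ → ℝ}
    (hf : Integrable f (unitMeasure.prod unitMeasure))
    (h : ∀ φ ψ, IsUnitTest φ → IsUnitTest ψ → tpair f φ ψ = 0) :
    f =ᵐ[unitMeasure.prod unitMeasure] 0 := by
  have h1 : ∀ ψ, IsUnitTest ψ → ∀ A, MeasurableSet A →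
      ∫ z in A ×ˢ Set.univ, f z * ψ z.2 ∂unitMeasure.prod unitMeasure = 0 := by
    intro ψ hψ A hA
    have hc : Continuous fun z : ℝ × ℝ => ψ z.2 := hψ.continuous.comp continuous_snd
    have hfψ := hf.mul_continuous_unit hc
    have hz : (fun x => ∫ y, f (x, y) * ψ y ∂unitMeasure) =ᵐ[unitMeasure] 0 := by
      refine ae_eq_zero_of_forall_isUnitTest hfψ.integral_prod_left fun φ hφ => ?_
      rw [← h φ ψ hφ hψ, tpair,
        integral_prod _ (integrable_mul_tensor hf hφ.continuous hψ.continuous)]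
      congr 1; ext x
      rw [← integral_mul_const]
      congr 1; ext y; ring
    rw [setIntegral_prod _ hfψ.integrableOn, Measure.restrict_univ,
      integral_congr_ae (ae_restrict_of_ae hz)]
    simp
  have h2 : ∀ A, MeasurableSet A → ∀ B, MeasurableSet B →
      ∫ z in A ×ˢ B, f z ∂unitMeasure.prod unitMeasure = 0 := by
    intro A hA B hB
    have hfA : Integrable f ((unitMeasure.restrict A).prod unitMeasure) := by
      have := hf.restrict (s := A ×ˢ Set.univ)
      rwa [← Measure.prod_restrict, Measure.restrict_univ] at this
    have hz : (fun y => ∫ x, f (x, y) ∂unitMeasure.restrict A) =ᵐ[unitMeasure] 0 := by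
      refine ae_eq_zero_of_forall_isUnitTest hfA.swap.integral_prod_left fun ψ hψ => ?_
      have hc : Continuous fun z : ℝ × ℝ => ψ z.2 := hψ.continuous.comp continuous_snd
      have hfψ := (hf.mul_continuous_unit hc).restrict (s := A ×ˢ Set.univ)
      rw [← Measure.prod_restrict, Measure.restrict_univ] at hfψ
      have := h1 ψ hψ A hA
      rw [← Measure.prod_restrict, Measure.restrict_univ, integral_prod_symm _ hfψ] at this
      rw [← this]
      congr 1; ext y
      rw [← integral_mul_const]
    have hfAB := hfA.restrict (s := Set.univ ×ˢ B)
    rw [← Measure.prod_restrict, Measure.restrict_univ] at hfAB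
    rw [← Measure.prod_restrict, integral_prod_symm _ hfAB,
      integral_congr_ae (ae_restrict_of_ae hz)]
    simp
  refine hf.ae_eq_zero_of_forall_setIntegral_eq_zero fun s hs _ => ?_
  refine MeasurableSpace.induction_on_inter
    (C := fun s _ => ∫ z in s, f z ∂unitMeasure.prod unitMeasure = 0)
    generateFrom_prod.symm isPiSystem_prod ?_ ?_ ?_ ?_ s hs
  · simp
  · rintro _ ⟨A, hA, B, hB, rfl⟩
    exact h2 A hA B hB
  · intro t ht hzero
    have := integral_add_compl ht hf
    have huniv := h2 Set.univ .univ Set.univ .univ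
    rw [Set.univ_prod_univ, Measure.restrict_univ] at huniv
    rw [hzero, huniv, zero_add] at this
    exact this
  · intro F hd hm hzero
    rw [integral_iUnion hm hd hf.integrableOn]
    simp [hzero]

/-! ### Weak derivatives and products of test functions -/

lemma IsUnitTest.isTestFunction {φ ψ : ℝ → ℝ} (hφ : IsUnitTest φ) (hψ : IsUnitTest ψ) :
    IsTestFunction fun z => φ z.1 * ψ z.2 := by
  obtain ⟨c, hc, h1⟩ := hφ.eq_zero
  obtain ⟨d, hd, h2⟩ := hψ.eq_zero
  let K : Set (ℝ × ℝ) := Set.Icc c (1 - c) ×ˢ Set.Icc d (1 - d)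
  have hK : IsCompact K := isCompact_Icc.prod isCompact_Icc
  have hsub : Function.support (fun z : ℝ × ℝ => φ z.1 * ψ z.2) ⊆ K := by
    intro z hz
    by_contra hzK
    refine hz ?_
    change φ z.1 * ψ z.2 = 0
    by_cases h : z.1 ∈ Set.Icc c (1 - c)
    · rw [h2 z.2 fun h' => hzK ⟨h, h'⟩, mul_zero]
    · rw [h1 z.1 h, zero_mul]
  refine ⟨(hφ.smooth.comp contDiff_fst).mul (hψ.smooth.comp contDiff_snd),
    HasCompactSupport.of_support_subset_isCompact hK hsub,
    (closure_minimal hsub hK.isClosed).trans ?_⟩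
  exact Set.prod_mono (fun x hx => ⟨hc.trans_le hx.1, hx.2.trans_lt (by linarith)⟩)
    (fun x hx => ⟨hd.trans_le hx.1, hx.2.trans_lt (by linarith)⟩)

lemma dx_iterate_tensor {φ ψ : ℝ → ℝ} (hφ : IsUnitTest φ) (hψ : IsUnitTest ψ) (n : ℕ) :
    dx^[n] (fun z => φ z.1 * ψ z.2) = fun z => iteratedDeriv n φ z.1 * ψ z.2 := by
  induction n with
  | zero => simp
  | succ n ih =>
    rw [Function.iterate_succ_apply', ih]
    ext z
    have := dx_tensor_mul (hφ.iteratedDeriv n).differentiable hψ.differentiable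
      (differentiable_const (1 : ℝ)) z
    simpa [dx, iteratedDeriv_succ] using this

lemma dy_iterate_tensor {φ ψ : ℝ → ℝ} (hφ : IsUnitTest φ) (hψ : IsUnitTest ψ) (n : ℕ) :
    dy^[n] (fun z => φ z.1 * ψ z.2) = fun z => φ z.1 * iteratedDeriv n ψ z.2 := by
  induction n with
  | zero => simp
  | succ n ih =>
    rw [Function.iterate_succ_apply', ih]
    ext z
    have := dy_tensor_mul hφ.differentiable (hψ.iteratedDeriv n).differentiable
      (differentiable_const (1 : ℝ)) z
    simpa [dy, iteratedDeriv_succ] using this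

lemma IsWeakPartial.tpair_eq {a b : ℕ} {w g : ℝ × ℝ → ℝ} (h : IsWeakPartial a b w g) {φ ψ : ℝ → ℝ}
    (hφ : IsUnitTest φ) (hψ : IsUnitTest ψ) :
    tpair w (iteratedDeriv a φ) (iteratedDeriv b ψ) = (-1) ^ (a + b) * tpair g φ ψ := by
  have := h.integral_eq _ (hφ.isTestFunction hψ)
  rw [dy_iterate_tensor hφ hψ, dx_iterate_tensor hφ (hψ.iteratedDeriv b), restrict_openSquare,
    restrict_refSquare] at this
  exact this

lemma integral_mul_expansion {α : Type*} [MeasurableSpace α] {μ : Measure α} {f F R : α → ℝ}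
    {n : ℕ} {c : ℕ → ℝ} {e : ℕ → α → ℝ} {d : ℝ}
    (hF : ∀ z, F z = (∑ i ∈ Finset.range n, c i * e i z) + d * R z)
    (he : ∀ i, Integrable (fun z => f z * e i z) μ) (hR : Integrable (fun z => f z * R z) μ) :
    ∫ z, f z * F z ∂μ =
      (∑ i ∈ Finset.range n, c i * ∫ z, f z * e i z ∂μ) + d * ∫ z, f z * R z ∂μ := by
  have h1 : ∀ z, f z * F z = (∑ i ∈ Finset.range n, c i * (f z * e i z)) + d * (f z * R z) := by
    intro z
    rw [hF, mul_add, Finset.mul_sum]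
    congr 1
    · exact Finset.sum_congr rfl fun i _ => by ring
    · ring
  simp only [h1]
  rw [integral_add (integrable_finsetSum _ fun i _ => (he i).const_mul _) (hR.const_mul _),
    integral_finsetSum _ fun i _ => (he i).const_mul _]
  simp only [integral_const_mul]

lemma tpair_expansion_fst {f : ℝ × ℝ → ℝ} (hf : Integrable f (unitMeasure.prod unitMeasure))
    {φ ψ : ℝ → ℝ} (hφ : IsUnitTest φ) (hψ : IsUnitTest ψ) (n : ℕ) :
    tpair f φ ψ = (∑ i ∈ Finset.range n, (-1) ^ i * (∫ x, (meanPoly i).eval x * φ x ∂unitMeasure) *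
        tpair f (iteratedDeriv i weight) ψ)
      + (-1) ^ n * tpair f (iteratedDeriv n (lower^[n] φ)) ψ := by
  refine integral_mul_expansion (fun z => ?_)
    (fun i => integrable_mul_tensor hf (isUnitTest_weight.iteratedDeriv i).continuous
      hψ.continuous)
    (integrable_mul_tensor hf ((hφ.iterate_lower n).iteratedDeriv n).continuous hψ.continuous)
  simp only [← integral_iterate_lower _ hφ]
  conv_lhs => rw [hφ.expansion n z.1, add_mul, Finset.sum_mul]
  simp only [mul_assoc]

lemma tpair_expansion_snd {f : ℝ × ℝ → ℝ} (hf : Integrable f (unitMeasure.prod unitMeasure))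
    {φ ψ : ℝ → ℝ} (hφ : IsUnitTest φ) (hψ : IsUnitTest ψ) (n : ℕ) :
    tpair f φ ψ = (∑ i ∈ Finset.range n, (-1) ^ i * (∫ x, (meanPoly i).eval x * ψ x ∂unitMeasure) *
        tpair f φ (iteratedDeriv i weight))
      + (-1) ^ n * tpair f φ (iteratedDeriv n (lower^[n] ψ)) := by
  refine integral_mul_expansion (fun z => ?_)
    (fun i => integrable_mul_tensor hf hφ.continuous
      (isUnitTest_weight.iteratedDeriv i).continuous)
    (integrable_mul_tensor hf hφ.continuous ((hψ.iterate_lower n).iteratedDeriv n).continuous)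
  simp only [← integral_iterate_lower _ hψ]
  conv_lhs => rw [hψ.expansion n z.2, mul_add, Finset.mul_sum]
  congr 1
  · exact Finset.sum_congr rfl fun i _ => by ring
  · ring

/-! ### The remainder operators -/

/-- The kernel operator acting on the first variable. -/
def sliceOp (n : ℕ) (g : ℝ × ℝ → ℝ) (z : ℝ × ℝ) : ℝ :=
  ∫ t, kernel n (z.1, t) * g (t, z.2) ∂unitMeasure

/-- The kernel operator acting on the second variable, averaged in the first one. -/
def crossOp (n i : ℕ) (h : ℝ × ℝ → ℝ) (y : ℝ) : ℝ :=
  ∫ z, kernel n (y, z.2) * (iteratedDeriv i weight z.1 * h z) ∂unitMeasure.prod unitMeasure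

/-- Forgetting the evaluation point `x` in a triple `((x, y), t)` preserves measure, so a function
integrable in `(t, y)` stays integrable in all three variables. -/
lemma measurePreserving_slice :
    MeasurePreserving (fun q : (ℝ × ℝ) × ℝ => (q.2, q.1.2))
      ((unitMeasure.prod unitMeasure).prod unitMeasure) (unitMeasure.prod unitMeasure) :=
  Measure.measurePreserving_swap.comp
    ((measurePreserving_snd (μ := unitMeasure) (ν := unitMeasure)).prod
      (MeasurePreserving.id unitMeasure))

lemma integrable_slice (n : ℕ) {g : ℝ × ℝ → ℝ} (hg : Integrable g (unitMeasure.prod unitMeasure)) :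
    Integrable (fun q : (ℝ × ℝ) × ℝ => kernel n (q.1.1, q.2) * g (q.2, q.1.2))
      ((unitMeasure.prod unitMeasure).prod unitMeasure) :=
  (measurePreserving_slice.integrable_comp_of_integrable hg).bdd_mul (c := 1)
    ((stronglyMeasurable_kernel n).comp_measurable (by fun_prop)).aestronglyMeasurable
    (Eventually.of_forall fun _ => abs_kernel_le _ _)

lemma integrable_sliceOp (n : ℕ) {g : ℝ × ℝ → ℝ}
    (hg : Integrable g (unitMeasure.prod unitMeasure)) :
    Integrable (sliceOp n g) (unitMeasure.prod unitMeasure) :=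
  (integrable_slice n hg).integral_prod_left

/-- `sliceOp n` is the transpose of the `n + 1`-st power of `lower` in the first variable: on almost
every slice Fubini moves the kernel from `g` to `φ`. -/
lemma tpair_sliceOp (n : ℕ) {g : ℝ × ℝ → ℝ} (hg : Integrable g (unitMeasure.prod unitMeasure))
    {φ ψ : ℝ → ℝ} (hφ : IsUnitTest φ) (hψ : IsUnitTest ψ) :
    tpair (sliceOp n g) φ ψ = tpair g (lower^[n + 1] φ) ψ := by
  rw [tpair, tpair, integral_prod_symm _
      (integrable_mul_tensor (integrable_sliceOp n hg) hφ.continuous hψ.continuous),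
    integral_prod_symm _
      (integrable_mul_tensor hg (hφ.iterate_lower _).continuous hψ.continuous)]
  refine integral_congr_ae ?_
  filter_upwards [hg.prod_left_ae] with y hy
  have h1 : ∫ x, sliceOp n g (x, y) * (φ x * ψ y) ∂unitMeasure =
      ∫ x, ∫ t, kernel n (x, t) * g (t, y) * (φ x * ψ y) ∂unitMeasure ∂unitMeasure := by
    simp only [sliceOp, integral_mul_const]
  have h2 : ∫ t, g (t, y) * ((lower^[n + 1] φ) t * ψ y) ∂unitMeasure =
      ∫ t, ∫ x, kernel n (x, t) * g (t, y) * (φ x * ψ y) ∂unitMeasure ∂unitMeasure := by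
    refine setIntegral_congr_fun measurableSet_Icc fun t ht => ?_
    simp only [iterate_lower_eq_integral_kernel hφ n ht]
    rw [← integral_mul_const, ← integral_const_mul]
    congr 1; ext x; ring
  rw [h1, h2, integral_integral_swap]
  have hprod : Integrable (fun q : ℝ × ℝ => (φ q.1 * ψ y) * g (q.2, y))
      (unitMeasure.prod unitMeasure) := (hφ.integrable.mul_const (ψ y)).mul_prod hy
  refine (hprod.bdd_mul (c := 1) (stronglyMeasurable_kernel n).aestronglyMeasurable
    (Eventually.of_forall fun _ => abs_kernel_le _ _)).congr (Eventually.of_forall fun q => ?_)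
  simp only [Function.uncurry]; ring

lemma integrable_weight_mul (i : ℕ) {h : ℝ × ℝ → ℝ}
    (hh : Integrable h (unitMeasure.prod unitMeasure)) :
    Integrable (fun z => iteratedDeriv i weight z.1 * h z) (unitMeasure.prod unitMeasure) := by
  have hc := (isUnitTest_weight.iteratedDeriv i).continuous
  simpa only [mul_comm] using hh.mul_continuous_unit
    (h := fun z => iteratedDeriv i weight z.1) (hc.comp continuous_fst)

lemma integrable_cross (n i : ℕ) {h : ℝ × ℝ → ℝ}
    (hh : Integrable h (unitMeasure.prod unitMeasure)) :
    Integrable (fun q : ℝ × (ℝ × ℝ) =>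
      kernel n (q.1, q.2.2) * (iteratedDeriv i weight q.2.1 * h q.2))
      (unitMeasure.prod (unitMeasure.prod unitMeasure)) :=
  ((integrable_weight_mul i hh).comp_snd unitMeasure).bdd_mul (c := 1)
    ((stronglyMeasurable_kernel n).comp_measurable (by fun_prop)).aestronglyMeasurable
    (Eventually.of_forall fun _ => abs_kernel_le _ _)

lemma integrable_crossOp (n i : ℕ) {h : ℝ × ℝ → ℝ}
    (hh : Integrable h (unitMeasure.prod unitMeasure)) : Integrable (crossOp n i h) unitMeasure :=
  (integrable_cross n i hh).integral_prod_left

/-- The same duality in the second variable, with the first one tested against a fixed derivative of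
the weight. The result depends on `y` only. -/
lemma integral_crossOp_mul (n i : ℕ) {h : ℝ × ℝ → ℝ}
    (hh : Integrable h (unitMeasure.prod unitMeasure)) {ψ : ℝ → ℝ} (hψ : IsUnitTest ψ) :
    ∫ y, crossOp n i h y * ψ y ∂unitMeasure =
      tpair h (iteratedDeriv i weight) (lower^[n + 1] ψ) := by
  have h1 : ∫ y, crossOp n i h y * ψ y ∂unitMeasure =
      ∫ y, ∫ z, kernel n (y, z.2) * (iteratedDeriv i weight z.1 * h z) * ψ y
        ∂unitMeasure.prod unitMeasure ∂unitMeasure := by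
    simp only [crossOp, integral_mul_const]
  have h2 : tpair h (iteratedDeriv i weight) (lower^[n + 1] ψ) =
      ∫ z, ∫ y, kernel n (y, z.2) * (iteratedDeriv i weight z.1 * h z) * ψ y
        ∂unitMeasure ∂unitMeasure.prod unitMeasure := by
    rw [tpair, ← restrict_refSquare]
    refine setIntegral_congr_fun measurableSet_refSquare fun z hz => ?_
    simp only [iterate_lower_eq_integral_kernel hψ n hz.2]
    rw [← integral_const_mul, ← integral_const_mul]
    congr 1; ext x; ring
  rw [h1, h2, integral_integral_swap]
  have hprod : Integrable (fun q : ℝ × (ℝ × ℝ) => ψ q.1 * (iteratedDeriv i weight q.2.1 * h q.2))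
      (unitMeasure.prod (unitMeasure.prod unitMeasure)) :=
    hψ.integrable.mul_prod (integrable_weight_mul i hh)
  have hm : StronglyMeasurable fun q : ℝ × (ℝ × ℝ) => kernel n (q.1, q.2.2) :=
    (stronglyMeasurable_kernel n).comp_measurable (by fun_prop)
  refine (hprod.bdd_mul (c := 1) hm.aestronglyMeasurable
    (Eventually.of_forall fun _ => abs_kernel_le _ _)).congr (Eventually.of_forall fun q => ?_)
  simp only [Function.uncurry]; ring

lemma tpair_prod (a b φ ψ : ℝ → ℝ) :
    tpair (fun z => a z.1 * b z.2) φ ψ =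
      (∫ x, a x * φ x ∂unitMeasure) * ∫ y, b y * ψ y ∂unitMeasure := by
  rw [tpair, ← integral_prod_mul]
  congr 1; ext z; ring

/-! ### The representation formula -/

section linearity

variable {f g : ℝ × ℝ → ℝ} {φ ψ : ℝ → ℝ}

lemma tpair_add (hf : Integrable f (unitMeasure.prod unitMeasure))
    (hg : Integrable g (unitMeasure.prod unitMeasure)) (hφ : IsUnitTest φ) (hψ : IsUnitTest ψ) :
    tpair (fun z => f z + g z) φ ψ = tpair f φ ψ + tpair g φ ψ := by
  simp only [tpair, add_mul]
  exact integral_add (integrable_mul_tensor hf hφ.continuous hψ.continuous)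
    (integrable_mul_tensor hg hφ.continuous hψ.continuous)

lemma tpair_sub (hf : Integrable f (unitMeasure.prod unitMeasure))
    (hg : Integrable g (unitMeasure.prod unitMeasure)) (hφ : IsUnitTest φ) (hψ : IsUnitTest ψ) :
    tpair (fun z => f z - g z) φ ψ = tpair f φ ψ - tpair g φ ψ := by
  simp only [tpair, sub_mul]
  exact integral_sub (integrable_mul_tensor hf hφ.continuous hψ.continuous)
    (integrable_mul_tensor hg hφ.continuous hψ.continuous)

lemma tpair_sum {ι : Type*} (s : Finset ι) {c : ι → ℝ} {f : ι → ℝ × ℝ → ℝ}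
    (hf : ∀ i, Integrable (f i) (unitMeasure.prod unitMeasure))
    (hφ : IsUnitTest φ) (hψ : IsUnitTest ψ) :
    tpair (fun z => ∑ i ∈ s, c i * f i z) φ ψ = ∑ i ∈ s, c i * tpair (f i) φ ψ := by
  simp only [tpair, Finset.sum_mul, mul_assoc]
  rw [integral_finsetSum]
  · simp only [integral_const_mul]
  · exact fun i _ => (integrable_mul_tensor (hf i) hφ.continuous hψ.continuous).const_mul _

end linearity

/-- The coefficients of the averaged expansion of `w`. -/
def expCoeff (w : ℝ × ℝ → ℝ) (i : ℕ × ℕ) : ℝ :=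
  (-1) ^ (i.1 + i.2) * tpair w (iteratedDeriv i.1 weight) (iteratedDeriv i.2 weight)

/-- The basis functions of the averaged expansion. -/
def expBasis (i : ℕ × ℕ) (z : ℝ × ℝ) : ℝ := (meanPoly i.1).eval z.1 * (meanPoly i.2).eval z.2

lemma continuous_expBasis (i : ℕ × ℕ) : Continuous (expBasis i) := by
  unfold expBasis; fun_prop

lemma _root_.Continuous.integrable_unit_prod {f : ℝ × ℝ → ℝ} (hf : Continuous f) :
    Integrable f (unitMeasure.prod unitMeasure) := by
  rw [← restrict_refSquare]; exact hf.integrableOn_refSquare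

/-- Both sides are integrable, so it is enough to pair them with products `φ ⊗ ψ`. Expanding `φ` and
then `ψ` on the left produces exactly the pairings of the three groups of terms on the right. -/
lemma ae_eq_expansion (n : ℕ) {w g h : ℝ × ℝ → ℝ}
    (hw : Integrable w (unitMeasure.prod unitMeasure))
    (hg : Integrable g (unitMeasure.prod unitMeasure))
    (hh : Integrable h (unitMeasure.prod unitMeasure))
    (hwg : IsWeakPartial (n + 1) 0 w g) (hwh : IsWeakPartial 0 (n + 1) w h) :
    w =ᵐ[unitMeasure.prod unitMeasure] fun z =>
      (∑ i ∈ Finset.range (n + 1) ×ˢ Finset.range (n + 1), expCoeff w i * expBasis i z)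
      + ((∑ i ∈ Finset.range (n + 1), (-1) ^ i * ((meanPoly i).eval z.1 * crossOp n i h z.2))
        + sliceOp n g z) := by
  have iA : Integrable (fun z => ∑ i ∈ Finset.range (n + 1) ×ˢ Finset.range (n + 1),
      expCoeff w i * expBasis i z) (unitMeasure.prod unitMeasure) :=
    integrable_finsetSum _ fun i _ => (continuous_expBasis i).integrable_unit_prod.const_mul _
  have iB' : ∀ i, Integrable (fun z : ℝ × ℝ => (meanPoly i).eval z.1 * crossOp n i h z.2)
      (unitMeasure.prod unitMeasure) := fun i =>
    (Polynomial.continuous _).integrable_unitMeasure.mul_prod (integrable_crossOp n i hh)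
  have iB : Integrable (fun z : ℝ × ℝ => ∑ i ∈ Finset.range (n + 1),
      (-1) ^ i * ((meanPoly i).eval z.1 * crossOp n i h z.2)) (unitMeasure.prod unitMeasure) :=
    integrable_finsetSum _ fun i _ => (iB' i).const_mul _
  have iC := integrable_sliceOp n hg
  have iBC := iB.add iC
  have iABC := iA.add iBC
  have hz := ae_eq_zero_of_forall_tpair (hw.sub iABC) fun φ ψ hφ hψ => by
    have e1 := tpair_sub hw iABC hφ hψ
    have e2 := tpair_add iA iBC hφ hψ
    have e3 := tpair_add iB iC hφ hψ
    have e4 : tpair (fun z => ∑ i ∈ Finset.range (n + 1) ×ˢ Finset.range (n + 1),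
        expCoeff w i * expBasis i z) φ ψ = _ :=
      tpair_sum _ (fun i => (continuous_expBasis i).integrable_unit_prod) hφ hψ
    have e5 := tpair_sum (Finset.range (n + 1)) (c := fun i => (-1) ^ i) iB' hφ hψ
    have e6 := tpair_sliceOp n hg hφ hψ
    -- Expansion in `x`. The sign of the remainder of the expansion cancels the sign in the
    -- definition of the weak derivative.
    have s1 : tpair w φ ψ = (∑ i ∈ Finset.range (n + 1),
        (-1) ^ i * (∫ x, (meanPoly i).eval x * φ x ∂unitMeasure) *
          tpair w (iteratedDeriv i weight) ψ) + tpair g (lower^[n + 1] φ) ψ := by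
      rw [tpair_expansion_fst hw hφ hψ (n + 1)]
      congr 1
      have := hwg.tpair_eq (hφ.iterate_lower (n + 1)) hψ
      rw [iteratedDeriv_zero] at this
      rw [this, add_zero, ← mul_assoc, ← mul_pow]; simp
    -- The expansion in `y` is applied only to the coefficients of the first one and not to its
    -- remainder. Hence no mixed derivative of `w` appears.
    have s2 : ∀ i, tpair w (iteratedDeriv i weight) ψ = (∑ j ∈ Finset.range (n + 1),
        (-1) ^ j * (∫ x, (meanPoly j).eval x * ψ x ∂unitMeasure) *
          tpair w (iteratedDeriv i weight) (iteratedDeriv j weight))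
          + ∫ y, crossOp n i h y * ψ y ∂unitMeasure := by
      intro i
      have hi := isUnitTest_weight.iteratedDeriv i
      rw [tpair_expansion_snd hw hi hψ (n + 1), integral_crossOp_mul n i hh hψ]
      congr 1
      have := hwh.tpair_eq hi (hψ.iterate_lower (n + 1))
      rw [iteratedDeriv_zero] at this
      rw [this, zero_add, ← mul_assoc, ← mul_pow]; simp
    have s3 : ∑ i ∈ Finset.range (n + 1) ×ˢ Finset.range (n + 1),
        expCoeff w i * tpair (expBasis i) φ ψ =
        ∑ i ∈ Finset.range (n + 1), (-1) ^ i * (∫ x, (meanPoly i).eval x * φ x ∂unitMeasure) *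
          ∑ j ∈ Finset.range (n + 1), (-1) ^ j * (∫ x, (meanPoly j).eval x * ψ x ∂unitMeasure) *
          tpair w (iteratedDeriv i weight) (iteratedDeriv j weight) := by
      rw [Finset.sum_product]
      refine Finset.sum_congr rfl fun i _ => ?_
      rw [Finset.mul_sum]
      refine Finset.sum_congr rfl fun j _ => ?_
      have : tpair (expBasis (i, j)) φ ψ = _ :=
        tpair_prod (fun x => (meanPoly i).eval x) (fun x => (meanPoly j).eval x) φ ψ
      rw [this, expCoeff, pow_add]; ring
    have s4 : ∑ i ∈ Finset.range (n + 1), (-1 : ℝ) ^ i *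
        tpair (fun z => (meanPoly i).eval z.1 * crossOp n i h z.2) φ ψ =
        ∑ i ∈ Finset.range (n + 1), (-1) ^ i * (∫ x, (meanPoly i).eval x * φ x ∂unitMeasure) *
          ∫ y, crossOp n i h y * ψ y ∂unitMeasure := by
      refine Finset.sum_congr rfl fun i _ => ?_
      rw [tpair_prod (fun x => (meanPoly i).eval x) (crossOp n i h) φ ψ]; ring
    have s5 : tpair w φ ψ = (∑ i ∈ Finset.range (n + 1) ×ˢ Finset.range (n + 1),
        expCoeff w i * tpair (expBasis i) φ ψ) +
        ((∑ i ∈ Finset.range (n + 1), (-1 : ℝ) ^ i *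
          tpair (fun z => (meanPoly i).eval z.1 * crossOp n i h z.2) φ ψ) +
          tpair (sliceOp n g) φ ψ) := by
      rw [s3, s4, e6, ← add_assoc, ← Finset.sum_add_distrib, s1]
      congr 1
      refine Finset.sum_congr rfl fun i _ => ?_
      rw [s2 i]; ring
    refine e1.trans ?_
    rw [sub_eq_zero, s5]
    refine Eq.symm (e2.trans ?_)
    rw [e4]
    congr 1
    refine e3.trans ?_
    rw [e5]
  filter_upwards [hz] with z hz
  exact sub_eq_zero.1 hz

/-! ### Bounds for the remainder -/

/-- On each slice the kernel bound dominates the operator by the `L¹` norm in `t`, hence by the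
`L^p` norm on a probability space. The bound is independent of `x`, so integrating over `x` costs
nothing. -/
lemma eLpNorm_sliceOp_le (n : ℕ) {p : ℝ≥0∞} (hp : 1 ≤ p) (hp' : p ≠ ⊤) {g : ℝ × ℝ → ℝ}
    (hg : Integrable g (unitMeasure.prod unitMeasure)) :
    eLpNorm (sliceOp n g) p (unitMeasure.prod unitMeasure) ≤
      eLpNorm g p (unitMeasure.prod unitMeasure) := by
  have hp0 : p ≠ 0 := (zero_lt_one.trans_le hp).ne'
  rw [eLpNorm_eq_lintegral_rpow_enorm_toReal hp0 hp',
    eLpNorm_eq_lintegral_rpow_enorm_toReal hp0 hp']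
  refine ENNReal.rpow_le_rpow ?_ (by positivity)
  have hpos : 0 < p.toReal := ENNReal.toReal_pos hp0 hp'
  rw [lintegral_prod_symm _ ((integrable_sliceOp n hg).aestronglyMeasurable.enorm.pow_const _),
    lintegral_prod_symm _ (hg.aestronglyMeasurable.enorm.pow_const _)]
  refine lintegral_mono_ae ?_
  filter_upwards [hg.prod_left_ae] with y hy
  have hbound : ∀ x, ‖sliceOp n g (x, y)‖ₑ ^ p.toReal ≤
      ∫⁻ t, ‖g (t, y)‖ₑ ^ p.toReal ∂unitMeasure := by
    intro x
    have h1 : ‖sliceOp n g (x, y)‖ₑ ≤ ∫⁻ t, ‖g (t, y)‖ₑ ∂unitMeasure := by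
      refine (enorm_integral_le_lintegral_enorm _).trans (lintegral_mono fun t => ?_)
      rw [enorm_mul]
      refine mul_le_of_le_one_left' ?_
      rw [← ofReal_norm, Real.norm_eq_abs]
      exact ENNReal.ofReal_le_one.2 (abs_kernel_le n _)
    have h2 : ∫⁻ t, ‖g (t, y)‖ₑ ∂unitMeasure ≤
        (∫⁻ t, ‖g (t, y)‖ₑ ^ p.toReal ∂unitMeasure) ^ (1 / p.toReal) := by
      rw [← eLpNorm_eq_lintegral_rpow_enorm_toReal hp0 hp',
        ← eLpNorm_one_eq_lintegral_enorm]
      exact eLpNorm_le_eLpNorm_of_exponent_le hp hy.aestronglyMeasurable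
    refine (ENNReal.rpow_le_rpow (h1.trans h2) hpos.le).trans ?_
    rw [← ENNReal.rpow_mul, one_div, inv_mul_cancel₀ hpos.ne', ENNReal.rpow_one]
  refine (lintegral_mono hbound).trans ?_
  simp

lemma exists_enorm_le_of_continuous {f : ℕ → ℝ → ℝ} (hf : ∀ i, Continuous (f i)) (N : ℕ) :
    ∃ B : ℝ≥0, ∀ i ∈ Finset.range N, ∀ x ∈ Set.Icc (0 : ℝ) 1, ‖f i x‖ₑ ≤ B := by
  choose b hb using fun i =>
    (isCompact_Icc (a := (0 : ℝ)) (b := 1)).exists_bound_of_continuousOn (hf i).continuousOn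
  refine ⟨∑ i ∈ Finset.range N, (b i).toNNReal, fun i hi x hx => ?_⟩
  rw [← ofReal_norm, ENNReal.ofReal]
  exact ENNReal.coe_le_coe.2 ((Real.toNNReal_le_toNNReal (hb i x hx)).trans
    (Finset.single_le_sum (f := fun i => (b i).toNNReal) (fun _ _ => zero_le) hi))

lemma enorm_integral_mul_le {f b : ℝ × ℝ → ℝ} {B : ℝ≥0}
    (hb : ∀ z ∈ refSquare, ‖b z‖ₑ ≤ B) :
    ‖∫ z, b z * f z ∂unitMeasure.prod unitMeasure‖ₑ ≤
      B * eLpNorm f 1 (unitMeasure.prod unitMeasure) := by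
  refine (enorm_integral_le_lintegral_enorm _).trans ?_
  rw [eLpNorm_one_eq_lintegral_enorm, ← lintegral_const_mul' _ _ ENNReal.coe_ne_top,
    ← restrict_refSquare]
  refine lintegral_mono_ae (ae_restrict_of_forall_mem measurableSet_refSquare fun z hz => ?_)
  rw [enorm_mul]
  exact mul_le_mul_left (hb z hz) _

lemma enorm_crossOp_le {n i : ℕ} {B : ℝ≥0}
    (hB : ∀ x ∈ Set.Icc (0 : ℝ) 1, ‖iteratedDeriv i weight x‖ₑ ≤ B) (h : ℝ × ℝ → ℝ) (y : ℝ) :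
    ‖crossOp n i h y‖ₑ ≤ B * eLpNorm h 1 (unitMeasure.prod unitMeasure) := by
  simp only [crossOp, ← mul_assoc]
  refine enorm_integral_mul_le fun z hz => ?_
  rw [enorm_mul]
  have h1 : ‖kernel n (y, z.2)‖ₑ ≤ 1 := by
    rw [← ofReal_norm, Real.norm_eq_abs]
    exact ENNReal.ofReal_le_one.2 (abs_kernel_le n _)
  exact (mul_le_of_le_one_left' h1).trans (hB _ hz.1)

lemma normLp_eq (p : ℝ≥0∞) (f : ℝ × ℝ → ℝ) :
    normLp p f = eLpNorm f p (unitMeasure.prod unitMeasure) := by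
  rw [normLp, restrict_refSquare]

lemma normLp_le_of_enorm_le {p : ℝ≥0∞} {f : ℝ × ℝ → ℝ} {M : ℝ≥0∞}
    (h : ∀ z ∈ refSquare, ‖f z‖ₑ ≤ M) : normLp p f ≤ M := by
  refine (eLpNorm_le_of_ae_enorm_bound
    (ae_restrict_of_forall_mem measurableSet_refSquare h)).trans ?_
  simp

lemma weakPartial_spec {a b : ℕ} {w : ℝ × ℝ → ℝ} (h : ∃ g, IsWeakPartial a b w g) :
    IsWeakPartial a b w (weakPartial a b w) := by
  rw [weakPartial, dif_pos h]
  exact h.choose_spec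

lemma MemSobolev.isWeakPartial {ℓ : ℕ} {p : ℝ≥0∞} {w : ℝ × ℝ → ℝ} (h : MemSobolev ℓ p w) {a b : ℕ}
    (hab : a + b ≤ ℓ) : IsWeakPartial a b w (weakPartial a b w) :=
  weakPartial_spec ((h.exists_weakPartial a b hab).imp fun _ hg => hg.1)

lemma IsWeakPartial.aestronglyMeasurable {a b : ℕ} {w g : ℝ × ℝ → ℝ} (h : IsWeakPartial a b w g) :
    AEStronglyMeasurable g (unitMeasure.prod unitMeasure) := by
  rw [← restrict_refSquare, ← restrict_openSquare]
  exact h.locallyIntegrable_deriv.aestronglyMeasurable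

lemma eLpNorm_one_le_normLp {p : ℝ≥0∞} (hp : 1 ≤ p) {g : ℝ × ℝ → ℝ}
    (hg : AEStronglyMeasurable g (unitMeasure.prod unitMeasure)) :
    eLpNorm g 1 (unitMeasure.prod unitMeasure) ≤ normLp p g := by
  rw [normLp_eq]; exact eLpNorm_le_eLpNorm_of_exponent_le hp hg

lemma MemSobolev.integrable {ℓ : ℕ} {p : ℝ≥0∞} {w : ℝ × ℝ → ℝ} (h : MemSobolev ℓ p w) (hp : 1 ≤ p) :
    Integrable w (unitMeasure.prod unitMeasure) := by
  rw [← restrict_refSquare]; exact h.memLp.integrable hp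

/-- Approximation of `w` by its averaged expansion in terms of its pure derivatives. -/
lemma exists_normLp_sub_expansion_le (n : ℕ) {p : ℝ≥0∞} (hp : 1 ≤ p) (hp' : p ≠ ⊤) :
    ∃ C : ℝ≥0, 1 ≤ C ∧ ∀ w, MemSobolev (n + 1) p w →
      normLp p (fun z => w z - ∑ i ∈ Finset.range (n + 1) ×ˢ Finset.range (n + 1),
        expCoeff w i * expBasis i z) ≤
      C * (normLp p (weakPartial (n + 1) 0 w) + normLp p (weakPartial 0 (n + 1) w)) := by
  obtain ⟨B, hB⟩ := exists_enorm_le_of_continuous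
    (fun i => (isUnitTest_weight.iteratedDeriv i).continuous) (n + 1)
  obtain ⟨D, hD⟩ := exists_enorm_le_of_continuous
    (fun i => (meanPoly i).continuous) (n + 1)
  -- The `1` is for `sliceOp`. Each of the `n + 1` cross terms costs `D` for its polynomial and `B`
  -- for the derivative of the weight.
  refine ⟨1 + (n + 1) * (D * B), by simp, fun w hw => ?_⟩
  set g := weakPartial (n + 1) 0 w
  set h := weakPartial 0 (n + 1) w
  have hwg : IsWeakPartial (n + 1) 0 w g := hw.isWeakPartial (by omega)
  have hwh : IsWeakPartial 0 (n + 1) w h := hw.isWeakPartial (by omega)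
  have hC1 : (1 : ℝ≥0∞) ≤ ((1 + (n + 1) * (D * B) : ℝ≥0) : ℝ≥0∞) := by
    exact_mod_cast (by simp : (1 : ℝ≥0) ≤ 1 + (n + 1) * (D * B))
  -- `weakPartial` is an arbitrarily chosen representative. If its norm is infinite the estimate is
  -- trivial, as the constant is nonzero; otherwise finiteness yields the integrability needed,
  -- without appeal to almost everywhere uniqueness.
  by_cases htop : normLp p g + normLp p h = ⊤
  · rw [htop, ENNReal.mul_top (zero_lt_one.trans_le hC1).ne']; exact le_top
  have hgt : normLp p g < ⊤ := lt_of_le_of_lt le_self_add (lt_top_iff_ne_top.2 htop)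
  have hht : normLp p h < ⊤ := lt_of_le_of_lt le_add_self (lt_top_iff_ne_top.2 htop)
  have hgi : Integrable g (unitMeasure.prod unitMeasure) :=
    memLp_one_iff_integrable.1 ⟨hwg.aestronglyMeasurable,
      (eLpNorm_one_le_normLp hp hwg.aestronglyMeasurable).trans_lt hgt⟩
  have hhi : Integrable h (unitMeasure.prod unitMeasure) :=
    memLp_one_iff_integrable.1 ⟨hwh.aestronglyMeasurable,
      (eLpNorm_one_le_normLp hp hwh.aestronglyMeasurable).trans_lt hht⟩
  have hrep := ae_eq_expansion n (hw.integrable hp) hgi hhi hwg hwh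
  set R : ℝ × ℝ → ℝ := fun z => ∑ i ∈ Finset.range (n + 1),
    (-1) ^ i * ((meanPoly i).eval z.1 * crossOp n i h z.2) with hR
  have hae : (fun z => w z - ∑ i ∈ Finset.range (n + 1) ×ˢ Finset.range (n + 1),
      expCoeff w i * expBasis i z) =ᵐ[unitMeasure.prod unitMeasure] R + sliceOp n g := by
    filter_upwards [hrep] with z hz
    rw [hz, add_sub_cancel_left]; rfl
  have hRi : Integrable R (unitMeasure.prod unitMeasure) :=
    integrable_finsetSum _ fun i _ => ((Polynomial.continuous _).integrable_unitMeasure.mul_prod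
      (integrable_crossOp n i hhi)).const_mul _
  have hRb : normLp p R ≤ ((n + 1) * (D * B) : ℝ≥0) * normLp p h := by
    refine normLp_le_of_enorm_le fun z hz => ?_
    refine (enorm_sum_le _ _).trans ?_
    have hterm : ∀ i ∈ Finset.range (n + 1),
        ‖(-1 : ℝ) ^ i * ((meanPoly i).eval z.1 * crossOp n i h z.2)‖ₑ ≤
          D * (B * normLp p h) := fun i hi => by
      rw [enorm_mul, enorm_mul, enorm_pow, enorm_neg, enorm_one, one_pow, one_mul]
      exact mul_le_mul' (hD i hi _ hz.1) ((enorm_crossOp_le (hB i hi) h _).trans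
        (mul_le_mul_right (eLpNorm_one_le_normLp hp hwh.aestronglyMeasurable) _))
    refine (Finset.sum_le_card_nsmul _ _ _ hterm).trans (le_of_eq ?_)
    rw [Finset.card_range, nsmul_eq_mul]
    push_cast; ring
  rw [normLp_eq, eLpNorm_congr_ae hae]
  refine (eLpNorm_add_le hRi.aestronglyMeasurable
    (integrable_sliceOp n hgi).aestronglyMeasurable hp).trans ?_
  rw [← normLp_eq]
  calc normLp p R + eLpNorm (sliceOp n g) p (unitMeasure.prod unitMeasure)
      ≤ ((n + 1) * (D * B) : ℝ≥0) * normLp p h + normLp p g :=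
        add_le_add hRb ((eLpNorm_sliceOp_le n hp hp' hgi).trans (normLp_eq p g).ge)
    _ ≤ ((n + 1) * (D * B) : ℝ≥0) * (normLp p g + normLp p h) + (normLp p g + normLp p h) :=
        add_le_add (mul_le_mul_right le_add_self _) le_self_add
    _ = _ := by rw [ENNReal.coe_add, ENNReal.coe_one]; ring

/-! ### The approximating polynomials -/

/-- The part of the averaged expansion of `w` with indices in `s`. -/
def expPoly (s : Finset (ℕ × ℕ)) (w : ℝ × ℝ → ℝ) : MvPolynomial (Fin 2) ℝ :=
  ∑ i ∈ s, expCoeff w i •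
    (Polynomial.aeval (MvPolynomial.X 0) (meanPoly i.1) *
      Polynomial.aeval (MvPolynomial.X 1) (meanPoly i.2))

lemma evalPt_aeval (q : MvPolynomial (Fin 2) ℝ) (P : Polynomial ℝ) (z : ℝ × ℝ) :
    evalPt (Polynomial.aeval q P) z = P.eval (evalPt q z) := by
  simp only [evalPt]
  rw [← MvPolynomial.coe_aeval_eq_eval, RingHom.coe_coe, ← Polynomial.aeval_algHom_apply,
    Polynomial.coe_aeval_eq_eval]

lemma evalPt_expPoly (s : Finset (ℕ × ℕ)) (w : ℝ × ℝ → ℝ) (z : ℝ × ℝ) :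
    evalPt (expPoly s w) z = ∑ i ∈ s, expCoeff w i * expBasis i z := by
  simp [expPoly, evalPt_aeval, expBasis]

lemma aeval_mul_aeval_mem {P R : Polynomial ℝ} {m n : ℕ} (hP : P.natDegree ≤ m)
    (hR : R.natDegree ≤ n) {s : Set (ℕ × ℕ)} (hs : ∀ a b, a ≤ m → b ≤ n → (a, b) ∈ s) :
    Polynomial.aeval (MvPolynomial.X 0) P * Polynomial.aeval (MvPolynomial.X 1) R ∈ polySpan s := by
  rw [Polynomial.aeval_eq_sum_range' (Nat.lt_succ_of_le hP),
    Polynomial.aeval_eq_sum_range' (Nat.lt_succ_of_le hR), Finset.sum_mul_sum]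
  refine Submodule.sum_mem _ fun a ha => Submodule.sum_mem _ fun b hb => ?_
  rw [smul_mul_smul_comm]
  refine Submodule.smul_mem _ _ ?_
  have : (MvPolynomial.X 0 ^ a * MvPolynomial.X 1 ^ b : MvPolynomial (Fin 2) ℝ) = mono a b := by
    rw [mono, expo, MvPolynomial.X_pow_eq_monomial, MvPolynomial.X_pow_eq_monomial,
      MvPolynomial.monomial_mul, mul_one]
  rw [this]
  exact mono_mem_polySpan (hs a b (Nat.lt_succ_iff.1 (Finset.mem_range.1 ha))
    (Nat.lt_succ_iff.1 (Finset.mem_range.1 hb)))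

lemma expPoly_mem {s t : Finset (ℕ × ℕ)}
    (h : ∀ i ∈ s, ∀ a b, a ≤ i.1 → b ≤ i.2 → (a, b) ∈ t) (w : ℝ × ℝ → ℝ) :
    expPoly s w ∈ polySpan (t : Set (ℕ × ℕ)) :=
  Submodule.sum_mem _ fun i hi => Submodule.smul_mem _ _
    (aeval_mul_aeval_mem (natDegree_meanPoly_le _) (natDegree_meanPoly_le _)
      fun a b ha hb => h i hi a b ha hb)

lemma iteratedDeriv_sub_iteratedDeriv {a i : ℕ} (h : a ≤ i) (f : ℝ → ℝ) :
    iteratedDeriv a (iteratedDeriv (i - a) f) = iteratedDeriv i f := by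
  simp only [iteratedDeriv_eq_iterate]
  rw [← Function.iterate_add_apply, Nat.add_sub_cancel' h]

/-- The coefficients of high order of the expansion are bounded by the derivatives. -/
lemma enorm_expCoeff_le {ℓ : ℕ} {p : ℝ≥0∞} (hp : 1 ≤ p) {B : ℝ≥0}
    (hB : ∀ i ∈ Finset.range ℓ, ∀ x ∈ Set.Icc (0 : ℝ) 1, ‖iteratedDeriv i weight x‖ₑ ≤ B)
    {w : ℝ × ℝ → ℝ} (hw : MemSobolev ℓ p w) {i : ℕ × ℕ}
    (h1 : i.1 < ℓ) (h2 : i.2 < ℓ) (hi : ℓ ≤ i.1 + i.2) :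
    ‖expCoeff w i‖ₑ ≤ (B * B : ℝ≥0) *
      ∑ α ∈ Finset.HasAntidiagonal.antidiagonal ℓ, normLp p (weakPartial α.1 α.2 w) := by
  -- Exactly `ℓ` of the `i.1 + i.2` derivatives on the weights are moved to `w`: all those in `x`,
  -- and as many in `y` as are still missing.
  obtain ⟨a, b, hai, hbi, hab⟩ : ∃ a b, a ≤ i.1 ∧ b ≤ i.2 ∧ a + b = ℓ :=
    ⟨i.1, ℓ - i.1, le_rfl, by omega, by omega⟩
  have hwk : IsWeakPartial a b w (weakPartial a b w) := hw.isWeakPartial hab.le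
  have h := hwk.tpair_eq (isUnitTest_weight.iteratedDeriv (i.1 - a))
    (isUnitTest_weight.iteratedDeriv (i.2 - b))
  rw [iteratedDeriv_sub_iteratedDeriv hai, iteratedDeriv_sub_iteratedDeriv hbi] at h
  rw [expCoeff, h, enorm_mul, enorm_mul, enorm_pow, enorm_pow, enorm_neg, enorm_one, one_pow,
    one_pow, one_mul, one_mul]
  have hle : normLp p (weakPartial a b w) ≤
      ∑ α ∈ Finset.HasAntidiagonal.antidiagonal ℓ, normLp p (weakPartial α.1 α.2 w) := by
    have hmem : ((a, b) : ℕ × ℕ) ∈ Finset.HasAntidiagonal.antidiagonal ℓ := by simpa using hab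
    have := Finset.sum_le_sum_of_subset (f := fun α : ℕ × ℕ => normLp p (weakPartial α.1 α.2 w))
      (Finset.singleton_subset_iff.2 hmem)
    rwa [Finset.sum_singleton] at this
  refine le_trans ?_ (mul_le_mul_right ((eLpNorm_one_le_normLp hp
    hwk.aestronglyMeasurable).trans hle) _)
  simp only [tpair, mul_comm (weakPartial a b w _)]
  refine enorm_integral_mul_le fun z hz => ?_
  rw [enorm_mul, ENNReal.coe_mul]
  exact mul_le_mul' (hB _ (Finset.mem_range.2 (by omega)) _ hz.1)
    (hB _ (Finset.mem_range.2 (by omega)) _ hz.2)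

/-- Approximation of `w` by polynomials of total degree less than `ℓ`. -/
lemma exists_normLp_sub_lowExpansion_le {ℓ : ℕ} (hℓ : 1 ≤ ℓ) {p : ℝ≥0∞} (hp : 1 ≤ p)
    (hp' : p ≠ ⊤) : ∃ C : ℝ≥0, ∀ w, MemSobolev ℓ p w →
      normLp p (fun z => w z - evalPt (expPoly
        ((Finset.range ℓ ×ˢ Finset.range ℓ).filter fun i => i.1 + i.2 < ℓ) w) z) ≤
      C * ∑ α ∈ Finset.HasAntidiagonal.antidiagonal ℓ, normLp p (weakPartial α.1 α.2 w) := by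
  obtain ⟨n, rfl⟩ : ∃ n, ℓ = n + 1 := ⟨ℓ - 1, by omega⟩
  obtain ⟨B, hB⟩ := exists_enorm_le_of_continuous
    (fun i => (isUnitTest_weight.iteratedDeriv i).continuous) (n + 1)
  obtain ⟨D, hD⟩ := exists_enorm_le_of_continuous
    (fun i => (meanPoly i).continuous) (n + 1)
  obtain ⟨C, hC1, hC⟩ := exists_normLp_sub_expansion_le n hp hp'
  set sq := Finset.range (n + 1) ×ˢ Finset.range (n + 1) with hsq
  -- `C` bounds the remainder of the full expansion. Every discarded term costs `B * B` for its
  -- coefficient and `D * D` for its basis polynomial.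
  refine ⟨C + sq.card * (B * B * (D * D)), fun w hw => ?_⟩
  set S := ∑ α ∈ Finset.HasAntidiagonal.antidiagonal (n + 1), normLp p (weakPartial α.1 α.2 w)
    with hS
  set H : ℝ × ℝ → ℝ := fun z =>
    ∑ i ∈ sq.filter fun i => ¬ (i.1 + i.2 < n + 1), expCoeff w i * expBasis i z with hH
  have hHc : Continuous H := continuous_finsetSum _ fun i _ =>
    continuous_const.mul (continuous_expBasis i)
  have hHb : normLp p H ≤ (sq.card * (B * B * (D * D)) : ℝ≥0) * S := by
    refine normLp_le_of_enorm_le fun z hz => (enorm_sum_le _ _).trans ?_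
    have hterm : ∀ i ∈ sq.filter fun i => ¬ (i.1 + i.2 < n + 1),
        ‖expCoeff w i * expBasis i z‖ₑ ≤ (B * B : ℝ≥0) * S * (D * D : ℝ≥0) := fun i hi => by
      rw [Finset.mem_filter, hsq, Finset.mem_product] at hi
      obtain ⟨⟨hi1, hi2⟩, hi3⟩ := hi
      rw [enorm_mul]
      refine mul_le_mul' (enorm_expCoeff_le hp hB hw (Finset.mem_range.1 hi1)
        (Finset.mem_range.1 hi2) (not_lt.1 hi3)) ?_
      rw [expBasis, enorm_mul, ENNReal.coe_mul]
      exact mul_le_mul' (hD _ hi1 _ hz.1) (hD _ hi2 _ hz.2)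
    refine (Finset.sum_le_card_nsmul _ _ _ hterm).trans ?_
    refine (nsmul_le_nsmul_left zero_le (Finset.card_filter_le _ _)).trans (le_of_eq ?_)
    rw [nsmul_eq_mul]
    push_cast; ring
  have hsplit : (fun z => w z - evalPt (expPoly (sq.filter fun i => i.1 + i.2 < n + 1) w) z) =
      (fun z => w z - ∑ i ∈ sq, expCoeff w i * expBasis i z) + H := by
    ext z
    rw [evalPt_expPoly, Pi.add_apply, hH,
      ← Finset.sum_filter_add_sum_filter_not sq (fun i => i.1 + i.2 < n + 1)]
    ring
  have hmeas : AEStronglyMeasurable (fun z => w z - ∑ i ∈ sq, expCoeff w i * expBasis i z)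
      (volume.restrict refSquare) :=
    hw.memLp.aestronglyMeasurable.sub (continuous_finsetSum _ fun i _ =>
      continuous_const.mul (continuous_expBasis i)).aestronglyMeasurable
  rw [hsplit]
  refine (eLpNorm_add_le hmeas hHc.aestronglyMeasurable hp).trans ?_
  have hpure : normLp p (weakPartial (n + 1) 0 w) + normLp p (weakPartial 0 (n + 1) w) ≤ S := by
    have hsub : ({(n + 1, 0), (0, n + 1)} : Finset (ℕ × ℕ)) ⊆
        Finset.HasAntidiagonal.antidiagonal (n + 1) := by
      intro i hi
      simp only [Finset.mem_insert, Finset.mem_singleton] at hi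
      rcases hi with rfl | rfl <;> simp
    have := Finset.sum_le_sum_of_subset (f := fun α : ℕ × ℕ => normLp p (weakPartial α.1 α.2 w)) hsub
    rwa [Finset.sum_pair (by simp)] at this
  rw [ENNReal.coe_add, add_mul]
  exact add_le_add ((hC w hw).trans (mul_le_mul_right hpure _)) hHb


end

end ABF

/-! ### Conclusion: quasi-optimality combined with the averaged expansions. -/

theorem mainTheorem3 (k : ℕ) :
    -- the interpolant is well defined
    (∀ (u : ℝ × ℝ → ℝ × ℝ) (w : ℝ × ℝ → ℝ) (g : ABF.Face → ℝ → ℝ),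
      IntegrableOn u ABF.refSquare → IntegrableOn w ABF.refSquare → ABF.IsWeakDiv u w →
      (ABF.IsClassicalNormalTrace u g ∨ ABF.IsWeakNormalTrace u w g) →
      ∃! v : ABF.VecPoly, ABF.IsInterpolant k u w g v) ∧
    -- the estimate with all derivatives of order `ℓ`
    (∀ (ℓ : ℕ) (p : ℝ≥0∞), 1 ≤ ℓ → ℓ ≤ k + 2 → 1 ≤ p → p ≠ ⊤ →
      ∃ C : ℝ≥0, ∀ (u : ℝ × ℝ → ℝ × ℝ) (w : ℝ × ℝ → ℝ) (g : ABF.Face → ℝ → ℝ)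
        (v : ABF.VecPoly),
        IntegrableOn u ABF.refSquare → ABF.IsWeakDiv u w → ABF.MemSobolev ℓ p w →
        (ABF.IsClassicalNormalTrace u g ∨ ABF.IsWeakNormalTrace u w g) →
        ABF.IsInterpolant k u w g v →
        ABF.normLp p (fun z => w z - ABF.divPoly v z)
          ≤ C * ∑ α ∈ Finset.HasAntidiagonal.antidiagonal ℓ, ABF.normLp p (ABF.weakPartial α.1 α.2 w)) ∧
    -- the estimate with the pure derivatives of order `s`
    (∀ (s : ℕ) (p : ℝ≥0∞), 1 ≤ s → s ≤ k + 1 → 1 ≤ p → p ≠ ⊤ →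
      ∃ C : ℝ≥0, ∀ (u : ℝ × ℝ → ℝ × ℝ) (w : ℝ × ℝ → ℝ) (g : ABF.Face → ℝ → ℝ)
        (v : ABF.VecPoly),
        IntegrableOn u ABF.refSquare → ABF.IsWeakDiv u w → ABF.MemSobolev s p w →
        (ABF.IsClassicalNormalTrace u g ∨ ABF.IsWeakNormalTrace u w g) →
        ABF.IsInterpolant k u w g v →
        ABF.normLp p (fun z => w z - ABF.divPoly v z)
          ≤ C * (ABF.normLp p (ABF.weakPartial s 0 w) + ABF.normLp p (ABF.weakPartial 0 s w))) := by
  refine ⟨fun u w g hu hw _ hg => ABF.existsUnique_isInterpolant k hu hw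
      (ABF.integrableOn_normalTrace hg), fun ℓ p hℓ hℓk hp hp' => ?_, fun s p hs hsk hp hp' => ?_⟩
  · obtain ⟨C, -, hC⟩ := ABF.exists_normLp_sub_divPoly_le k hp
    obtain ⟨D, hD⟩ := ABF.exists_normLp_sub_lowExpansion_le hℓ hp hp'
    refine ⟨C * D, fun u w g v hu hdiv hw hg hv => ?_⟩
    -- Total degree below `ℓ ≤ k + 2` means at most `k + 1`, whereas the missing corner monomial has
    -- total degree `2k + 2`.
    have hmem := ABF.expPoly_mem
      (s := (Finset.range ℓ ×ˢ Finset.range ℓ).filter fun i => i.1 + i.2 < ℓ)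
      (t := ABF.divExpo k) (fun i hi a b ha hb => by
        have := (Finset.mem_filter.1 hi).2
        rw [ABF.mem_divExpo]; omega) w
    refine (hC u w g v hu hdiv hw.memLp hg hv _ hmem).trans ?_
    rw [ENNReal.coe_mul, mul_assoc]
    exact mul_le_mul_right (hD w hw) _
  · obtain ⟨n, rfl⟩ : ∃ n, s = n + 1 := ⟨s - 1, by omega⟩
    obtain ⟨C, -, hC⟩ := ABF.exists_normLp_sub_divPoly_le k hp
    obtain ⟨D, -, hD⟩ := ABF.exists_normLp_sub_expansion_le n hp hp'
    refine ⟨C * D, fun u w g v hu hdiv hw hg hv => ?_⟩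
    -- The full expansion has degree `n ≤ k` in each variable and so avoids the corner. For `n = k +
    -- 1` it could contain `x^(k+1) y^(k+1)`, whence the restriction `s ≤ k + 1`.
    have hmem := ABF.expPoly_mem (s := Finset.range (n + 1) ×ˢ Finset.range (n + 1))
      (t := ABF.divExpo k) (fun i hi a b ha hb => by
        rw [Finset.mem_product, Finset.mem_range, Finset.mem_range] at hi
        rw [ABF.mem_divExpo]; omega) w
    refine (hC u w g v hu hdiv hw.memLp hg hv _ hmem).trans ?_
    simp only [ABF.evalPt_expPoly]
    rw [ENNReal.coe_mul, mul_assoc]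
    exact mul_le_mul_right (hD w hw) _
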